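/- **Setting.** Let $\omega$ be a symplectic form on $\mathbb R^2$ and $B$ a real $2\times 2$ matrix with $\omega(B\xi,\eta)=-\omega(\xi,B\eta)$ for all $\xi,\eta$ and $\omega(B\cdot,\cdot)$ definite. The oscillator group $Osc_1(\omega,B)$ is the Lie group $\mathbb R\times\mathbb R^2\times\mathbb R$ with multiplication $$(z,\xi,t)(v,\eta,s)=\bigl(z+v+\tfrac12\omega(\xi,e^{tB}\eta),\ \xi+e^{tB}\eta,\ t+s\bigr),$$ and $H_1(\omega)$ denotes the Heisenberg subgroup $\{(z,\xi,0)\}$. A lattice is a discrete subgroup with compact quotient; automorphisms are automorphisms of Lie groups. For an integer $r\ge 1$ let $\omega_r(\xi,\eta)=r(\xi_1\eta_2-\xi_2\eta_1)$, and for $x\in\mathbb R$, $y>0$ let $$B_{x,y}=\begin{pmatrix}\frac xy&-\frac{x^2}{y}-y\\ \frac1y&-\frac xy\end{pmatrix},\qquad \mathbb F_1=\{(x,y)\in\mathbb R^2: 0\le x\le\tfrac12,\ y>0,\ x^2+y^2\ge1\}.$$ Let $\Gamma_r$ be the subgroup of $Osc_1(\omega_r,B)$ generated by $(1,0,0)$,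 $(0,e_1,0)$, $(0,e_2,0)$, and for $\xi\in\mathbb R^2$ let $L(\xi)=\langle\Gamma_r\cup\{(0,\xi,1)\}\rangle$. **Theorem.** Let $r\ge1$ be an integer, $B=\lambda B_{x,y}$ with $(x,y)\in\mathbb F_1$ and $\lambda=\lambda_0+k\pi$, where $k\in\{0,1,2,\dots\}$ and $\lambda_0\in\{\frac\pi3,\frac\pi2,\frac{2\pi}3,\pi\}$. Let $L=\langle\Gamma_r\cup\{(z,\xi,1)\}\rangle$ (with $z\in\mathbb R$, $\xi\in\mathbb R^2$) be a lattice in $Osc_1(\omega_r,B)$ with $L\cap H_1(\omega_r)=\Gamma_r$. Then there is exactly one $\xi_0$ in the list $\Xi(r,\lambda,x,y)$ below for which there exists an automorphism $\varphi$ of $Osc_1(\omega_r,B)$ with $\varphi(L)=L(\xi_0)$; moreover, for this $\xi_0$, $L(\xi_0)$ is itself a lattice with $L(\xi_0)\cap H_1(\omega_r)=\Gamma_r$. **The list $\Xi(r,\lambda,x,y)$.** Here $j$ runs over $\{0,1,2,\dots\}$ and $p,q$ are integers. - $\lambda=\frac\pi3+2\pi j$, $(x,y)=(\frac12,\frac{\sqrt3}2)$: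 $\{(0,0)\}$ for $r$ even, $\{(\frac1{2r},0)\}$ for $r$ odd. - $\lambda=\frac{5\pi}3+2\pi j$, $(x,y)=(\frac12,\frac{\sqrt3}2)$: $\{(0,0)\}$ for $r$ even, $\{(0,\frac1{2r})\}$ for $r$ odd. - $\lambda=\frac\pi2+2\pi j$ or $\lambda=\frac{3\pi}2+2\pi j$, $(x,y)=(0,1)$: $\{(0,0),(0,\frac1r)\}$ for $r$ even, $\{(0,0)\}$ for $r$ odd. - $\lambda=\frac{2\pi}3+2\pi j$, $(x,y)=(\frac12,\frac{\sqrt3}2)$: for $r$ even, $\{(0,0),(\frac1r,0)\}$ if $3\mid r$ and $\{(0,0)\}$ otherwise; for $r$ odd, $\{(0,\frac1{2r}),(\frac1r,\frac1{2r})\}$ if $3\mid r$ and $\{(0,\frac1{2r})\}$ otherwise. - $\lambda=\frac{4\pi}3+2\pi j$, $(x,y)=(\frac12,\frac{\sqrt3}2)$: for $r$ even, $\{(0,0),(\frac1r,0)\}$ if $3\mid r$ and $\{(0,0)\}$ otherwise; for $r$ odd, $\{(\frac1{2r},0),(\frac1{2r}+\frac1r,0)\}$ if $3\mid r$ and $\{(\frac1{2r},0)\}$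 otherwise. - $\lambda=\pi+2\pi j$: for $r$ odd, $\{(0,0)\}$; for $r$ even, - $\{(0,0),(\frac1r,0),(0,\frac1r),(\frac1r,\frac1r)\}$ if $x^2+y^2>1$, $x\ne\frac12$; - $\{(0,0),(\frac1r,0),(\frac1r,\frac1r)\}$ if $x^2+y^2>1$, $x=\frac12$, or if $x^2+y^2=1$, $x\neq\frac12$; - $\{(0,0),(\frac1r,\frac1r)\}$ if $(x,y)=(\frac12,\frac{\sqrt3}2)$. - $\lambda=2\pi+2\pi j$ ($r$ even or odd): all $(\frac pr,\frac qr)$ such that - if $x^2+y^2>1$, $x\notin\{0,\frac12\}$: $0\le p,q\le\frac r2$, or $0<p<\frac r2<q<r$; - if $x^2+y^2>1$, $x=0$: $0\le p,q\le\frac r2$; - if $x^2+y^2>1$, $x=\frac12$: $0\le p\le\frac q2\le q\le\frac r2$, or $q=0$ and $0\le p\le\frac r2$, or $0<p<\frac r2<q<r$ and $p\le\frac q2$; - if $x^2+y^2=1$, $x\notin\{0,\frac12\}$: $0\le p\le q\le\frac r2$, or $0<p<\frac r2<q<r$ and $p+q\le r$; - if $(x,y)=(0,1)$: $0\le p\le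 q\le\frac r2$; - if $(x,y)=(\frac12,\frac{\sqrt3}2)$: $0\le 2p\le q\le\frac{p+r}2$. -/

import Mathlib

open Real

noncomputable section

namespace OscLattice

/-- The data defining a four-dimensional oscillator group `Osc₁(ω, B)`: a symplectic form `ω` on
`ℝ²` and a matrix `B` with `ω(Bξ, η) = -ω(ξ, Bη)` and `ω(B·, ·)` definite. -/
structure OscData where
  ω : LinearMap.BilinForm ℝ (Fin 2 → ℝ)
  B : Matrix (Fin 2) (Fin 2) ℝ
  alt : ω.IsAlt
  nondegenerate : ω.Nondegenerate
  skew : ∀ ξ η : Fin 2 → ℝ, ω (B.mulVec ξ) η = -ω ξ (B.mulVec η)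
  definite : (∀ ξ : Fin 2 → ℝ, ξ ≠ 0 → 0 < ω (B.mulVec ξ) ξ) ∨
    (∀ ξ : Fin 2 → ℝ, ξ ≠ 0 → ω (B.mulVec ξ) ξ < 0)

/-- `e^{tB} ξ`. -/
def OscData.flow (D : OscData) (t : ℝ) (ξ : Fin 2 → ℝ) : Fin 2 → ℝ :=
  (NormedSpace.exp (t • D.B)).mulVec ξ

lemma OscData.flow_zero (D : OscData) (ξ : Fin 2 → ℝ) : D.flow 0 ξ = ξ := by
  simp [OscData.flow, NormedSpace.exp_zero]

lemma OscData.flow_add (D : OscData) (s t : ℝ) (ξ : Fin 2 → ℝ) :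
    D.flow (s + t) ξ = D.flow s (D.flow t ξ) := by
  unfold OscData.flow
  rw [add_smul, Matrix.exp_add_of_commute _ _
    (((Commute.refl D.B).smul_left s).smul_right t), Matrix.mulVec_mulVec]

lemma OscData.flow_map_add (D : OscData) (t : ℝ) (ξ η : Fin 2 → ℝ) :
    D.flow t (ξ + η) = D.flow t ξ + D.flow t η :=
  Matrix.mulVec_add _ _ _

lemma OscData.flow_map_neg (D : OscData) (t : ℝ) (ξ : Fin 2 → ℝ) :
    D.flow t (-ξ) = -D.flow t ξ :=
  Matrix.mulVec_neg _ _

/-- The matrices `e^{tB}` are symplectic. -/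
lemma OscData.flow_symplectic (D : OscData) (t : ℝ) (ξ η : Fin 2 → ℝ) :
    D.ω (D.flow t ξ) (D.flow t η) = D.ω ξ η := by
  set J : Matrix (Fin 2) (Fin 2) ℝ := LinearMap.BilinForm.toMatrix' D.ω with hJ
  have hω : ∀ a b : Fin 2 → ℝ, D.ω a b = a ⬝ᵥ J.mulVec b := by
    intro a b
    rw [← Matrix.toBilin'_apply', hJ, Matrix.toBilin'_toMatrix']
  have hdet : J.det ≠ 0 := by
    apply LinearMap.BilinForm.nondegenerate_toBilin'_iff_det_ne_zero.mp
    rw [hJ, Matrix.toBilin'_toMatrix']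
    exact D.nondegenerate
  have hu : IsUnit J := (Matrix.isUnit_iff_isUnit_det _).mpr hdet.isUnit
  have hu' : IsUnit J.det := hdet.isUnit
  have hskew : D.B.transpose * J = -(J * D.B) := by
    apply Matrix.ext_of_mulVec_single
    intro j
    apply dotProduct_eq
    intro w
    rw [dotProduct_comm _ w, dotProduct_comm _ w]
    have h := D.skew w (Pi.single j 1)
    rw [hω, hω] at h
    rw [← Matrix.mulVec_mulVec, Matrix.neg_mulVec, ← Matrix.mulVec_mulVec, dotProduct_neg, ← h,
      Matrix.dotProduct_mulVec, Matrix.vecMul_transpose]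
  have hexp : (NormedSpace.exp (t • D.B)).transpose * J = J * NormedSpace.exp (-(t • D.B)) := by
    have h1 : (t • D.B).transpose = J * (-(t • D.B)) * J⁻¹ := by
      rw [Matrix.mul_neg, Matrix.mul_smul, ← smul_neg, ← hskew, Matrix.smul_mul,
        Matrix.mul_nonsing_inv_cancel_right _ _ hu', Matrix.transpose_smul]
    rw [← Matrix.exp_transpose, h1, Matrix.exp_conj _ _ hu,
      Matrix.nonsing_inv_mul_cancel_right _ _ hu']
  have hinv : NormedSpace.exp (-(t • D.B)) * NormedSpace.exp (t • D.B) = 1 := by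
    have hc : Commute (-(t • D.B)) (t • D.B) := (Commute.refl (t • D.B)).neg_left
    rw [← Matrix.exp_add_of_commute _ _ hc, neg_add_cancel, NormedSpace.exp_zero]
  unfold OscData.flow
  rw [hω, hω, ← Matrix.vecMul_transpose, ← Matrix.dotProduct_mulVec, Matrix.mulVec_mulVec,
    Matrix.mulVec_mulVec, hexp, Matrix.mul_assoc, hinv, Matrix.mul_one]

/-- The underlying set `ℝ × ℝ² × ℝ` of the oscillator group. -/
@[ext] structure Osc (D : OscData) where
  z : ℝ
  ξ : Fin 2 → ℝ
  t : ℝ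

namespace Osc

variable {D : OscData}

instance : Mul (Osc D) :=
  ⟨fun g h => ⟨g.z + h.z + 1 / 2 * D.ω g.ξ (D.flow g.t h.ξ), g.ξ + D.flow g.t h.ξ, g.t + h.t⟩⟩

instance : One (Osc D) := ⟨⟨0, 0, 0⟩⟩

instance : Inv (Osc D) := ⟨fun g => ⟨-g.z, -D.flow (-g.t) g.ξ, -g.t⟩⟩

@[simp] lemma mul_z (g h : Osc D) : (g * h).z = g.z + h.z + 1 / 2 * D.ω g.ξ (D.flow g.t h.ξ) := rfl
@[simp] lemma mul_ξ (g h : Osc D) : (g * h).ξ = g.ξ + D.flow g.t h.ξ := rfl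
@[simp] lemma mul_t (g h : Osc D) : (g * h).t = g.t + h.t := rfl
@[simp] lemma one_z : (1 : Osc D).z = 0 := rfl
@[simp] lemma one_ξ : (1 : Osc D).ξ = 0 := rfl
@[simp] lemma one_t : (1 : Osc D).t = 0 := rfl
@[simp] lemma inv_z (g : Osc D) : (g⁻¹).z = -g.z := rfl
@[simp] lemma inv_ξ (g : Osc D) : (g⁻¹).ξ = -D.flow (-g.t) g.ξ := rfl
@[simp] lemma inv_t (g : Osc D) : (g⁻¹).t = -g.t := rfl

/-- The oscillator group `Osc₁(ω, B)`. -/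
instance : Group (Osc D) :=
  Group.ofLeftAxioms
    (by
      intro a b c
      ext1
      · simp only [mul_z, mul_ξ, mul_t, D.flow_map_add, D.flow_add, map_add, LinearMap.add_apply,
          D.flow_symplectic]
        ring
      · simp only [mul_ξ, mul_t, D.flow_map_add, D.flow_add, add_assoc]
      · simp only [mul_t, add_assoc])
    (by
      intro a
      ext1 <;> simp [D.flow_zero])
    (by
      intro a
      ext1
      · simp only [mul_z, inv_z, inv_ξ, inv_t, one_z, map_neg, LinearMap.neg_apply]
        rw [D.alt.self_eq_zero]
        ring
      · simp
      · simp)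

/-- The topology of `ℝ × ℝ² × ℝ`, which makes `Osc₁(ω, B)` a Lie group. -/
instance : TopologicalSpace (Osc D) :=
  TopologicalSpace.induced (fun g => (g.z, g.ξ, g.t)) inferInstance

variable (D)

/-- The Heisenberg group `H₁(ω) = {(z, ξ, 0)}` as a subgroup of `Osc₁(ω, B)`. -/
def heisenberg : Subgroup (Osc D) where
  carrier := {g | g.t = 0}
  one_mem' := rfl
  mul_mem' := by
    intro a b ha hb
    simp only [Set.mem_ofPred_eq] at ha hb
    simp [ha, hb]
  inv_mem' := by
    intro a ha
    simp only [Set.mem_ofPred_eq] at ha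
    simp [ha]

/-- The subgroup generated by `(1, 0, 0)`, `(0, e₁, 0)` and `(0, e₂, 0)`. -/
def Γ : Subgroup (Osc D) :=
  Subgroup.closure {⟨1, 0, 0⟩, ⟨0, ![1, 0], 0⟩, ⟨0, ![0, 1], 0⟩}

/-- The subgroup `⟨Γ ∪ {(z, ξ, 1)}⟩`. -/
def generated (z : ℝ) (ξ : Fin 2 → ℝ) : Subgroup (Osc D) :=
  Subgroup.closure ((Γ D : Set (Osc D)) ∪ {⟨z, ξ, 1⟩})

variable {D}

/-- A lattice is a discrete subgroup with compact quotient. -/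
def IsLattice (L : Subgroup (Osc D)) : Prop :=
  DiscreteTopology L ∧ CompactSpace (Osc D ⧸ L)

/-- `L'` is the image of `L` under an automorphism of `Osc₁(ω, B)`. Automorphisms of a Lie group
are the continuous ones (they are automatically smooth). -/
def Equivalent (L L' : Subgroup (Osc D)) : Prop :=
  ∃ φ : Osc D ≃ₜ* Osc D, L.map (φ.toMulEquiv : Osc D →* Osc D) = L'

end Osc

/-- The symplectic form `ω_r(ξ, η) = r (ξ₁ η₂ - ξ₂ η₁)`. -/
def stdForm (r : ℕ) : LinearMap.BilinForm ℝ (Fin 2 → ℝ) :=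
  Matrix.toBilin' !![0, (r : ℝ); -(r : ℝ), 0]

/-- The matrix `B_{x,y}`. -/
def Bmat (x y : ℝ) : Matrix (Fin 2) (Fin 2) ℝ :=
  !![x / y, -(x ^ 2 / y) - y; 1 / y, -(x / y)]

lemma stdForm_apply (r : ℕ) (ξ η : Fin 2 → ℝ) :
    stdForm r ξ η = r * (ξ 0 * η 1 - ξ 1 * η 0) := by
  simp [stdForm, Matrix.toBilin'_apply, Fin.sum_univ_two]
  ring

/-- The data of the group `Osc₁(ω_r, λ B_{x,y})`, for `r ≥ 1`, `λ > 0` and `y > 0`. -/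
def stdData {r : ℕ} (hr : 0 < r) {lam : ℝ} (hlam : 0 < lam) (x : ℝ) {y : ℝ} (hy : 0 < y) :
    OscData where
  ω := stdForm r
  B := lam • Bmat x y
  alt := by
    intro ξ
    rw [stdForm_apply]
    ring
  nondegenerate := by
    apply LinearMap.BilinForm.nondegenerate_toBilin'_of_det_ne_zero'
    simp [Matrix.det_fin_two, hr.ne']
  skew := by
    intro ξ η
    simp only [stdForm_apply, Bmat, Matrix.smul_mulVec, Matrix.mulVec, dotProduct,
      Fin.sum_univ_two, Pi.smul_apply, smul_eq_mul, Matrix.of_apply, Matrix.cons_val_zero,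
      Matrix.cons_val_one]
    ring
  definite := by
    right
    intro ξ hξ
    have hr' : (0 : ℝ) < r := by exact_mod_cast hr
    have key : stdForm r ((lam • Bmat x y).mulVec ξ) ξ
        = -(r * lam / y * ((ξ 0 - x * ξ 1) ^ 2 + (y * ξ 1) ^ 2)) := by
      simp only [stdForm_apply, Bmat, Matrix.smul_mulVec, Matrix.mulVec, dotProduct,
        Fin.sum_univ_two, Pi.smul_apply, smul_eq_mul, Matrix.of_apply, Matrix.cons_val_zero,
        Matrix.cons_val_one]
      field_simp
      ring
    have hpos : 0 < (ξ 0 - x * ξ 1) ^ 2 + (y * ξ 1) ^ 2 := by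
      by_cases h1 : ξ 1 = 0
      · have h0 : ξ 0 ≠ 0 := by
          intro h0
          apply hξ
          ext i
          fin_cases i
          · exact h0
          · exact h1
        rw [h1]
        have := sq_pos_of_ne_zero h0
        simpa using this
      · have := mul_ne_zero hy.ne' h1
        positivity
    rw [key]
    have : 0 < r * lam / y * ((ξ 0 - x * ξ 1) ^ 2 + (y * ξ 1) ^ 2) := by positivity
    linarith

/-- The set `F₁`, half of the standard fundamental domain of the modular group. -/
def F₁ : Set (ℝ × ℝ) := {p | 0 ≤ p.1 ∧ p.1 ≤ 1 / 2 ∧ 0 < p.2 ∧ 1 ≤ p.1 ^ 2 + p.2 ^ 2}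

/-- The numbers `λ₀ + kπ` with `λ₀ ∈ {π/3, π/2, 2π/3, π}` and `k ∈ {0, 1, 2, …}`. -/
def angles : Set ℝ :=
  {lam | ∃ lam₀ ∈ ({1 / 3 * π, 1 / 2 * π, 2 / 3 * π, π} : Set ℝ), ∃ k : ℕ, lam = lam₀ + k * π}

lemma angles_pos {lam : ℝ} (h : lam ∈ angles) : 0 < lam := by
  obtain ⟨lam₀, h₀, k, rfl⟩ := h
  have hπ := pi_pos
  have hk : 0 ≤ (k : ℝ) * π := by positivity
  simp only [Set.mem_insert_iff, Set.mem_singleton_iff] at h₀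
  rcases h₀ with rfl | rfl | rfl | rfl <;> linarith

/-- `lam = θ + 2πj` for some `j ∈ {0, 1, 2, …}`. -/
def AngleMod (θ lam : ℝ) : Prop := ∃ j : ℕ, lam = θ + 2 * π * j

/-- The points `(k/r, l/r)` with integers `k, l` satisfying `P`. -/
def gridPoints (r : ℕ) (P : ℤ → ℤ → Prop) : Set (Fin 2 → ℝ) :=
  {ξ | ∃ k l : ℤ, P k l ∧ ξ = ![(k : ℝ) / r, (l : ℝ) / r]}

/-- `E` if `r` is even and `O` if `r` is odd. -/
def byParity (r : ℕ) (E O : Set (Fin 2 → ℝ)) : Set (Fin 2 → ℝ) := if Even r then E else O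

/-- `T` if `3` divides `r` and `N` otherwise. -/
def byThree (r : ℕ) (T N : Set (Fin 2 → ℝ)) : Set (Fin 2 → ℝ) := if 3 ∣ r then T else N

/-- The list of representatives `ξ₀`, one clause for every row of the table. Here `c = 1/r` and
`h = 1/(2r)`. -/
def xiList (r : ℕ) (lam x y : ℝ) : Set (Fin 2 → ℝ) :=
  let c : ℝ := 1 / (r : ℝ)
  let h : ℝ := 1 / (2 * (r : ℝ))
  {ξ |
    (AngleMod (1 / 3 * π) lam ∧ x = 1 / 2 ∧ y = √3 / 2 ∧
      ξ ∈ byParity r {![0, 0]} {![h, 0]}) ∨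
    (AngleMod (5 / 3 * π) lam ∧ x = 1 / 2 ∧ y = √3 / 2 ∧
      ξ ∈ byParity r {![0, 0]} {![0, h]}) ∨
    (AngleMod (1 / 2 * π) lam ∧ x = 0 ∧ y = 1 ∧
      ξ ∈ byParity r {![0, 0], ![0, c]} {![0, 0]}) ∨
    (AngleMod (3 / 2 * π) lam ∧ x = 0 ∧ y = 1 ∧
      ξ ∈ byParity r {![0, 0], ![0, c]} {![0, 0]}) ∨
    (AngleMod (2 / 3 * π) lam ∧ x = 1 / 2 ∧ y = √3 / 2 ∧
      ξ ∈ byParity r (byThree r {![0, 0], ![c, 0]} {![0, 0]})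
        (byThree r {![0, h], ![c, h]} {![0, h]})) ∨
    (AngleMod (4 / 3 * π) lam ∧ x = 1 / 2 ∧ y = √3 / 2 ∧
      ξ ∈ byParity r (byThree r {![0, 0], ![c, 0]} {![0, 0]})
        (byThree r {![h, 0], ![h + c, 0]} {![h, 0]})) ∨
    (AngleMod π lam ∧ 1 < x ^ 2 + y ^ 2 ∧ x ≠ 1 / 2 ∧
      ξ ∈ byParity r {![0, 0], ![c, 0], ![0, c], ![c, c]} {![0, 0]}) ∨
    (AngleMod π lam ∧ 1 < x ^ 2 + y ^ 2 ∧ x = 1 / 2 ∧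
      ξ ∈ byParity r {![0, 0], ![c, 0], ![c, c]} {![0, 0]}) ∨
    (AngleMod π lam ∧ x ^ 2 + y ^ 2 = 1 ∧ x ≠ 1 / 2 ∧
      ξ ∈ byParity r {![0, 0], ![c, 0], ![c, c]} {![0, 0]}) ∨
    (AngleMod π lam ∧ x = 1 / 2 ∧ y = √3 / 2 ∧
      ξ ∈ byParity r {![0, 0], ![c, c]} {![0, 0]}) ∨
    (AngleMod (2 * π) lam ∧ 1 < x ^ 2 + y ^ 2 ∧ x ≠ 0 ∧ x ≠ 1 / 2 ∧
      ξ ∈ gridPoints r (fun k l => 0 ≤ k ∧ 0 ≤ l ∧ 2 * k ≤ r ∧ 2 * l ≤ r) ∪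
        gridPoints r (fun k l => 0 < k ∧ 2 * k < r ∧ r < 2 * l ∧ l < r)) ∨
    (AngleMod (2 * π) lam ∧ 1 < x ^ 2 + y ^ 2 ∧ x = 0 ∧
      ξ ∈ gridPoints r (fun k l => 0 ≤ k ∧ 0 ≤ l ∧ 2 * k ≤ r ∧ 2 * l ≤ r)) ∨
    (AngleMod (2 * π) lam ∧ 1 < x ^ 2 + y ^ 2 ∧ x = 1 / 2 ∧
      ξ ∈ gridPoints r (fun k l => 0 ≤ k ∧ 2 * k ≤ l ∧ 2 * l ≤ r) ∪
        gridPoints r (fun k l => 0 ≤ k ∧ 2 * k ≤ r ∧ l = 0) ∪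
        gridPoints r (fun k l => 0 < k ∧ 2 * k < r ∧ r < 2 * l ∧ l < r ∧ 2 * k ≤ l)) ∨
    (AngleMod (2 * π) lam ∧ x ^ 2 + y ^ 2 = 1 ∧ x ≠ 0 ∧ x ≠ 1 / 2 ∧
      ξ ∈ gridPoints r (fun k l => 0 ≤ k ∧ k ≤ l ∧ 2 * l ≤ r) ∪
        gridPoints r (fun k l => 0 < k ∧ 2 * k < r ∧ r < 2 * l ∧ l < r ∧ k + l ≤ r)) ∨
    (AngleMod (2 * π) lam ∧ x = 0 ∧ y = 1 ∧
      ξ ∈ gridPoints r (fun k l => 0 ≤ k ∧ k ≤ l ∧ 2 * l ≤ r)) ∨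
    (AngleMod (2 * π) lam ∧ x = 1 / 2 ∧ y = √3 / 2 ∧
      ξ ∈ gridPoints r (fun k l => 0 ≤ 2 * k ∧ 2 * k ≤ l ∧ 2 * l ≤ k + r))}

end OscLattice

end

noncomputable section

namespace OscLattice

/-! Write `A = e^B`. Since `B_{x,y}² = -1`, the flow is a rotation for the complex structure
`B_{x,y}`: `e^{tB} = cos(tλ) + sin(tλ) B_{x,y}`. If `L` meets the Heisenberg group in `Γ`, its last
generator normalizes `Γ`. This forces `A ∈ SL₂(ℤ)` and `ξ = u / 2r` with `u ∈ ℤ²` subject to the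
parity conditions `Compat r A u` (`exists_matrix_of_inf_heisenberg`). The coordinate `z` carries no
information, because `(z, ξ, t) ↦ (z + κt, ξ, t)` is an automorphism. Hence a lattice is encoded by
`u` alone.

The Heisenberg group consists of products of commutators, so automorphisms preserve it. On it they
have the form `(z, η) ↦ (μz + ω(ζ, Sη), Sη)`, and the same `ζ` controls the image of the time axis
(`exists_form_of_aut`). If such a map carries one lattice to another, then `S ∈ GL₂(ℤ)`, `μ = det S
= ±1`, `S` commutes or anticommutes with `B` according to this sign, and `ζ = s / 2r` with `Compat r
S s`. Following the last generator turns equivalence into `u' = Su + (1 - A)s + 2rm` if `det S = 1`,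
and `u' = -ASu + (1 - A)s + 2rm` if `det S = -1`. This is `Rel`; the two directions are
`equivalent_of_rel` and `rel_of_equivalent`. By `classification_of_transversal` it remains to show
that the list is a system of representatives for `Rel`.

For `(x, y)` in `F₁` the only symmetries `S` are `±1`, apart from a few extra ones on the boundary
`x = 0`, `x = 1/2`, `x² + y² = 1` (`comm_cases`, `anti_cases`). Unless `sin λ = 0`, integrality of
`A` forces `(x, y)` to be the square or the hexagonal point.

If `A = 1`, then `(1 - A)s` vanishes, and a fundamental domain is needed for a finite group acting
on `(ℤ/r)²`. If `A = -1`, then `1 - A = 2`: everything collapses for odd `r`, and for even `r`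
orbits in `(ℤ/2)²` remain. If `A` has order 6, 4 or 3, then `det(1 - A)` is 1, 2 or 3, so `(1 -
A)2ℤ²` has that index in `2ℤ²` and the only possible invariant is a coordinate sum modulo the index.
Translations by `2rℤ²` destroy it unless the index divides `r`; for order 3 it survives only up to
sign. -/

lemma Bmat_mul_self (x : ℝ) {y : ℝ} (hy : 0 < y) : Bmat x y * Bmat x y = -1 := by
  ext i j
  fin_cases i <;> fin_cases j <;> simp [Bmat, Matrix.mul_apply, Fin.sum_univ_two] <;>
    field_simp <;> ring

/-- As `B_{x,y}² = -1`, there is a continuous algebra map from `ℂ` with `i ↦ B_{x,y}`; it carries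
Euler's formula over to matrices. -/
lemma exp_smul_Bmat (x : ℝ) {y : ℝ} (hy : 0 < y) (θ : ℝ) :
    NormedSpace.exp (θ • Bmat x y) = cos θ • (1 : Matrix (Fin 2) (Fin 2) ℝ) + sin θ • Bmat x y := by
  let _ : NormedRing (Matrix (Fin 2) (Fin 2) ℝ) := Matrix.linftyOpNormedRing
  let _ : NormedAlgebra ℝ (Matrix (Fin 2) (Fin 2) ℝ) := Matrix.linftyOpNormedAlgebra
  let f : ℂ →ₐ[ℝ] Matrix (Fin 2) (Fin 2) ℝ := Complex.lift ⟨Bmat x y, Bmat_mul_self x hy⟩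
  have hf : Continuous f := f.toLinearMap.continuous_of_finiteDimensional
  have hf' : ∀ w : ℂ, f w = w.re • (1 : Matrix (Fin 2) (Fin 2) ℝ) + w.im • Bmat x y := by
    intro w
    simp [f, Complex.lift_apply, Complex.liftAux_apply, Algebra.algebraMap_eq_smul_one]
  have h := NormedSpace.map_exp f hf ((θ : ℂ) * Complex.I)
  rw [hf', hf'] at h
  simp only [Complex.mul_re, Complex.ofReal_re, Complex.I_re, mul_zero, Complex.ofReal_im,
    Complex.I_im, mul_one, sub_self, zero_smul, zero_add, Complex.mul_im, add_zero] at h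
  refine h.symm.trans ?_
  rw [← Complex.exp_eq_exp_ℂ, Complex.exp_ofReal_mul_I_re, Complex.exp_ofReal_mul_I_im]

section

variable {r : ℕ} (hr : 0 < r) {lam : ℝ} (hlam : 0 < lam) (x : ℝ) {y : ℝ} (hy : 0 < y)

lemma stdData_flow (t : ℝ) (ξ : Fin 2 → ℝ) :
    (stdData hr hlam x hy).flow t ξ =
      cos (t * lam) • ξ + sin (t * lam) • (Bmat x y).mulVec ξ := by
  have : t • (stdData hr hlam x hy).B = (t * lam) • Bmat x y := by
    simp [stdData, smul_smul]
  rw [OscData.flow, this, exp_smul_Bmat x hy, Matrix.add_mulVec, Matrix.smul_mulVec,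
    Matrix.smul_mulVec, Matrix.one_mulVec]

lemma stdData_ω (ξ η : Fin 2 → ℝ) :
    (stdData hr hlam x hy).ω ξ η = r * (ξ 0 * η 1 - ξ 1 * η 0) :=
  stdForm_apply r ξ η

end

/-! ### Integer matrices, the grid `u / 2r` and parity conditions. -/

lemma OscData.flow_zero_right (D : OscData) (t : ℝ) : D.flow t 0 = 0 :=
  Matrix.mulVec_zero _

lemma OscData.flow_flow_neg (D : OscData) (t : ℝ) (ξ : Fin 2 → ℝ) :
    D.flow t (D.flow (-t) ξ) = ξ := by
  rw [← D.flow_add, add_neg_cancel, D.flow_zero]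

/-- An integer matrix as a real matrix. -/
def realMat (M : Matrix (Fin 2) (Fin 2) ℤ) : Matrix (Fin 2) (Fin 2) ℝ := M.map (Int.cast : ℤ → ℝ)

lemma realMat_mulVec (M : Matrix (Fin 2) (Fin 2) ℤ) (ξ : Fin 2 → ℝ) :
    (realMat M).mulVec ξ = ![M 0 0 * ξ 0 + M 0 1 * ξ 1, M 1 0 * ξ 0 + M 1 1 * ξ 1] := by
  ext i
  fin_cases i <;> simp [realMat, Matrix.mulVec, dotProduct, Fin.sum_univ_two]

/-- The point `u / (2r)`. -/
def halfGrid (r : ℕ) (u : Fin 2 → ℤ) : Fin 2 → ℝ := fun i => u i / (2 * r)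

/-- The congruences which say that `(z, η) ↦ (det M z + ω_r(u / 2r, M η), M η)` preserves the
lattice `Γ_r` of the Heisenberg group. -/
def Compat (r : ℕ) (M : Matrix (Fin 2) (Fin 2) ℤ) (u : Fin 2 → ℤ) : Prop :=
  2 ∣ u 0 * M 1 0 - u 1 * M 0 0 - r * (M 0 0 * M 1 0) ∧
    2 ∣ u 0 * M 1 1 - u 1 * M 0 1 - r * (M 0 1 * M 1 1)

lemma even_sub_sq (a : ℤ) : (2 : ℤ) ∣ a - a * a := by
  have := (Int.even_mul_pred_self a).two_dvd
  have h : a - a * a = -(a * (a - 1)) := by ring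
  rw [h]
  exact (dvd_neg).mpr this

/-- Modulo 2 the expression is linear in `(a, b)`: squares agree with their roots, and the
coefficient of `ab` is `-2 r M₀₁ M₁₀`. So the two conditions at `e₁` and `e₂` in `Compat` suffice.
-/
lemma Compat.two_dvd {r : ℕ} {M : Matrix (Fin 2) (Fin 2) ℤ} {u : Fin 2 → ℤ} (h : Compat r M u)
    (a b : ℤ) :
    2 ∣ u 0 * (M 1 0 * a + M 1 1 * b) - u 1 * (M 0 0 * a + M 0 1 * b) +
      r * (M.det * (a * b) - (M 0 0 * a + M 0 1 * b) * (M 1 0 * a + M 1 1 * b)) := by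
  obtain ⟨⟨k, hk⟩, ⟨l, hl⟩⟩ := h
  obtain ⟨m, hm⟩ := even_sub_sq a
  obtain ⟨n, hn⟩ := even_sub_sq b
  rw [Matrix.det_fin_two]
  refine ⟨a * k + b * l + r * M 0 0 * M 1 0 * m + r * M 0 1 * M 1 1 * n
    - r * M 0 1 * M 1 0 * a * b, ?_⟩
  linear_combination a * hk + b * hl + r * M 0 0 * M 1 0 * hm + r * M 0 1 * M 1 1 * hn

/-! ### Coordinates on `Γ` and integrality of maps preserving it. -/

namespace Osc

variable {D : OscData}

lemma horizontal_zpow (v : Fin 2 → ℝ) (n : ℤ) :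
    (⟨0, v, 0⟩ : Osc D) ^ n = ⟨0, (n : ℝ) • v, 0⟩ := by
  have key : ∀ a b : ℝ, (⟨0, a • v, 0⟩ : Osc D) * ⟨0, b • v, 0⟩ = ⟨0, (a + b) • v, 0⟩ := by
    intro a b
    ext1
    · simp [D.flow_zero, D.alt.self_eq_zero]
    · simp [D.flow_zero, add_smul]
    · simp
  induction n using Int.induction_on with
  | zero => ext1 <;> simp
  | succ n ih =>
    rw [zpow_add_one, ih]
    have := key (n : ℤ) 1
    simp only [one_smul] at this
    rw [this]
    push_cast
    rfl
  | pred n ih =>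
    rw [zpow_sub_one, ih]
    have hinv : (⟨0, v, 0⟩ : Osc D)⁻¹ = ⟨0, (-1 : ℝ) • v, 0⟩ := by
      ext1 <;> simp [D.flow_zero]
    rw [hinv, key]
    push_cast
    rw [sub_eq_add_neg]

lemma central_zpow (n : ℤ) : (⟨1, 0, 0⟩ : Osc D) ^ n = ⟨n, 0, 0⟩ := by
  induction n using Int.induction_on with
  | zero => ext1 <;> simp
  | succ n ih =>
    rw [zpow_add_one, ih]
    ext1 <;> simp [D.flow_zero]
  | pred n ih =>
    rw [zpow_sub_one, ih]
    ext1 <;> simp [D.flow_zero, sub_eq_add_neg]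

lemma mem_Γ_iff {r : ℕ} (hω : ∀ ξ η, D.ω ξ η = r * (ξ 0 * η 1 - ξ 1 * η 0)) {g : Osc D} :
    g ∈ Γ D ↔ g.t = 0 ∧ ∃ a b n : ℤ, g.ξ = ![(a : ℝ), (b : ℝ)] ∧ g.z = n + r * (a * b) / 2 := by
  constructor
  · intro hg
    induction hg using Subgroup.closure_induction with
    | mem g hg =>
      simp only [Set.mem_insert_iff, Set.mem_singleton_iff] at hg
      rcases hg with rfl | rfl | rfl
      · exact ⟨rfl, 0, 0, 1, by ext i; fin_cases i <;> simp, by simp⟩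
      · exact ⟨rfl, 1, 0, 0, by simp, by simp⟩
      · exact ⟨rfl, 0, 1, 0, by simp, by simp⟩
    | one => exact ⟨rfl, 0, 0, 0, by ext i; fin_cases i <;> simp, by simp⟩
    | mul g h _ _ ihg ihh =>
      obtain ⟨hg, a, b, n, hξ, hz⟩ := ihg
      obtain ⟨hh, a', b', n', hξ', hz'⟩ := ihh
      -- Moving `e₂^b` past `e₁^{a'}` costs the central integer `r b a'`, which keeps the
      -- half-integral part in the form `r (a + a')(b + b') / 2`.
      refine ⟨by simp [hg, hh], a + a', b + b', n + n' - r * (b * a'), ?_, ?_⟩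
      · rw [mul_ξ, hg, D.flow_zero, hξ, hξ']
        simp
      · rw [mul_z, hg, D.flow_zero, hω, hξ, hξ', hz, hz']
        simp only [Matrix.cons_val_zero, Matrix.cons_val_one]
        push_cast
        ring
    | inv g _ ih =>
      obtain ⟨hg, a, b, n, hξ, hz⟩ := ih
      refine ⟨by simp [hg], -a, -b, -n - r * (a * b), ?_, ?_⟩
      · rw [inv_ξ, hg, neg_zero, D.flow_zero, hξ]
        simp
      · rw [inv_z, hz]
        push_cast
        ring
  · rintro ⟨ht, a, b, n, hξ, hz⟩
    have h1 : (⟨1, 0, 0⟩ : Osc D) ∈ Γ D := Subgroup.subset_closure (by simp)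
    have h2 : (⟨0, ![1, 0], 0⟩ : Osc D) ∈ Γ D := Subgroup.subset_closure (by simp)
    have h3 : (⟨0, ![0, 1], 0⟩ : Osc D) ∈ Γ D := Subgroup.subset_closure (by simp)
    have h := mul_mem (mul_mem (zpow_mem h1 n) (zpow_mem h2 a)) (zpow_mem h3 b)
    rw [central_zpow, horizontal_zpow, horizontal_zpow] at h
    convert h using 1
    ext1
    · simp [D.flow_zero, hω, hz]
      ring
    · simp [D.flow_zero, hξ]
    · simp [ht]

lemma mem_heisenberg {g : Osc D} : g ∈ heisenberg D ↔ g.t = 0 := Iff.rfl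

lemma Γ_le_heisenberg : Γ D ≤ heisenberg D := by
  rw [Γ, Subgroup.closure_le]
  intro g hg
  simp only [Set.mem_insert_iff, Set.mem_singleton_iff] at hg
  rcases hg with rfl | rfl | rfl <;> rfl

instance heisenberg_normal : (heisenberg D).Normal :=
  ⟨fun g hg h => by
    rw [mem_heisenberg] at hg ⊢
    simp [hg]⟩

/-- Integrality of a map of the form `(z, η) ↦ (det M z + ω_r(u / 2r, M η), M η)`. -/
lemma mem_Γ_congr {r : ℕ} (hr : 0 < r) (hω : ∀ ξ η, D.ω ξ η = r * (ξ 0 * η 1 - ξ 1 * η 0))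
    {M : Matrix (Fin 2) (Fin 2) ℤ} (hM : M.det = 1 ∨ M.det = -1) {u : Fin 2 → ℤ}
    (h : Compat r M u) {g g' : Osc D} (hg : g.t = 0) (hg' : g'.t = 0)
    (hξ : g'.ξ = (realMat M).mulVec g.ξ)
    (hz : g'.z = M.det * g.z + D.ω (halfGrid r u) g'.ξ) :
    g' ∈ Γ D ↔ g ∈ Γ D := by
  have hr' : (r : ℝ) ≠ 0 := by exact_mod_cast hr.ne'
  have hsq : (M.det : ℝ) * M.det = 1 := by
    rcases hM with h | h <;> simp [h]
  rw [mem_Γ_iff hω, mem_Γ_iff hω]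
  simp only [hg, hg', true_and]
  rw [realMat_mulVec] at hξ
  have key : ∀ a b : ℤ, g.ξ = ![(a : ℝ), (b : ℝ)] → ∃ k : ℤ, D.ω (halfGrid r u) g'.ξ =
      k - r * (M.det * (a * b)) / 2 +
        r * (((M 0 0 * a + M 0 1 * b : ℤ) : ℝ) * (M 1 0 * a + M 1 1 * b : ℤ)) / 2 := by
    intro a b hab
    obtain ⟨k, hk⟩ := h.two_dvd a b
    refine ⟨k, ?_⟩
    have hk' := congrArg (Int.cast : ℤ → ℝ) hk
    push_cast at hk'
    rw [hω, hξ, hab]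
    simp only [halfGrid, Matrix.cons_val_zero, Matrix.cons_val_one]
    push_cast
    field_simp
    linarith
  constructor
  · rintro ⟨a', b', n, hξ', hz'⟩
    rw [hξ'] at hξ
    have e0 := congrFun hξ 0
    have e1 := congrFun hξ 1
    simp only [Matrix.cons_val_zero, Matrix.cons_val_one] at e0 e1
    have hd : (M.det : ℝ) = M 0 0 * M 1 1 - M 0 1 * M 1 0 := by
      rw [Matrix.det_fin_two]
      push_cast
      ring
    -- Since `det M = ±1`, the inverse of `M` is `det M` times its adjugate, so `g.ξ` is again
    -- integral.
    have hab : g.ξ = ![((M.det * (M 1 1 * a' - M 0 1 * b') : ℤ) : ℝ),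
        ((M.det * (M 0 0 * b' - M 1 0 * a') : ℤ) : ℝ)] := by
      ext i
      fin_cases i
      · simp only [Fin.zero_eta, Matrix.cons_val_zero]
        simp only [Int.cast_mul, Int.cast_sub]
        rw [e0, e1]
        linear_combination (-g.ξ 0) * hsq + M.det * g.ξ 0 * hd
      · simp only [Fin.mk_one, Matrix.cons_val_one, Matrix.cons_val_zero]
        simp only [Int.cast_mul, Int.cast_sub]
        rw [e0, e1]
        linear_combination (-g.ξ 1) * hsq + M.det * g.ξ 1 * hd
    generalize M.det * (M 1 1 * a' - M 0 1 * b') = a at hab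
    generalize M.det * (M 0 0 * b' - M 1 0 * a') = b at hab
    obtain ⟨k, hk⟩ := key a b hab
    refine ⟨a, b, M.det * (n - k), hab, ?_⟩
    rw [hk] at hz
    have ea : (a' : ℝ) = ((M 0 0 * a + M 0 1 * b : ℤ) : ℝ) := by
      rw [e0, hab]
      simp
    have eb : (b' : ℝ) = ((M 1 0 * a + M 1 1 * b : ℤ) : ℝ) := by
      rw [e1, hab]
      simp
    rw [hz', ea, eb] at hz
    rw [Int.cast_mul, Int.cast_sub]
    linear_combination (-(M.det : ℝ)) * hz - (g.z - r * (a * b) / 2) * hsq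
  · rintro ⟨a, b, n, hab, hgz⟩
    obtain ⟨k, hk⟩ := key a b hab
    refine ⟨M 0 0 * a + M 0 1 * b, M 1 0 * a + M 1 1 * b, M.det * n + k, ?_, ?_⟩
    · rw [hξ, hab]
      push_cast
      simp
    · rw [hz, hk, hgz]
      push_cast
      ring

/-- A linear map which preserves `Γ_r` is given by an integer matrix. -/
lemma exists_int_of_preserves_Γ {r : ℕ} (hω : ∀ ξ η, D.ω ξ η = r * (ξ 0 * η 1 - ξ 1 * η 0))
    {S : Matrix (Fin 2) (Fin 2) ℝ} {f : (Fin 2 → ℝ) → ℝ}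
    (h : ∀ η, (⟨0, η, 0⟩ : Osc D) ∈ Γ D → (⟨f η, S.mulVec η, 0⟩ : Osc D) ∈ Γ D) :
    ∃ M : Matrix (Fin 2) (Fin 2) ℤ, S = realMat M ∧
      ∃ k : Fin 2 → ℤ, f ![1, 0] = k 0 + r * (M 0 0 * M 1 0) / 2 ∧
        f ![0, 1] = k 1 + r * (M 0 1 * M 1 1) / 2 := by
  have h1 := h ![1, 0] (Subgroup.subset_closure (by simp))
  have h2 := h ![0, 1] (Subgroup.subset_closure (by simp))
  rw [mem_Γ_iff hω] at h1 h2
  obtain ⟨-, a, c, n, hac, hn⟩ := h1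
  obtain ⟨-, b, d, m, hbd, hm⟩ := h2
  refine ⟨!![a, b; c, d], ?_, ![n, m], by simpa using hn, by simpa using hm⟩
  have a1 := congrFun hac 0
  have a2 := congrFun hac 1
  have a3 := congrFun hbd 0
  have a4 := congrFun hbd 1
  simp [Matrix.mulVec, dotProduct, Fin.sum_univ_two] at a1 a2 a3 a4
  ext i j
  fin_cases i <;> fin_cases j <;> simp [realMat, a1, a2, a3, a4]

/-- Solving the integrality conditions for the vector `ζ` when `f = ω_r(ζ, M ·)`. -/
lemma exists_compat {r : ℕ} (hr : 0 < r) (hω : ∀ ξ η, D.ω ξ η = r * (ξ 0 * η 1 - ξ 1 * η 0))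
    {M : Matrix (Fin 2) (Fin 2) ℤ} (hM : M.det = 1 ∨ M.det = -1) {ζ : Fin 2 → ℝ} {k : Fin 2 → ℤ}
    (h1 : D.ω ζ ((realMat M).mulVec ![1, 0]) = k 0 + r * (M 0 0 * M 1 0) / 2)
    (h2 : D.ω ζ ((realMat M).mulVec ![0, 1]) = k 1 + r * (M 0 1 * M 1 1) / 2) :
    ∃ u, ζ = halfGrid r u ∧ Compat r M u := by
  have hr' : (r : ℝ) ≠ 0 := by exact_mod_cast hr.ne'
  have hsq : (M.det : ℝ) * M.det = 1 := by
    rcases hM with h | h <;> simp [h]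
  have hsqz : M.det * M.det = 1 := by
    rcases hM with h | h <;> simp [h]
  have hd : (M.det : ℝ) = M 0 0 * M 1 1 - M 0 1 * M 1 0 := by
    rw [Matrix.det_fin_two]
    push_cast
    ring
  have hdz := M.det_fin_two
  rw [realMat_mulVec, hω] at h1 h2
  simp at h1 h2
  -- Cramer's rule: the hypotheses prescribe the pairings of `2rζ` with the columns of `M` as
  -- integers, and the determinant of `M` is a unit.
  have hu : ζ = halfGrid r
      ![M.det * (-M 0 1 * (2 * k 0 + r * (M 0 0 * M 1 0)) +
          M 0 0 * (2 * k 1 + r * (M 0 1 * M 1 1))),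
        M.det * (-M 1 1 * (2 * k 0 + r * (M 0 0 * M 1 0)) +
          M 1 0 * (2 * k 1 + r * (M 0 1 * M 1 1)))] := by
    ext i
    fin_cases i
    · simp [halfGrid]
      field_simp
      linear_combination (-2 * r * ζ 0) * hsq + 2 * r * ζ 0 * M.det * hd
        + M.det * 2 * (-M 0 1) * h1 + M.det * 2 * M 0 0 * h2
    · simp [halfGrid]
      field_simp
      linear_combination (-2 * r * ζ 1) * hsq + 2 * r * ζ 1 * M.det * hd
        + M.det * 2 * (-M 1 1) * h1 + M.det * 2 * M 1 0 * h2
  refine ⟨_, hu, ⟨k 0, ?_⟩, ⟨k 1, ?_⟩⟩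
  · simp only [Matrix.cons_val_zero, Matrix.cons_val_one]
    linear_combination (2 * k 0 + r * (M 0 0 * M 1 0)) * hsqz
      - M.det * (2 * k 0 + r * (M 0 0 * M 1 0)) * hdz
  · simp only [Matrix.cons_val_zero, Matrix.cons_val_one]
    linear_combination (2 * k 1 + r * (M 0 1 * M 1 1)) * hsqz
      - M.det * (2 * k 1 + r * (M 0 1 * M 1 1)) * hdz

end Osc

/-- The data `D` has the form `ω = ω_r`, `B = λ B_{x,y}`, expressed through the flow. -/
structure IsStd (D : OscData) (r : ℕ) (lam x y : ℝ) : Prop where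
  r_pos : 0 < r
  lam_pos : 0 < lam
  y_pos : 0 < y
  ω : ∀ ξ η, D.ω ξ η = r * (ξ 0 * η 1 - ξ 1 * η 0)
  flow : ∀ t ξ, D.flow t ξ = cos (t * lam) • ξ + sin (t * lam) • (Bmat x y).mulVec ξ

lemma isStd_stdData {r : ℕ} (hr : 0 < r) {lam : ℝ} (hlam : 0 < lam) (x : ℝ) {y : ℝ} (hy : 0 < y) :
    IsStd (stdData hr hlam x hy) r lam x y :=
  ⟨hr, hlam, hy, stdData_ω hr hlam x hy, stdData_flow hr hlam x hy⟩

/-- The relation on vectors `u ∈ ℤ²` which says that the lattices `L(u / 2r)` are equivalent. -/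
def Rel (r : ℕ) (x y : ℝ) (A : Matrix (Fin 2) (Fin 2) ℤ) (u u' : Fin 2 → ℤ) : Prop :=
  ∃ (S : Matrix (Fin 2) (Fin 2) ℤ) (s m : Fin 2 → ℤ), Compat r S s ∧
    ((S.det = 1 ∧ realMat S * Bmat x y = Bmat x y * realMat S ∧
        u' = S.mulVec u + s - A.mulVec s + (2 * r : ℤ) • m) ∨
      (S.det = -1 ∧ realMat S * Bmat x y = -(Bmat x y * realMat S) ∧
        u' = -A.mulVec (S.mulVec u) + s - A.mulVec s + (2 * r : ℤ) • m))

/-! ### Arithmetic of the grid `u / 2r`. -/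

lemma realMat_mul (M N : Matrix (Fin 2) (Fin 2) ℤ) : realMat (M * N) = realMat M * realMat N :=
  Matrix.map_mul_intCast M N

lemma realMat_one : realMat 1 = 1 := by
  ext i j
  fin_cases i <;> fin_cases j <;> simp [realMat]

lemma realMat_mulVec_halfGrid (r : ℕ) (M : Matrix (Fin 2) (Fin 2) ℤ) (u : Fin 2 → ℤ) :
    (realMat M).mulVec (halfGrid r u) = halfGrid r (M.mulVec u) := by
  rw [realMat_mulVec]
  ext i
  fin_cases i <;> simp [halfGrid, Matrix.mulVec, dotProduct, Fin.sum_univ_two] <;> ring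

lemma halfGrid_add (r : ℕ) (u v : Fin 2 → ℤ) :
    halfGrid r (u + v) = halfGrid r u + halfGrid r v := by
  ext i
  simp [halfGrid, add_div]

lemma halfGrid_neg (r : ℕ) (u : Fin 2 → ℤ) : halfGrid r (-u) = -halfGrid r u := by
  ext i
  simp [halfGrid, neg_div]

lemma halfGrid_sub (r : ℕ) (u v : Fin 2 → ℤ) :
    halfGrid r (u - v) = halfGrid r u - halfGrid r v := by
  rw [sub_eq_add_neg, halfGrid_add, halfGrid_neg, ← sub_eq_add_neg]

lemma halfGrid_smul {r : ℕ} (hr : 0 < r) (m : Fin 2 → ℤ) :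
    halfGrid r ((2 * r : ℤ) • m) = ![(m 0 : ℝ), (m 1 : ℝ)] := by
  have hr' : (r : ℝ) ≠ 0 := by exact_mod_cast hr.ne'
  ext i
  fin_cases i <;> simp [halfGrid] <;> field_simp

lemma halfGrid_injective {r : ℕ} (hr : 0 < r) : Function.Injective (halfGrid r) := by
  have hr' : (r : ℝ) ≠ 0 := by exact_mod_cast hr.ne'
  intro u v h
  ext i
  have := congrFun h i
  simp only [halfGrid] at this
  field_simp at this
  exact_mod_cast this

namespace Osc

variable {D : OscData} {r : ℕ} {lam x y : ℝ}

/-! ### The generated subgroups -/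

/-- The two contributions `½ω` add up by antisymmetry. For `l.t = 1` and `e^B` integral, conjugation
thus has the shape treated in `mem_Γ_congr`. -/
lemma conj_eq (l g : Osc D) (hg : g.t = 0) :
    l * g * l⁻¹ = ⟨g.z + D.ω l.ξ (D.flow l.t g.ξ), D.flow l.t g.ξ, 0⟩ := by
  have h := D.alt.neg_eq (D.flow l.t g.ξ) l.ξ
  ext1
  · simp only [mul_z, mul_ξ, mul_t, inv_z, inv_ξ, hg, add_zero, D.flow_map_neg, D.flow_flow_neg,
      map_add, map_neg, LinearMap.add_apply, D.alt.self_eq_zero]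
    linear_combination (1 / 2) * h
  · simp only [mul_ξ, mul_t, inv_ξ, hg, add_zero, D.flow_map_neg, D.flow_flow_neg]
    abel
  · simp [hg]

lemma mem_normalizer_Γ (hD : IsStd D r lam x y) {A : Matrix (Fin 2) (Fin 2) ℤ} (hA : A.det = 1)
    (hflow : ∀ ξ, D.flow 1 ξ = (realMat A).mulVec ξ) {u : Fin 2 → ℤ} (hu : Compat r A u) (z : ℝ) :
    (⟨z, halfGrid r u, 1⟩ : Osc D) ∈ Subgroup.normalizer (Γ D : Set (Osc D)) := by
  rw [Subgroup.mem_normalizer_iff]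
  intro h
  by_cases ht : h.t = 0
  · rw [conj_eq _ _ ht]
    exact (mem_Γ_congr hD.r_pos hD.ω (Or.inl hA) hu ht rfl (hflow _) (by simp [hA])).symm
  · constructor
    · intro hh
      exact absurd (Γ_le_heisenberg hh) ht
    · intro hh
      have := Γ_le_heisenberg hh
      rw [mem_heisenberg] at this
      simp at this
      exact absurd this ht

lemma generated_eq_sup (z : ℝ) (ξ : Fin 2 → ℝ) :
    generated D z ξ = Γ D ⊔ Subgroup.zpowers ⟨z, ξ, 1⟩ := by
  rw [generated, Subgroup.closure_union, Subgroup.closure_eq, Subgroup.zpowers_eq_closure]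

lemma Γ_le_generated (z : ℝ) (ξ : Fin 2 → ℝ) : Γ D ≤ generated D z ξ := by
  rw [generated_eq_sup]
  exact le_sup_left

lemma mk_mem_generated (z : ℝ) (ξ : Fin 2 → ℝ) : (⟨z, ξ, 1⟩ : Osc D) ∈ generated D z ξ :=
  Subgroup.subset_closure (by simp)

/-- The generator normalizes `Γ`, so the join of `Γ` with its powers is a product set. -/
lemma exists_of_mem_generated {z : ℝ} {ξ : Fin 2 → ℝ}
    (hl : (⟨z, ξ, 1⟩ : Osc D) ∈ Subgroup.normalizer (Γ D : Set (Osc D))) {g : Osc D}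
    (hg : g ∈ generated D z ξ) : ∃ γ ∈ Γ D, ∃ n : ℤ, g = γ * (⟨z, ξ, 1⟩ : Osc D) ^ n := by
  have hle : Subgroup.zpowers (⟨z, ξ, 1⟩ : Osc D) ≤ Subgroup.normalizer (Γ D : Set (Osc D)) := by
    rwa [Subgroup.zpowers_le]
  rw [generated_eq_sup, ← SetLike.mem_coe, sup_comm,
    Subgroup.coe_mul_of_left_le_normalizer_right _ _ hle] at hg
  obtain ⟨_, ⟨n, rfl⟩, γ, hγ, rfl⟩ := hg
  refine ⟨_, ((Subgroup.mem_normalizer_iff.mp (zpow_mem hl n)) γ).mp hγ, n, by simp⟩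

/-- The time coordinate as a homomorphism. -/
def tHom (D : OscData) : Osc D →* Multiplicative ℝ where
  toFun g := Multiplicative.ofAdd g.t
  map_one' := rfl
  map_mul' _ _ := rfl

lemma zpow_t (g : Osc D) (n : ℤ) : (g ^ n).t = n * g.t := by
  have := map_zpow (tHom D) g n
  have := congrArg Multiplicative.toAdd this
  simpa [tHom] using this

lemma generated_inf_heisenberg {z : ℝ} {ξ : Fin 2 → ℝ}
    (hl : (⟨z, ξ, 1⟩ : Osc D) ∈ Subgroup.normalizer (Γ D : Set (Osc D))) :
    generated D z ξ ⊓ heisenberg D = Γ D := by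
  apply le_antisymm
  · rintro g ⟨hg, ht⟩
    obtain ⟨γ, hγ, n, rfl⟩ := exists_of_mem_generated hl hg
    have h := Γ_le_heisenberg hγ
    replace ht := mem_heisenberg.mp ht
    rw [mem_heisenberg] at h
    simp only [mul_t, zpow_t, h, zero_add, mul_one, Int.cast_eq_zero] at ht
    simpa [ht] using hγ
  · exact le_inf (Γ_le_generated z ξ) Γ_le_heisenberg

/-- The Heisenberg group is normal, so `L` normalizes its intersection with it. -/
lemma mem_normalizer_of_inf_heisenberg {L : Subgroup (Osc D)} (h : L ⊓ heisenberg D = Γ D)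
    {l : Osc D} (hl : l ∈ L) : l ∈ Subgroup.normalizer (Γ D : Set (Osc D)) := by
  rw [Subgroup.mem_normalizer_iff]
  intro g
  rw [← h, Subgroup.mem_inf, Subgroup.mem_inf]
  refine and_congr ?_ ?_
  · rw [Subgroup.mul_mem_cancel_right _ (inv_mem hl), Subgroup.mul_mem_cancel_left _ hl]
  · simp [mem_heisenberg]

/-! ### Equivalence of subgroups -/

lemma Equivalent.symm {L L' : Subgroup (Osc D)} (h : Equivalent L L') : Equivalent L' L := by
  obtain ⟨φ, rfl⟩ := h
  refine ⟨φ.symm, ?_⟩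
  rw [Subgroup.map_map]
  convert Subgroup.map_id L
  ext1 g
  exact φ.symm_apply_apply g

lemma Equivalent.trans {L₁ L₂ L₃ : Subgroup (Osc D)} (h : Equivalent L₁ L₂)
    (h' : Equivalent L₂ L₃) : Equivalent L₁ L₃ := by
  obtain ⟨φ, rfl⟩ := h
  obtain ⟨ψ, rfl⟩ := h'
  refine ⟨φ.trans ψ, ?_⟩
  rw [Subgroup.map_map]
  rfl

lemma Equivalent.isLattice {L L' : Subgroup (Osc D)} (h : Equivalent L L') (hL : IsLattice L) :
    IsLattice L' := by
  obtain ⟨φ, rfl⟩ := h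
  obtain ⟨h1, h2⟩ := hL
  constructor
  · let e : L.map (φ.toMulEquiv : Osc D →* Osc D) → L :=
      fun g => ⟨φ.symm g, by
        obtain ⟨_, l, hl, rfl⟩ := g
        exact (φ.symm_apply_apply l).symm ▸ hl⟩
    have he : Continuous e := by
      apply Continuous.subtype_mk
      exact φ.symm.continuous.comp continuous_subtype_val
    have hinj : Function.Injective e := by
      intro a b hab
      have := congrArg Subtype.val hab
      exact Subtype.ext (φ.symm.injective this)
    exact DiscreteTopology.of_continuous_injective he hinj
  · have hmap : ∀ a b : Osc D, QuotientGroup.leftRel L a b →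
        (QuotientGroup.mk (φ a) : Osc D ⧸ L.map (φ.toMulEquiv : Osc D →* Osc D)) =
          QuotientGroup.mk (φ b) := by
      intro a b hab
      rw [QuotientGroup.leftRel_apply] at hab
      rw [QuotientGroup.eq]
      refine ⟨a⁻¹ * b, hab, ?_⟩
      rw [← map_inv, ← map_mul]
      rfl
    let f : Osc D ⧸ L → Osc D ⧸ L.map (φ.toMulEquiv : Osc D →* Osc D) :=
      Quotient.lift (fun a => QuotientGroup.mk (φ a)) hmap
    have hf : Continuous f :=
      Continuous.quotient_lift (continuous_quot_mk.comp φ.continuous) hmap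
    have hs : Function.Surjective f := by
      intro q
      obtain ⟨g, rfl⟩ := QuotientGroup.mk_surjective q
      exact ⟨QuotientGroup.mk (φ.symm g), congrArg QuotientGroup.mk (φ.apply_symm_apply g)⟩
    exact hs.compactSpace hf

/-- Neither multiplying the last generator by an element of `Γ` nor inverting it changes the
subgroup generated together with `Γ`. -/
lemma equivalent_generated {φ : Osc D ≃ₜ* Osc D} (hφ : ∀ g, φ g ∈ Γ D ↔ g ∈ Γ D)
    {z z' : ℝ} {ξ ξ' : Fin 2 → ℝ} {γ : Osc D} (hγ : γ ∈ Γ D)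
    (h : φ ⟨z, ξ, 1⟩ = γ * ⟨z', ξ', 1⟩ ∨ (φ ⟨z, ξ, 1⟩)⁻¹ = γ * ⟨z', ξ', 1⟩) :
    Equivalent (generated D z ξ) (generated D z' ξ') := by
  refine ⟨φ, ?_⟩
  have hΓ : (Γ D).map (φ.toMulEquiv : Osc D →* Osc D) = Γ D := by
    ext g
    rw [Subgroup.mem_map]
    constructor
    · rintro ⟨g, hg, rfl⟩
      exact (hφ g).mpr hg
    · intro hg
      exact ⟨φ.symm g, (hφ _).mp ((φ.apply_symm_apply g).symm ▸ hg), φ.apply_symm_apply g⟩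
  rw [generated_eq_sup, generated_eq_sup, Subgroup.map_sup, hΓ, MonoidHom.map_zpowers]
  have hz : ∀ l' : Osc D, Γ D ⊔ Subgroup.zpowers (γ * l') = Γ D ⊔ Subgroup.zpowers l' := by
    intro l'
    apply le_antisymm
    · refine sup_le le_sup_left ?_
      rw [Subgroup.zpowers_le]
      exact Subgroup.mul_mem_sup hγ (Subgroup.mem_zpowers l')
    · refine sup_le le_sup_left ?_
      rw [Subgroup.zpowers_le]
      have := Subgroup.mul_mem (Γ D ⊔ Subgroup.zpowers (γ * l'))
        (Subgroup.mem_sup_left (inv_mem hγ))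
        (Subgroup.mem_sup_right (Subgroup.mem_zpowers (γ * l')))
      simpa using this
  rw [← hz ⟨z', ξ', 1⟩]
  rcases h with h | h
  · rw [← h]
    rfl
  · rw [← h, Subgroup.zpowers_inv]
    rfl

/-! ### Automorphisms -/

lemma continuous_coords : Continuous fun g : Osc D => (g.z, g.ξ, g.t) :=
  continuous_induced_dom

lemma continuous_z : Continuous fun g : Osc D => g.z := continuous_fst.comp continuous_coords

lemma continuous_ξ : Continuous fun g : Osc D => g.ξ :=
  continuous_fst.comp (continuous_snd.comp continuous_coords)

lemma continuous_t : Continuous fun g : Osc D => g.t :=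
  continuous_snd.comp (continuous_snd.comp continuous_coords)

lemma continuous_mk {X : Type*} [TopologicalSpace X] {f h : X → ℝ} {g : X → Fin 2 → ℝ}
    (hf : Continuous f) (hg : Continuous g) (hh : Continuous h) :
    Continuous fun a => (⟨f a, g a, h a⟩ : Osc D) :=
  continuous_induced_rng.mpr (hf.prodMk (hg.prodMk hh))

/-- The automorphism `(z, ξ, t) ↦ (c z + κ t, S ξ, c t)` with inverse matrix `T`, where `c = ±1`. -/
def linearAut (S T : Matrix (Fin 2) (Fin 2) ℝ) (hST : S * T = 1) (hTS : T * S = 1) (c κ : ℝ)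
    (hc : c * c = 1) (hω : ∀ ξ η, D.ω (S.mulVec ξ) (S.mulVec η) = c * D.ω ξ η)
    (hflow : ∀ t ξ, S.mulVec (D.flow t ξ) = D.flow (c * t) (S.mulVec ξ)) : Osc D ≃ₜ* Osc D where
  toFun g := ⟨c * g.z + κ * g.t, S.mulVec g.ξ, c * g.t⟩
  invFun g := ⟨c * g.z - κ * g.t, T.mulVec g.ξ, c * g.t⟩
  left_inv g := by
    ext1
    · simp only
      linear_combination g.z * hc
    · simp only [Matrix.mulVec_mulVec, hTS, Matrix.one_mulVec]
    · simp only
      linear_combination g.t * hc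
  right_inv g := by
    ext1
    · simp only
      linear_combination g.z * hc
    · simp only [Matrix.mulVec_mulVec, hST, Matrix.one_mulVec]
    · simp only
      linear_combination g.t * hc
  map_mul' g h := by
    ext1
    · simp only [mul_z, mul_t]
      rw [← hflow, hω]
      ring
    · simp only [mul_ξ]
      rw [← hflow, Matrix.mulVec_add]
    · simp only [mul_t]
      ring
  continuous_toFun := continuous_mk
    ((continuous_const.mul continuous_z).add (continuous_const.mul continuous_t))
    (Continuous.matrix_mulVec continuous_const continuous_ξ) (continuous_const.mul continuous_t)
  continuous_invFun := continuous_mk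
    ((continuous_const.mul continuous_z).sub (continuous_const.mul continuous_t))
    (Continuous.matrix_mulVec continuous_const continuous_ξ) (continuous_const.mul continuous_t)

lemma continuous_conj (hD : IsStd D r lam x y) (ζ : Fin 2 → ℝ) :
    Continuous fun g : Osc D => (⟨0, ζ, 0⟩ : Osc D) * g * (⟨0, ζ, 0⟩ : Osc D)⁻¹ := by
  have h1 : ∀ v : Fin 2 → ℝ, Continuous fun g : Osc D => D.flow g.t v := by
    intro v
    simp only [hD.flow]
    have := continuous_t (D := D)
    fun_prop
  have h2 := h1 (-D.flow (-0) ζ)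
  refine continuous_induced_rng.mpr (Continuous.prodMk ?_ (Continuous.prodMk ?_ ?_))
  · have := continuous_z (D := D)
    have := continuous_ξ (D := D)
    simp only [mul_z, mul_ξ, mul_t, inv_z, inv_ξ, D.flow_zero, zero_add, neg_zero, hD.ω] at h2 ⊢
    fun_prop
  · have := continuous_ξ (D := D)
    simp only [mul_ξ, mul_t, inv_ξ, D.flow_zero, zero_add, neg_zero] at h2 ⊢
    fun_prop
  · have := continuous_t (D := D)
    simp only [mul_t, inv_t]
    fun_prop

/-- Conjugation by `(0, ζ, 0)`. -/
def conjAut (hD : IsStd D r lam x y) (ζ : Fin 2 → ℝ) : Osc D ≃ₜ* Osc D where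
  __ := MulAut.conj (⟨0, ζ, 0⟩ : Osc D)
  continuous_toFun := continuous_conj hD ζ
  continuous_invFun := by
    have h := continuous_conj hD (-ζ)
    have h1 : (⟨0, -ζ, 0⟩ : Osc D) = (⟨0, ζ, 0⟩ : Osc D)⁻¹ := by
      ext1 <;> simp [D.flow_zero]
    rw [h1] at h
    convert h using 2
    rw [inv_inv]
    rfl

/-- In `cos + sin · B` the cosine is even and the sine odd, so passing `S` through `B` with sign `c`
amounts to replacing `t` by `ct`. -/
lemma flow_intertwine (hD : IsStd D r lam x y) {S : Matrix (Fin 2) (Fin 2) ℝ} {c : ℝ}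
    (hc : c = 1 ∨ c = -1) (hS : S * Bmat x y = c • (Bmat x y * S)) (t : ℝ) (ξ : Fin 2 → ℝ) :
    S.mulVec (D.flow t ξ) = D.flow (c * t) (S.mulVec ξ) := by
  rw [hD.flow, hD.flow, Matrix.mulVec_add, Matrix.mulVec_smul, Matrix.mulVec_smul,
    Matrix.mulVec_mulVec, hS, Matrix.smul_mulVec, Matrix.mulVec_mulVec]
  rcases hc with rfl | rfl
  · rw [one_smul, one_mul]
  · rw [neg_one_mul, neg_mul, cos_neg, sin_neg, neg_one_smul, smul_neg, neg_smul]

/-- The required automorphism is `S` extended linearly, followed by conjugation with `(0, s / 2r,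
0)`; `Compat r S s` makes it preserve `Γ`. For `det S = -1` the image of the generator has time
`-1`, and inverting it produces the factor `-A` in `Rel`. -/
lemma equivalent_of_rel (hD : IsStd D r lam x y) {A : Matrix (Fin 2) (Fin 2) ℤ}
    (hflow : ∀ ξ, D.flow 1 ξ = (realMat A).mulVec ξ) {u u' : Fin 2 → ℤ}
    (h : Rel r x y A u u') (z z' : ℝ) :
    Equivalent (generated D z (halfGrid r u)) (generated D z' (halfGrid r u')) := by
  obtain ⟨S, s, m, hs, h⟩ := h
  obtain ⟨c, hc, hdet, hSB⟩ : ∃ c : ℤ, (c = 1 ∨ c = -1) ∧ S.det = c ∧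
      realMat S * Bmat x y = (c : ℝ) • (Bmat x y * realMat S) := by
    rcases h with ⟨h1, h2, -⟩ | ⟨h1, h2, -⟩
    · exact ⟨1, Or.inl rfl, h1, by simp [h2]⟩
    · exact ⟨-1, Or.inr rfl, h1, by simp [h2]⟩
  have hcc : c * c = 1 := by rcases hc with rfl | rfl <;> rfl
  have hcc' : (c : ℝ) * c = 1 := by exact_mod_cast hcc
  have hc' : (c : ℝ) = 1 ∨ (c : ℝ) = -1 := by
    rcases hc with rfl | rfl <;> simp
  have hST : S * (c • S.adjugate) = 1 := by
    rw [Matrix.mul_smul, Matrix.mul_adjugate, hdet, smul_smul, hcc, one_smul]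
  have hTS : (c • S.adjugate) * S = 1 := by
    rw [Matrix.smul_mul, Matrix.adjugate_mul, hdet, smul_smul, hcc, one_smul]
  have hST' : realMat S * realMat (c • S.adjugate) = 1 := by
    rw [← realMat_mul, hST, realMat_one]
  have hTS' : realMat (c • S.adjugate) * realMat S = 1 := by
    rw [← realMat_mul, hTS, realMat_one]
  have hω : ∀ ξ η, D.ω ((realMat S).mulVec ξ) ((realMat S).mulVec η) = c * D.ω ξ η := by
    intro ξ η
    have hd : (c : ℝ) = S 0 0 * S 1 1 - S 0 1 * S 1 0 := by
      rw [← hdet, Matrix.det_fin_two]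
      push_cast
      ring
    rw [hD.ω, hD.ω, realMat_mulVec, realMat_mulVec, hd]
    simp only [Matrix.cons_val_zero, Matrix.cons_val_one]
    ring
  set ζ := halfGrid r s with hζ
  set l : Osc D := ⟨z, halfGrid r u, 1⟩ with hl
  -- This element absorbs the translation by `2rm`; the central coordinate is the one that puts it
  -- in `Γ`.
  set γ : Osc D := ⟨r * (m 0 * m 1) / 2, -![(m 0 : ℝ), (m 1 : ℝ)], 0⟩ with hγ
  have hγΓ : γ ∈ Γ D := by
    rw [mem_Γ_iff hD.ω]
    exact ⟨rfl, -m 0, -m 1, 0, by simp [hγ], by simp [hγ]⟩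
  -- The shear `κ` stays free: it acts trivially where `t = 0` and is chosen at the end to match the
  -- prescribed `z` and `z'`.
  let ψ : ℝ → Osc D ≃ₜ* Osc D := fun κ =>
    (linearAut (realMat S) (realMat (c • S.adjugate)) hST' hTS' c κ hcc' hω
      (flow_intertwine hD hc' hSB)).trans (conjAut hD ζ)
  have hψ : ∀ κ g, ψ κ g = (⟨0, ζ, 0⟩ : Osc D) *
      ⟨c * g.z + κ * g.t, (realMat S).mulVec g.ξ, c * g.t⟩ * (⟨0, ζ, 0⟩ : Osc D)⁻¹ :=
    fun _ _ => rfl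
  have hpres : ∀ κ g, ψ κ g ∈ Γ D ↔ g ∈ Γ D := by
    intro κ g
    rw [hψ]
    by_cases ht : g.t = 0
    · rw [conj_eq _ _ (by simp [ht])]
      refine mem_Γ_congr hD.r_pos hD.ω (by rwa [hdet]) hs ht rfl ?_ ?_
      · simp [D.flow_zero]
      · simp [D.flow_zero, hdet, ht, hζ]
    · have hc0 : (c : ℝ) ≠ 0 := by
        rintro h0
        simp [h0] at hcc'
      constructor
      · intro hg
        have := Γ_le_heisenberg hg
        simp only [mem_heisenberg, mul_t, inv_t, zero_add, neg_zero, add_zero, mul_eq_zero] at this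
        exact absurd this (by simp [hc0, ht])
      · intro hg
        exact absurd (Γ_le_heisenberg hg) ht
  have hz : ∀ κ, (ψ κ l).z = (ψ 0 l).z + κ := by
    intro κ
    rw [hψ, hψ]
    simp only [hl, mul_z, mul_ξ, mul_t, inv_z, inv_ξ]
    ring
  have hξ : ∀ κ, (ψ κ l).ξ = ζ + (realMat S).mulVec (halfGrid r u) - D.flow c ζ := by
    intro κ
    rw [hψ]
    simp [hl, D.flow_zero, sub_eq_add_neg, D.flow_map_neg]
  have ht : ∀ κ, (ψ κ l).t = c := by
    intro κ
    rw [hψ]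
    simp [hl]
  rcases h with ⟨h1, -, h2⟩ | ⟨h1, -, h2⟩
  · have hc1 : c = 1 := hdet.symm.trans h1
    refine equivalent_generated (hpres ((γ * ⟨z', halfGrid r u', 1⟩).z - (ψ 0 l).z)) hγΓ
      (Or.inl ?_)
    ext1
    · rw [← hl, hz]
      ring
    · rw [← hl, hξ, hc1, Int.cast_one, hflow, hζ, realMat_mulVec_halfGrid, realMat_mulVec_halfGrid,
        h2, halfGrid_add, halfGrid_sub, halfGrid_add, halfGrid_smul hD.r_pos, mul_ξ, hγ]
      simp only [D.flow_zero]
      abel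
    · rw [← hl, ht, hc1]
      simp [hγ]
  · have hc1 : c = -1 := hdet.symm.trans h1
    refine equivalent_generated (hpres (-(γ * ⟨z', halfGrid r u', 1⟩).z - (ψ 0 l).z)) hγΓ
      (Or.inr ?_)
    ext1
    · rw [← hl, inv_z, hz]
      ring
    · rw [← hl, inv_ξ, ht, hξ, hc1, Int.cast_neg, Int.cast_one, neg_neg, sub_eq_add_neg,
        D.flow_map_add, D.flow_map_neg, D.flow_flow_neg, D.flow_map_add, hflow, hflow,
        hζ, realMat_mulVec_halfGrid, realMat_mulVec_halfGrid, realMat_mulVec_halfGrid,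
        h2, halfGrid_add, halfGrid_sub, halfGrid_add, halfGrid_neg, halfGrid_smul hD.r_pos, mul_ξ,
        hγ]
      simp only [D.flow_zero]
      abel
    · rw [← hl, inv_t, ht, hc1]
      simp [hγ]

end Osc

/-! ### Commuting and anticommuting with `B_{x,y}` in terms of entries. -/

lemma comm_Bmat_iff {x y : ℝ} (hy : 0 < y) {S : Matrix (Fin 2) (Fin 2) ℤ} :
    realMat S * Bmat x y = Bmat x y * realMat S ↔
      (S 0 1 : ℝ) = -(x ^ 2 + y ^ 2) * S 1 0 ∧ (S 1 1 : ℝ) = S 0 0 - 2 * x * S 1 0 := by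
  rw [← Matrix.ext_iff]
  simp only [Fin.forall_fin_two, Matrix.mul_apply, Fin.sum_univ_two, Bmat, realMat, Matrix.map_apply,
    Matrix.of_apply, Matrix.cons_val_zero, Matrix.cons_val_one]
  field_simp
  constructor
  · rintro ⟨⟨h1, -⟩, h2, -⟩
    exact ⟨by linear_combination h1, by linear_combination h2⟩
  · rintro ⟨h1, h2⟩
    rw [h1, h2]
    refine ⟨⟨?_, ?_⟩, ?_, ?_⟩ <;> ring

lemma anti_Bmat_iff {x y : ℝ} (hy : 0 < y) {S : Matrix (Fin 2) (Fin 2) ℤ} :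
    realMat S * Bmat x y = -(Bmat x y * realMat S) ↔
      (S 0 1 : ℝ) = (x ^ 2 + y ^ 2) * S 1 0 - 2 * x * S 0 0 ∧ (S 1 1 : ℝ) = -S 0 0 := by
  rw [← Matrix.ext_iff]
  simp only [Fin.forall_fin_two, Matrix.mul_apply, Fin.sum_univ_two, Bmat, realMat, Matrix.map_apply,
    Matrix.of_apply, Matrix.cons_val_zero, Matrix.cons_val_one, Matrix.neg_apply]
  field_simp
  constructor
  · rintro ⟨⟨h1, -⟩, h2, -⟩
    exact ⟨by linear_combination h1, by linear_combination h2⟩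
  · rintro ⟨h1, h2⟩
    rw [h1, h2]
    refine ⟨⟨?_, ?_⟩, ?_, ?_⟩ <;> ring

lemma realMat_det (S : Matrix (Fin 2) (Fin 2) ℤ) :
    ((S.det : ℤ) : ℝ) = S 0 0 * S 1 1 - S 0 1 * S 1 0 := by
  rw [Matrix.det_fin_two]
  push_cast
  ring

/-- A matrix commuting with `B_{x,y}` is complex linear, and its determinant is the norm `(S₀₀ - x
S₁₀)² + (y S₁₀)² ≥ 0`. In the anticommuting case it is minus this norm. -/
lemma det_eq_one_of_comm {x y : ℝ} (hy : 0 < y) {S : Matrix (Fin 2) (Fin 2) ℤ}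
    (hS : S.det = 1 ∨ S.det = -1) (h : realMat S * Bmat x y = Bmat x y * realMat S) :
    S.det = 1 := by
  refine hS.resolve_right fun h' => ?_
  obtain ⟨h1, h2⟩ := (comm_Bmat_iff hy).mp h
  have hd := realMat_det S
  rw [h', h1, h2] at hd
  push_cast at hd
  nlinarith [sq_nonneg ((S 0 0 : ℝ) - S 1 0 * x), sq_nonneg ((S 1 0 : ℝ) * y)]

lemma det_eq_neg_one_of_anti {x y : ℝ} (hy : 0 < y) {S : Matrix (Fin 2) (Fin 2) ℤ}
    (hS : S.det = 1 ∨ S.det = -1) (h : realMat S * Bmat x y = -(Bmat x y * realMat S)) :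
    S.det = -1 := by
  refine hS.resolve_left fun h' => ?_
  obtain ⟨h1, h2⟩ := (anti_Bmat_iff hy).mp h
  have hd := realMat_det S
  rw [h', h1, h2] at hd
  push_cast at hd
  nlinarith [sq_nonneg ((S 0 0 : ℝ) - S 1 0 * x), sq_nonneg ((S 1 0 : ℝ) * y)]

/-! ### Integrality of `e^B`, the form of automorphisms, and why equivalence implies `Rel`. -/

namespace Osc

variable {D : OscData} {r : ℕ} {lam x y : ℝ}

/-- The integer matrix and the grid point belonging to a lattice which meets `H₁` in `Γ`. -/
lemma exists_matrix_of_inf_heisenberg (hD : IsStd D r lam x y) {z : ℝ} {ξ : Fin 2 → ℝ}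
    (h : generated D z ξ ⊓ heisenberg D = Γ D) :
    ∃ A : Matrix (Fin 2) (Fin 2) ℤ, A.det = 1 ∧ (∀ η, D.flow 1 η = (realMat A).mulVec η) ∧
      ∃ u, ξ = halfGrid r u ∧ Compat r A u := by
  have hr' : (r : ℝ) ≠ 0 := by exact_mod_cast hD.r_pos.ne'
  have hl := mem_normalizer_of_inf_heisenberg h (mk_mem_generated z ξ)
  obtain ⟨A, hA, k, hk1, hk2⟩ := exists_int_of_preserves_Γ hD.ω
    (S := NormedSpace.exp ((1 : ℝ) • D.B)) (f := fun η => D.ω ξ (D.flow 1 η)) (by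
      intro η hη
      have := (Subgroup.mem_normalizer_iff.mp hl _).mp hη
      rw [conj_eq _ _ rfl] at this
      simpa [OscData.flow] using this)
  have hflow : ∀ η, D.flow 1 η = (realMat A).mulVec η := fun η => by
    rw [OscData.flow, hA]
  have hdet : A.det = 1 := by
    have := D.flow_symplectic 1 ![1, 0] ![0, 1]
    rw [hflow, hflow, realMat_mulVec, realMat_mulVec, hD.ω, hD.ω] at this
    simp [hr'] at this
    have hd := realMat_det A
    exact_mod_cast (hd.trans (by linear_combination this) : ((A.det : ℤ) : ℝ) = 1)
  refine ⟨A, hdet, hflow, ?_⟩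
  simp only [hflow] at hk1 hk2
  exact exists_compat hD.r_pos hD.ω (Or.inl hdet) hk1 hk2

/-- At time `π / λ` the flow is `-1`, so the commutator of this half turn with `-η/2` is `η/2 +
η/2`, with no central term as the two vectors are parallel. -/
lemma horizontal_eq_commutator (hD : IsStd D r lam x y) (η : Fin 2 → ℝ) :
    (⟨0, η, 0⟩ : Osc D) = ⟨0, 0, π / lam⟩ * ⟨0, (-1 / 2 : ℝ) • η, 0⟩ * (⟨0, 0, π / lam⟩ : Osc D)⁻¹ *
      (⟨0, (-1 / 2 : ℝ) • η, 0⟩ : Osc D)⁻¹ := by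
  have h1 : π / lam * lam = π := div_mul_cancel₀ _ hD.lam_pos.ne'
  rw [conj_eq _ _ rfl]
  ext1
  · simp [D.flow_zero, hD.flow, h1, D.alt.self_eq_zero]
  · simp only [mul_ξ, inv_ξ, D.flow_zero, neg_zero, hD.flow (π / lam), h1, cos_pi, sin_pi,
      zero_smul, add_zero, smul_smul, ← neg_smul, ← add_smul]
    norm_num
  · simp

lemma central_eq_commutator (hD : IsStd D r lam x y) (v : ℝ) :
    (⟨v, 0, 0⟩ : Osc D) = ⟨0, ![1, 0], 0⟩ * ⟨0, ![0, v / r], 0⟩ * (⟨0, ![1, 0], 0⟩ : Osc D)⁻¹ *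
      (⟨0, ![0, v / r], 0⟩ : Osc D)⁻¹ := by
  have hr' : (r : ℝ) ≠ 0 := by exact_mod_cast hD.r_pos.ne'
  rw [conj_eq _ _ rfl]
  ext1
  · simp [D.flow_zero, hD.ω]
    field_simp
  · ext i
    fin_cases i <;> simp [D.flow_zero]
  · simp

lemma commutator_heisenberg (a b : Osc D) (ha : a.t = 0) (hb : b.t = 0) :
    a * b * a⁻¹ * b⁻¹ = ⟨D.ω a.ξ b.ξ, 0, 0⟩ := by
  rw [conj_eq _ _ hb]
  ext1
  · simp [D.flow_zero, ha, hb, D.alt.self_eq_zero]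
  · simp [D.flow_zero, ha, hb]
  · simp [hb]

/-- The coordinate `t` is a homomorphism to an abelian group, and every Heisenberg element is a
product of two commutators. -/
lemma map_t_eq_zero (hD : IsStd D r lam x y) (φ : Osc D →* Osc D) {g : Osc D} (hg : g.t = 0) :
    (φ g).t = 0 := by
  have key : ∀ a b : Osc D, (φ (a * b * a⁻¹ * b⁻¹)).t = 0 := by
    intro a b
    simp only [map_mul, map_inv, mul_t, inv_t]
    ring
  have h : g = ⟨0, g.ξ, 0⟩ * ⟨g.z, 0, 0⟩ := by
    ext1 <;> simp [D.flow_zero, hg]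
  rw [h, horizontal_eq_commutator hD, central_eq_commutator hD g.z, map_mul, mul_t, key, key,
    add_zero]

/-- The form of an automorphism of the oscillator group. -/
lemma exists_form_of_aut (hD : IsStd D r lam x y) (φ : Osc D ≃ₜ* Osc D) :
    ∃ (μ c : ℝ) (S : Matrix (Fin 2) (Fin 2) ℝ) (ζ : Fin 2 → ℝ), μ ≠ 0 ∧
      (∀ z ξ, φ ⟨z, ξ, 0⟩ = ⟨μ * z + D.ω ζ (S.mulVec ξ), S.mulVec ξ, 0⟩) ∧
      (∀ ξ η, D.ω (S.mulVec ξ) (S.mulVec η) = μ * D.ω ξ η) ∧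
      (∀ t, (φ ⟨0, 0, t⟩).t = c * t) ∧
      (∀ t, (φ ⟨0, 0, t⟩).ξ = ζ - D.flow (c * t) ζ) ∧
      (∀ t ξ, S.mulVec (D.flow t ξ) = D.flow (c * t) (S.mulVec ξ)) := by
  have hr' : (r : ℝ) ≠ 0 := by exact_mod_cast hD.r_pos.ne'
  have ht0 : ∀ g : Osc D, g.t = 0 → (φ g).t = 0 := fun g hg =>
    map_t_eq_zero hD (φ.toMulEquiv : Osc D →* Osc D) hg
  -- Commutators inside the Heisenberg group compute `ω`. This yields both that the centre is
  -- preserved and how the linear part scales `ω`.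
  have hcomm : ∀ a b : Osc D, a.t = 0 → b.t = 0 →
      φ ⟨D.ω a.ξ b.ξ, 0, 0⟩ = ⟨D.ω (φ a).ξ (φ b).ξ, 0, 0⟩ := by
    intro a b ha hb
    rw [← commutator_heisenberg a b ha hb, map_mul, map_mul, map_mul, map_inv, map_inv,
      commutator_heisenberg _ _ (ht0 a ha) (ht0 b hb)]
  have hcentral : ∀ v, (φ ⟨v, 0, 0⟩).ξ = 0 := by
    intro v
    have := hcomm ⟨0, ![1, 0], 0⟩ ⟨0, ![0, v / r], 0⟩ rfl rfl
    have hv : D.ω ![1, 0] ![0, v / r] = v := by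
      rw [hD.ω]
      simp
      field_simp
    simp only [hv] at this
    rw [this]
  -- the action on the centre of the Heisenberg group
  let f : ℝ →+ ℝ := AddMonoidHom.mk' (fun v => (φ ⟨v, 0, 0⟩).z) (by
    intro v w
    have : (⟨v + w, 0, 0⟩ : Osc D) = ⟨v, 0, 0⟩ * ⟨w, 0, 0⟩ := by
      ext1 <;> simp [D.flow_zero]
    rw [this, map_mul, mul_z, hcentral]
    simp)
  have hf : Continuous f := continuous_z.comp
    (φ.continuous.comp (continuous_mk continuous_id continuous_const continuous_const))
  have hf' : ∀ v, (φ ⟨v, 0, 0⟩).z = (φ ⟨1, 0, 0⟩).z * v := by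
    intro v
    have := (f.toRealLinearMap hf).map_smul v 1
    simp only [smul_eq_mul, mul_one, AddMonoidHom.coe_toRealLinearMap] at this
    rw [mul_comm]
    exact this
  have hφc : ∀ v, φ ⟨v, 0, 0⟩ = ⟨(φ ⟨1, 0, 0⟩).z * v, 0, 0⟩ := by
    intro v
    ext1
    · exact hf' v
    · exact hcentral v
    · exact ht0 _ rfl
  set μ := (φ ⟨1, 0, 0⟩).z with hμ
  -- the action on `ℝ²`
  have hadd : ∀ ξ η : Fin 2 → ℝ, φ ⟨0, ξ + η, 0⟩ =
      ⟨μ * (-1 / 2 * D.ω ξ η), 0, 0⟩ * φ ⟨0, ξ, 0⟩ * φ ⟨0, η, 0⟩ := by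
    intro ξ η
    rw [← hφc, ← map_mul, ← map_mul]
    congr 1
    ext1
    · simp [D.flow_zero]
      ring
    · simp [D.flow_zero]
    · simp
  let σ : (Fin 2 → ℝ) →+ (Fin 2 → ℝ) := AddMonoidHom.mk' (fun ξ => (φ ⟨0, ξ, 0⟩).ξ) (by
    intro ξ η
    rw [hadd]
    simp [ht0 ⟨0, ξ, 0⟩ rfl, D.flow_zero])
  have hσ : Continuous σ := continuous_ξ.comp
    (φ.continuous.comp (continuous_mk continuous_const continuous_id continuous_const))
  set S := LinearMap.toMatrix' ((σ.toRealLinearMap hσ : (Fin 2 → ℝ) →ₗ[ℝ] (Fin 2 → ℝ))) with hSdef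
  have hS : ∀ ξ, (φ ⟨0, ξ, 0⟩).ξ = S.mulVec ξ := by
    intro ξ
    rw [hSdef, LinearMap.toMatrix'_mulVec]
    rfl
  have hω : ∀ ξ η, D.ω (S.mulVec ξ) (S.mulVec η) = μ * D.ω ξ η := by
    intro ξ η
    have := congrArg Osc.z (hcomm ⟨0, ξ, 0⟩ ⟨0, η, 0⟩ rfl rfl)
    simp only [hφc, hS] at this
    exact this.symm
  let ℓ : (Fin 2 → ℝ) →+ ℝ := AddMonoidHom.mk' (fun ξ => (φ ⟨0, ξ, 0⟩).z) (by
    intro ξ η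
    rw [hadd]
    simp only [mul_z, mul_ξ, mul_t, ht0 ⟨0, ξ, 0⟩ rfl, D.flow_zero, hS, hω, map_zero, zero_add,
      LinearMap.zero_apply]
    ring)
  have hℓ : Continuous ℓ := continuous_z.comp
    (φ.continuous.comp (continuous_mk continuous_const continuous_id continuous_const))
  have hμ0 : μ ≠ 0 := by
    intro h
    have h1 := hφc 1
    rw [h, zero_mul] at h1
    have h2 : (⟨1, 0, 0⟩ : Osc D) = 1 := φ.injective (by rw [h1, map_one]; rfl)
    exact one_ne_zero (congrArg Osc.z h2)
  have hdet : S 0 0 * S 1 1 - S 1 0 * S 0 1 = μ := by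
    have := hω ![1, 0] ![0, 1]
    rw [hD.ω, hD.ω] at this
    simp [Matrix.mulVec, dotProduct, Fin.sum_univ_two] at this
    apply mul_left_cancel₀ hr'
    linear_combination this
  -- The left side is a linear functional of `ξ`. As `ω` is nondegenerate and `det S = μ ≠ 0`, it is
  -- represented by a vector `ζ`, written out by Cramer's rule.
  obtain ⟨ζ, hζ⟩ : ∃ ζ, ∀ ξ, (φ ⟨0, ξ, 0⟩).z = D.ω ζ (S.mulVec ξ) := by
    refine ⟨![(S 0 0 * ℓ ![0, 1] - S 0 1 * ℓ ![1, 0]) / (r * μ),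
      (S 1 0 * ℓ ![0, 1] - S 1 1 * ℓ ![1, 0]) / (r * μ)], fun ξ => ?_⟩
    have hlin : (φ ⟨0, ξ, 0⟩).z = ξ 0 * ℓ ![1, 0] + ξ 1 * ℓ ![0, 1] := by
      have hξ : ξ = ξ 0 • ![1, 0] + ξ 1 • ![0, 1] := by
        ext i
        fin_cases i <;> simp
      have h := (ℓ.toRealLinearMap hℓ).map_add (ξ 0 • ![1, 0]) (ξ 1 • ![0, 1])
      rw [← hξ, map_smul, map_smul] at h
      exact h
    rw [hlin, hD.ω]
    simp only [Matrix.mulVec, dotProduct, Fin.sum_univ_two, Matrix.cons_val_zero,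
      Matrix.cons_val_one]
    field_simp
    rw [← hdet]
    ring
  let τ : ℝ →+ ℝ := AddMonoidHom.mk' (fun t => (φ ⟨0, 0, t⟩).t) (by
    intro s t
    have : (⟨0, 0, s + t⟩ : Osc D) = ⟨0, 0, s⟩ * ⟨0, 0, t⟩ := by
      ext1 <;> simp [D.flow_zero_right]
    rw [this, map_mul, mul_t])
  have hτ : Continuous τ := continuous_t.comp
    (φ.continuous.comp (continuous_mk continuous_const continuous_const continuous_id))
  have hτ' : ∀ t, (φ ⟨0, 0, t⟩).t = (φ ⟨0, 0, 1⟩).t * t := by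
    intro t
    have := (τ.toRealLinearMap hτ).map_smul t 1
    simp only [smul_eq_mul, mul_one, AddMonoidHom.coe_toRealLinearMap] at this
    rw [mul_comm]
    exact this
  set c := (φ ⟨0, 0, 1⟩).t with hc
  have hconj : ∀ t ξ, φ ⟨0, D.flow t ξ, 0⟩ =
      ⟨D.ω ζ (S.mulVec ξ) + D.ω (φ ⟨0, 0, t⟩).ξ (D.flow (c * t) (S.mulVec ξ)),
        D.flow (c * t) (S.mulVec ξ), 0⟩ := by
    intro t ξ
    have h1 : (⟨0, D.flow t ξ, 0⟩ : Osc D) = ⟨0, 0, t⟩ * ⟨0, ξ, 0⟩ * (⟨0, 0, t⟩ : Osc D)⁻¹ := by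
      rw [conj_eq _ _ rfl]
      simp
    rw [h1, map_mul, map_mul, map_inv, conj_eq _ _ (ht0 _ rfl), hτ', hS, hζ]
  have hSflow : ∀ t ξ, S.mulVec (D.flow t ξ) = D.flow (c * t) (S.mulVec ξ) := by
    intro t ξ
    rw [← hS, hconj]
  refine ⟨μ, c, S, ζ, hμ0, ?_, hω, hτ', ?_, hSflow⟩
  · intro z ξ
    have h1 : (⟨z, ξ, 0⟩ : Osc D) = ⟨z, 0, 0⟩ * ⟨0, ξ, 0⟩ := by
      ext1 <;> simp [D.flow_zero]
    rw [h1, map_mul, hφc]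
    ext1
    · simp [hζ]
    · simp [hS, D.flow_zero]
    · simp [ht0 ⟨0, ξ, 0⟩ rfl]
  · intro t
    -- Compares the two expressions for the `z`-coordinate of `φ(0, e^{tB}ξ, 0)`: directly through
    -- `ζ`, and as a conjugate by `φ(0, 0, t)`. Nondegeneracy then gives the claimed vector.
    have key : ∀ ξ, D.ω ((φ ⟨0, 0, t⟩).ξ - (ζ - D.flow (c * t) ζ)) (S.mulVec (D.flow t ξ)) = 0 := by
      intro ξ
      have h1 := congrArg Osc.z (hconj t ξ)
      simp only [hζ, ← hSflow] at h1
      have h2 := D.flow_symplectic (c * t) ζ (S.mulVec ξ)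
      rw [← hSflow] at h2
      simp only [map_sub, LinearMap.sub_apply]
      linear_combination -h1 + h2
    set h := (φ ⟨0, 0, t⟩).ξ - (ζ - D.flow (c * t) ζ) with hh
    have hadj : ∀ w, D.ω h w = 0 := by
      intro w
      have h1 := key (D.flow (-t) (S.adjugate.mulVec w))
      rw [D.flow_flow_neg, Matrix.mulVec_mulVec, Matrix.mul_adjugate, Matrix.det_fin_two,
        Matrix.smul_mulVec, Matrix.one_mulVec, map_smul, smul_eq_mul, mul_comm (S 0 1), hdet] at h1
      exact (mul_eq_zero.mp h1).resolve_left hμ0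
    have e0 := hadj ![0, 1]
    have e1 := hadj ![1, 0]
    rw [hD.ω] at e0 e1
    simp [hr'] at e0 e1
    have : h = 0 := by
      ext i
      fin_cases i <;> simp [e0, e1]
    exact sub_eq_zero.mp this

/-- The automorphism preserves the Heisenberg group and therefore `Γ`, which makes `S` and `ζ`
arithmetic. `Rel` is then read off from the `ξ`-coordinate of the image `γ l'^{±1}` of the last
generator `l`, where `l'` generates the other lattice. -/
lemma rel_of_equivalent (hD : IsStd D r lam x y) {A : Matrix (Fin 2) (Fin 2) ℤ} (hA : A.det = 1)
    (hflow : ∀ ξ, D.flow 1 ξ = (realMat A).mulVec ξ) {u u' : Fin 2 → ℤ} (hu : Compat r A u)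
    (hu' : Compat r A u') {z z' : ℝ}
    (h : Equivalent (generated D z (halfGrid r u)) (generated D z' (halfGrid r u'))) :
    Rel r x y A u u' := by
  have hr' : (r : ℝ) ≠ 0 := by exact_mod_cast hD.r_pos.ne'
  obtain ⟨φ, hφ⟩ := h
  obtain ⟨μ, c, S, ζ, hμ0, hφH, hω, hφt, hφξ, hSflow⟩ := exists_form_of_aut hD φ
  have hl := mem_normalizer_Γ hD hA hflow hu z
  have hl' := mem_normalizer_Γ hD hA hflow hu' z'
  have hφΓ : ∀ g, g ∈ Γ D → φ g ∈ Γ D := by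
    intro g hg
    rw [← generated_inf_heisenberg hl', Subgroup.mem_inf, ← hφ]
    exact ⟨⟨g, Γ_le_generated _ _ hg, rfl⟩,
      map_t_eq_zero hD (φ.toMulEquiv : Osc D →* Osc D) (Γ_le_heisenberg hg)⟩
  have hφΓ' : ∀ g, g.t = 0 → φ g ∈ Γ D → g ∈ Γ D := by
    intro g hgt hg
    have h1 := Γ_le_generated z' (halfGrid r u') hg
    rw [← hφ] at h1
    obtain ⟨g', hg', h2⟩ := h1
    rw [← generated_inf_heisenberg hl, Subgroup.mem_inf]
    exact ⟨φ.injective h2 ▸ hg', hgt⟩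
  -- the scaling factor is a unit
  have h1Γ : (⟨1, 0, 0⟩ : Osc D) ∈ Γ D := Subgroup.subset_closure (by simp)
  have hint : ∀ v : ℝ, (⟨v, 0, 0⟩ : Osc D) ∈ Γ D → ∃ n : ℤ, v = n := by
    intro v hv
    rw [mem_Γ_iff hD.ω] at hv
    obtain ⟨-, a, b, n, hab, hz⟩ := hv
    have ha := congrFun hab 0
    simp at ha
    exact ⟨n, by simpa [← ha] using hz⟩
  have hφ1 : ∀ v, φ ⟨v, 0, 0⟩ = ⟨μ * v, 0, 0⟩ := by
    intro v
    rw [hφH]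
    simp
  obtain ⟨n, hn⟩ := hint μ (by simpa [hφ1] using hφΓ _ h1Γ)
  obtain ⟨k, hk⟩ := hint μ⁻¹ (hφΓ' _ rfl (by
    rw [hφ1, mul_inv_cancel₀ hμ0]
    exact h1Γ))
  obtain ⟨M, rfl, κ, hk1, hk2⟩ := exists_int_of_preserves_Γ hD.ω (S := S)
    (f := fun η => D.ω ζ (S.mulVec η)) (by
      intro η hη
      simpa [hφH] using hφΓ _ hη)
  have hMμ : ((M.det : ℤ) : ℝ) = μ := by
    have := hω ![1, 0] ![0, 1]
    rw [hD.ω, hD.ω, realMat_mulVec, realMat_mulVec] at this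
    simp at this
    rw [realMat_det]
    apply mul_left_cancel₀ hr'
    linear_combination this
  have hMn : M.det = n := by exact_mod_cast hMμ.trans hn
  have hM : M.det = 1 ∨ M.det = -1 := by
    rw [hMn]
    refine Int.eq_one_or_neg_one_of_mul_eq_one (v := k) ?_
    have : (n : ℝ) * k = 1 := by rw [← hn, ← hk, mul_inv_cancel₀ hμ0]
    exact_mod_cast this
  obtain ⟨s, rfl, hs⟩ := exists_compat hD.r_pos hD.ω hM hk1 hk2
  -- the image of the last generator
  have hlt : (φ ⟨z, halfGrid r u, 1⟩).t = c ∧ (φ ⟨z, halfGrid r u, 1⟩).ξ =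
      (realMat M).mulVec (halfGrid r u) + (halfGrid r s - D.flow c (halfGrid r s)) := by
    have h1 : (⟨z, halfGrid r u, 1⟩ : Osc D) = ⟨z, halfGrid r u, 0⟩ * ⟨0, 0, 1⟩ := by
      ext1 <;> simp [D.flow_zero]
    rw [h1, map_mul, mul_t, mul_ξ, hφH, D.flow_zero, hφξ, hφt]
    simp
  obtain ⟨hlt, hlξ⟩ := hlt
  have hmem : φ ⟨z, halfGrid r u, 1⟩ ∈ generated D z' (halfGrid r u') := by
    rw [← hφ]
    exact ⟨_, mk_mem_generated _ _, rfl⟩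
  obtain ⟨γ, hγ, i, hi⟩ := exists_of_mem_generated hl' hmem
  have hγt := mem_heisenberg.mp (Γ_le_heisenberg hγ)
  have hci : c = i := by
    have := congrArg Osc.t hi
    simpa [hlt, hγt, zpow_t] using this
  -- The other generator is itself the image of some `γ' l^j`; comparing times gives `ij = 1`.
  have hi1 : i = 1 ∨ i = -1 := by
    have h1 := mk_mem_generated (D := D) z' (halfGrid r u')
    rw [← hφ] at h1
    obtain ⟨g, hg, h2⟩ := h1
    obtain ⟨γ', hγ', j, rfl⟩ := exists_of_mem_generated hl hg
    refine Int.eq_one_or_neg_one_of_mul_eq_one (v := j) ?_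
    have h3 : (φ (γ' * (⟨z, halfGrid r u, 1⟩ : Osc D) ^ j)).t = 1 := congrArg Osc.t h2
    rw [map_mul, map_zpow, mul_t, zpow_t, hlt,
      mem_heisenberg.mp (Γ_le_heisenberg (hφΓ _ hγ')), zero_add, hci] at h3
    rw [mul_comm]
    exact_mod_cast h3
  have hMB : ∀ ξ, (realMat M).mulVec ((Bmat x y).mulVec ξ) =
      (i : ℝ) • (Bmat x y).mulVec ((realMat M).mulVec ξ) := by
    intro ξ
    -- At a quarter turn the flow equals `B_{x,y}`, so the intertwining relation becomes
    -- (anti)commutation with `B_{x,y}`.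
    have h1 := hSflow (π / 2 / lam) ξ
    have h2 : π / 2 / lam * lam = π / 2 := div_mul_cancel₀ _ hD.lam_pos.ne'
    have h3 : c * (π / 2 / lam) * lam = c * (π / 2) := by rw [mul_assoc, h2]
    rw [hD.flow, hD.flow, h2, h3, hci, cos_pi_div_two, sin_pi_div_two, zero_smul, zero_add,
      one_smul] at h1
    rw [h1]
    rcases hi1 with rfl | rfl <;> simp
  have hMB' : realMat M * Bmat x y = (i : ℝ) • (Bmat x y * realMat M) := by
    apply Matrix.ext_of_mulVec_single
    intro j
    rw [← Matrix.mulVec_mulVec, hMB, Matrix.smul_mulVec, ← Matrix.mulVec_mulVec]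
  rcases hi1 with rfl | rfl
  · rw [Int.cast_one, one_smul] at hMB'
    obtain ⟨-, a, b, -, hab, -⟩ := (mem_Γ_iff hD.ω).mp hγ
    refine ⟨M, s, -![a, b], hs, Or.inl ⟨det_eq_one_of_comm hD.y_pos hM hMB', hMB', ?_⟩⟩
    apply halfGrid_injective hD.r_pos
    have h1 := congrArg Osc.ξ hi
    rw [hlξ, hci, zpow_one, mul_ξ, hγt, D.flow_zero, Int.cast_one, hflow] at h1
    have h2 : γ.ξ = halfGrid r ((2 * r : ℤ) • ![a, b]) := by
      rw [halfGrid_smul hD.r_pos, hab]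
      simp
    rw [h2, realMat_mulVec_halfGrid, realMat_mulVec_halfGrid] at h1
    rw [smul_neg, halfGrid_add, halfGrid_sub, halfGrid_add, halfGrid_neg]
    linear_combination -h1
  · rw [Int.cast_neg, Int.cast_one, neg_one_smul] at hMB'
    obtain ⟨-, a, b, -, hab, -⟩ := (mem_Γ_iff hD.ω).mp (inv_mem hγ)
    refine ⟨M, s, -A.mulVec ![a, b], hs,
      Or.inr ⟨det_eq_neg_one_of_anti hD.y_pos hM hMB', hMB', ?_⟩⟩
    apply halfGrid_injective hD.r_pos
    have h0 : (φ ⟨z, halfGrid r u, 1⟩)⁻¹ = ⟨z', halfGrid r u', 1⟩ * γ⁻¹ := by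
      rw [hi]
      simp
    have h1 := congrArg Osc.ξ h0
    rw [inv_ξ, hlt, hlξ, hci, mul_ξ, Int.cast_neg, Int.cast_one, neg_neg, D.flow_map_add,
      sub_eq_add_neg, D.flow_map_add, D.flow_map_neg, D.flow_flow_neg] at h1
    have h2 : γ⁻¹.ξ = halfGrid r ((2 * r : ℤ) • ![a, b]) := by
      rw [halfGrid_smul hD.r_pos, hab]
      simp
    simp only [h2, hflow, realMat_mulVec_halfGrid] at h1
    rw [smul_neg, ← Matrix.mulVec_smul, halfGrid_add, halfGrid_sub, halfGrid_add, halfGrid_neg,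
      halfGrid_neg, eq_comm]
    rw [← sub_eq_iff_eq_add] at h1
    rw [← h1]
    abel

end Osc

/-! ### Integer symmetries of the complex structure -/

section Symmetries

variable {x y : ℝ}

lemma three_quarters_le_sq (hxy : (x, y) ∈ F₁) : 3 / 4 ≤ y ^ 2 := by
  obtain ⟨h0, h1, -, h3⟩ := hxy
  simp only at h0 h1 h3
  nlinarith

/-- From `y² ≥ 3/4` one gets `c² ≤ 4/3 < 4`; for integral `c` only `0` and `±1` remain. -/
lemma abs_le_one_of_norm {a c t : ℝ} (hxy : (x, y) ∈ F₁) (h : (a - t) ^ 2 + c ^ 2 * y ^ 2 = 1) :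
    -2 < c ∧ c < 2 := by
  have := three_quarters_le_sq hxy
  constructor <;> nlinarith [sq_nonneg (a - t), sq_nonneg c]

lemma norm_eq_one_of_int (hxy : (x, y) ∈ F₁) {a n : ℤ} (h : ((a : ℝ) - x) ^ 2 + y ^ 2 = 1)
    (hn : x ^ 2 + y ^ 2 = n) : n = 1 := by
  obtain ⟨h0, h1, -, h3⟩ := hxy
  simp only at h0 h1 h3
  have h4 : (1 : ℝ) ≤ n := hn ▸ h3
  have h5 : (n : ℝ) < 2 := by nlinarith [sq_nonneg ((a : ℝ) - x)]
  have h4' : 1 ≤ n := by exact_mod_cast h4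
  have h5' : n < 2 := by exact_mod_cast h5
  omega

lemma x_eq_of_int (hxy : (x, y) ∈ F₁) {n : ℤ} (hn : 2 * x = n) : x = 0 ∨ x = 1 / 2 := by
  obtain ⟨h0, h1, -, -⟩ := hxy
  simp only at h0 h1
  have h4 : (0 : ℝ) ≤ n := by linarith
  have h5 : (n : ℝ) ≤ 1 := by linarith
  have h4' : 0 ≤ n := by exact_mod_cast h4
  have h5' : n ≤ 1 := by exact_mod_cast h5
  obtain rfl | rfl : n = 0 ∨ n = 1 := by omega
  · left
    push_cast at hn
    linarith
  · right
    push_cast at hn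
    linarith

lemma int_sq_eq_one {a : ℤ} (h : (a : ℝ) ^ 2 = 1) : a = 1 ∨ a = -1 := by
  have h' : a ^ 2 = 1 := by exact_mod_cast h
  exact Int.isUnit_iff.mp (IsUnit.of_mul_eq_one a (by rw [← h', sq]))

lemma matrix_eq_of_entries {R : Type*} {S : Matrix (Fin 2) (Fin 2) R} {a b c d : R}
    (h00 : S 0 0 = a) (h01 : S 0 1 = b) (h10 : S 1 0 = c) (h11 : S 1 1 = d) :
    S = !![a, b; c, d] := by
  ext i j
  fin_cases i <;> fin_cases j <;> simp [h00, h01, h10, h11]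

/-- The rotations in `SL₂(ℤ)` which commute with `B_{x,y}`. -/
lemma comm_cases (hxy : (x, y) ∈ F₁) {S : Matrix (Fin 2) (Fin 2) ℤ} (hdet : S.det = 1)
    (h : realMat S * Bmat x y = Bmat x y * realMat S) :
    ∃ ε : ℤ, (ε = 1 ∨ ε = -1) ∧ (S = !![ε, 0; 0, ε] ∨
      (x ^ 2 + y ^ 2 = 1 ∧ x = 0 ∧ S = !![0, -ε; ε, 0]) ∨
      (x ^ 2 + y ^ 2 = 1 ∧ x = 1 / 2 ∧ (S = !![ε, -ε; ε, 0] ∨ S = !![0, -ε; ε, -ε]))) := by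
  obtain ⟨h1, h2⟩ := (comm_Bmat_iff hxy.2.2.1).mp h
  have hd := realMat_det S
  rw [hdet, h1, h2] at hd
  push_cast at hd
  have hn : ((S 0 0 : ℝ) - S 1 0 * x) ^ 2 + (S 1 0 : ℝ) ^ 2 * y ^ 2 = 1 := by
    linear_combination -hd
  obtain ⟨hc1, hc2⟩ := abs_le_one_of_norm hxy hn
  have hc1' : -2 < S 1 0 := by exact_mod_cast hc1
  have hc2' : S 1 0 < 2 := by exact_mod_cast hc2
  rcases (by omega : S 1 0 = 0 ∨ S 1 0 = 1 ∨ S 1 0 = -1) with hc | hc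
  · rw [hc] at h1 h2 hn
    simp only [Int.cast_zero, zero_mul, sub_zero, mul_zero, ne_eq, OfNat.ofNat_ne_zero,
      not_false_eq_true, zero_pow, add_zero] at h1 h2 hn
    exact ⟨S 0 0, int_sq_eq_one hn, Or.inl (matrix_eq_of_entries rfl (by exact_mod_cast h1) hc
      (by exact_mod_cast h2))⟩
  · obtain ⟨ε, hε'⟩ : ∃ ε, S 1 0 = ε := ⟨_, rfl⟩
    simp only [hε'] at h1 h2 hn hc
    have hε : (ε : ℝ) * ε = 1 := by
      rcases hc with rfl | rfl <;> norm_num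
    -- The lower left entry is a unit, so the norm `x² + y²` and the trace `2x` are integers; on
    -- `F₁` this leaves norm 1 and `x = 0` or `x = 1/2`.
    have hN : x ^ 2 + y ^ 2 = ((-ε * S 0 1 : ℤ) : ℝ) := by
      push_cast
      linear_combination ε * h1 - (x ^ 2 + y ^ 2) * hε
    have hx : 2 * x = ((ε * (S 0 0 - S 1 1) : ℤ) : ℝ) := by
      push_cast
      linear_combination ε * h2 - 2 * x * hε
    have hN1 := norm_eq_one_of_int hxy (a := ε * S 0 0) (by
      push_cast
      linear_combination hn + (S 0 0 ^ 2 - x ^ 2 - y ^ 2) * hε) hN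
    rw [hN1, Int.cast_one] at hN
    have h01 : S 0 1 = -ε := by
      have : (S 0 1 : ℝ) = ((-ε : ℤ) : ℝ) := by
        push_cast
        linear_combination h1 - ε * hN
      exact_mod_cast this
    refine ⟨ε, hc, Or.inr ?_⟩
    rcases x_eq_of_int hxy hx with hx0 | hx0
    · left
      have h00 : S 0 0 = 0 := by
        have : (S 0 0 : ℝ) ^ 2 = 0 := by
          rw [hx0] at hn hN
          linear_combination hn - y ^ 2 * hε - hN
        exact_mod_cast pow_eq_zero_iff (two_ne_zero) |>.mp this
      refine ⟨hN, hx0, matrix_eq_of_entries h00 h01 hε' ?_⟩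
      rw [hx0, h00] at h2
      exact_mod_cast (by simpa using h2 : (S 1 1 : ℝ) = 0)
    · right
      have h00 : (S 0 0 : ℝ) * (S 0 0 - ε) = 0 := by
        rw [hx0] at hn hN
        linear_combination hn - (y ^ 2 + 1 / 4) * hε - hN
      rw [hx0] at h2
      have h2' : S 1 1 = S 0 0 - ε := by
        have : (S 1 1 : ℝ) = ((S 0 0 - ε : ℤ) : ℝ) := by
          push_cast
          linear_combination h2
        exact_mod_cast this
      refine ⟨hN, hx0, ?_⟩
      rcases mul_eq_zero.mp h00 with h00 | h00
      · have h00' : S 0 0 = 0 := by exact_mod_cast h00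
        exact Or.inr (matrix_eq_of_entries h00' h01 hε' (by rw [h2', h00', zero_sub]))
      · have h00' : S 0 0 - ε = 0 := by exact_mod_cast h00
        exact Or.inl (matrix_eq_of_entries (by omega) h01 hε' (by omega))

/-- The reflections in `GL₂(ℤ)` which anticommute with `B_{x,y}`. -/
lemma anti_cases (hxy : (x, y) ∈ F₁) {S : Matrix (Fin 2) (Fin 2) ℤ} (hdet : S.det = -1)
    (h : realMat S * Bmat x y = -(Bmat x y * realMat S)) :
    ∃ ε : ℤ, (ε = 1 ∨ ε = -1) ∧ ((x = 0 ∧ S = !![ε, 0; 0, -ε]) ∨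
      (x = 1 / 2 ∧ S = !![ε, -ε; 0, -ε]) ∨
      (x ^ 2 + y ^ 2 = 1 ∧ S = !![0, ε; ε, 0]) ∨
      (x ^ 2 + y ^ 2 = 1 ∧ x = 1 / 2 ∧ S = !![ε, 0; ε, -ε])) := by
  obtain ⟨h1, h2⟩ := (anti_Bmat_iff hxy.2.2.1).mp h
  simp only at h1
  have hd := realMat_det S
  rw [hdet, h1, h2] at hd
  push_cast at hd
  have hn : ((S 0 0 : ℝ) - S 1 0 * x) ^ 2 + (S 1 0 : ℝ) ^ 2 * y ^ 2 = 1 := by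
    linear_combination hd
  have h11 : S 1 1 = -S 0 0 := by exact_mod_cast h2
  obtain ⟨hc1, hc2⟩ := abs_le_one_of_norm hxy hn
  have hc1' : -2 < S 1 0 := by exact_mod_cast hc1
  have hc2' : S 1 0 < 2 := by exact_mod_cast hc2
  rcases (by omega : S 1 0 = 0 ∨ S 1 0 = 1 ∨ S 1 0 = -1) with hc | hc
  · rw [hc] at h1 hn
    simp only [Int.cast_zero, zero_mul, sub_zero, mul_zero, ne_eq, OfNat.ofNat_ne_zero,
      not_false_eq_true, zero_pow, add_zero, zero_sub] at h1 hn
    have hx : 2 * x = ((-S 0 0 * S 0 1 : ℤ) : ℝ) := by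
      push_cast
      linear_combination S 0 0 * h1 - 2 * x * hn
    refine ⟨S 0 0, int_sq_eq_one hn, ?_⟩
    rcases x_eq_of_int hxy hx with hx0 | hx0
    · refine Or.inl ⟨hx0, matrix_eq_of_entries rfl ?_ hc h11⟩
      rw [hx0] at h1
      exact_mod_cast (by simpa using h1 : (S 0 1 : ℝ) = 0)
    · refine Or.inr (Or.inl ⟨hx0, matrix_eq_of_entries rfl ?_ hc h11⟩)
      rw [hx0] at h1
      have : (S 0 1 : ℝ) = ((-S 0 0 : ℤ) : ℝ) := by
        push_cast
        linear_combination h1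
      exact_mod_cast this
  · obtain ⟨ε, hε'⟩ : ∃ ε, S 1 0 = ε := ⟨_, rfl⟩
    simp only [hε'] at h1 hn hc
    have hε : (ε : ℝ) * ε = 1 := by
      rcases hc with rfl | rfl <;> norm_num
    have hεz : ε * ε = 1 := by exact_mod_cast hε
    obtain ⟨hx0, hx1, -, hx2⟩ := hxy
    simp only at hx0 hx1 hx2
    -- After normalizing the sign, `(a - x)² + y² = 1`. With `x² + y² ≥ 1` and `0 ≤ x ≤ 1/2` this
    -- leaves `a = 0`, so the norm is 1, or `a = 1`, so `x² + y² = 2x`, which forces the hexagonal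
    -- point.
    obtain ⟨a, ha⟩ : ∃ a, a = ε * S 0 0 := ⟨_, rfl⟩
    have h00 : S 0 0 = ε * a := by
      rw [ha]
      linear_combination -S 0 0 * hεz
    have h00' : (S 0 0 : ℝ) = ε * a := by exact_mod_cast h00
    have hn' : ((a : ℝ) - x) ^ 2 + y ^ 2 = 1 := by
      rw [h00'] at hn
      linear_combination hn - ((a - x) ^ 2 + y ^ 2) * hε
    have hlow : (-1 : ℝ) < a := by nlinarith
    have hupp : (a : ℝ) < 2 := by nlinarith
    have hlow' : -1 < a := by exact_mod_cast hlow
    have hupp' : a < 2 := by exact_mod_cast hupp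
    refine ⟨ε, hc, Or.inr (Or.inr ?_)⟩
    obtain rfl | rfl : a = 0 ∨ a = 1 := by omega
    · left
      have hN : x ^ 2 + y ^ 2 = 1 := by
        push_cast at hn'
        linear_combination hn'
      rw [mul_zero] at h00
      refine ⟨hN, matrix_eq_of_entries h00 ?_ hε' (by rw [h11, h00, neg_zero])⟩
      rw [h00, hN] at h1
      exact_mod_cast (by simpa using h1 : (S 0 1 : ℝ) = ε)
    · right
      push_cast at hn'
      have hx : x = 1 / 2 := by nlinarith
      have hN : x ^ 2 + y ^ 2 = 1 := by
        rw [hx] at hn' ⊢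
        linear_combination hn'
      rw [mul_one] at h00
      refine ⟨hN, hx, matrix_eq_of_entries h00 ?_ hε' (by rw [h11, h00])⟩
      rw [h00, hN, hx] at h1
      have : (S 0 1 : ℝ) = 0 := by linear_combination h1
      exact_mod_cast this

end Symmetries

/-! ### Systems of representatives for `Rel`. -/

/-- Every matrix in `GL₂(ℤ)` is compatible with some vector. -/
lemma exists_compat_int (r : ℕ) {M : Matrix (Fin 2) (Fin 2) ℤ} (hM : M.det = 1 ∨ M.det = -1) :
    ∃ s, Compat r M s := by
  have hsq : M.det * M.det = 1 := by
    rcases hM with h | h <;> simp [h]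
  have hd := M.det_fin_two
  refine ⟨![M.det * (-M 0 1 * (r * (M 0 0 * M 1 0)) + M 0 0 * (r * (M 0 1 * M 1 1))),
    M.det * (-M 1 1 * (r * (M 0 0 * M 1 0)) + M 1 0 * (r * (M 0 1 * M 1 1)))], ⟨0, ?_⟩, ⟨0, ?_⟩⟩
  · simp only [Matrix.cons_val_zero, Matrix.cons_val_one]
    linear_combination (r * (M 0 0 * M 1 0)) * hsq - M.det * (r * (M 0 0 * M 1 0)) * hd
  · simp only [Matrix.cons_val_zero, Matrix.cons_val_one]
    linear_combination (r * (M 0 1 * M 1 1)) * hsq - M.det * (r * (M 0 1 * M 1 1)) * hd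

/-- `U` is a system of representatives for the relation `Rel`. -/
structure IsTransversal (r : ℕ) (x y : ℝ) (A : Matrix (Fin 2) (Fin 2) ℤ)
    (U : Set (Fin 2 → ℤ)) : Prop where
  compat : ∀ u ∈ U, Compat r A u
  exists_rel : ∀ u, Compat r A u → ∃ u' ∈ U, Relation.ReflTransGen (Rel r x y A) u u'
  eq_of_rel : ∀ u ∈ U, ∀ u' ∈ U, Rel r x y A u u' → u = u'

lemma rel_refl (r : ℕ) (x y : ℝ) (A : Matrix (Fin 2) (Fin 2) ℤ) (u : Fin 2 → ℤ) :
    Rel r x y A u u :=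
  ⟨1, 0, 0, by simp [Compat], Or.inl ⟨by simp, by simp [realMat_one], by simp⟩⟩

/-- Equivalence of subgroups is transitive, so chains of `Rel` suffice and transitivity of `Rel`
need not be proved. Intermediate subgroups get `z = 0`, an arbitrary choice. -/
lemma equivalent_of_reflTransGen {D : OscData} {r : ℕ} {lam x y : ℝ}
    (hD : IsStd D r lam x y) {A : Matrix (Fin 2) (Fin 2) ℤ}
    (hflow : ∀ ξ, D.flow 1 ξ = (realMat A).mulVec ξ) {u u' : Fin 2 → ℤ}
    (h : Relation.ReflTransGen (Rel r x y A) u u') (z z' : ℝ) :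
    Osc.Equivalent (Osc.generated D z (halfGrid r u)) (Osc.generated D z' (halfGrid r u')) := by
  induction h generalizing z' with
  | refl => exact Osc.equivalent_of_rel hD hflow (rel_refl r x y A u) z z'
  | tail _ h ih => exact (ih 0).trans (Osc.equivalent_of_rel hD hflow h 0 z')

/-- Reduction of the classification of lattices to a system of representatives. -/
theorem classification_of_transversal {D : OscData} {r : ℕ} {lam x y : ℝ}
    (hD : IsStd D r lam x y) {A : Matrix (Fin 2) (Fin 2) ℤ} (hA : A.det = 1)
    (hflow : ∀ ξ, D.flow 1 ξ = (realMat A).mulVec ξ) {U : Set (Fin 2 → ℤ)}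
    (hU : IsTransversal r x y A U) {z : ℝ} {u : Fin 2 → ℤ} (hu : Compat r A u)
    (hL : Osc.IsLattice (Osc.generated D z (halfGrid r u))) :
    ∃ ξ₀ ∈ halfGrid r '' U,
      (Osc.IsLattice (Osc.generated D 0 ξ₀) ∧
        Osc.generated D 0 ξ₀ ⊓ Osc.heisenberg D = Osc.Γ D ∧
        Osc.Equivalent (Osc.generated D z (halfGrid r u)) (Osc.generated D 0 ξ₀)) ∧
      ∀ ξ₁ ∈ halfGrid r '' U,
        Osc.Equivalent (Osc.generated D z (halfGrid r u)) (Osc.generated D 0 ξ₁) → ξ₁ = ξ₀ := by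
  obtain ⟨u₀, hu₀, hrel⟩ := hU.exists_rel u hu
  have heq := equivalent_of_reflTransGen hD hflow hrel z 0
  refine ⟨_, ⟨u₀, hu₀, rfl⟩, ⟨heq.isLattice hL, Osc.generated_inf_heisenberg
    (Osc.mem_normalizer_Γ hD hA hflow (hU.compat u₀ hu₀) 0), heq⟩, ?_⟩
  rintro _ ⟨u₁, hu₁, rfl⟩ h
  rw [hU.eq_of_rel u₁ hu₁ u₀ hu₀ (Osc.rel_of_equivalent hD hA hflow (hU.compat u₁ hu₁)
    (hU.compat u₀ hu₀) (h.symm.trans heq))]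

/-! ### Representatives when `e^B = 1`: reduction of pairs of integers modulo `r` -/

section Reduction

variable {r : ℤ} {Q : ℤ → ℤ → Prop}

/-- Here and below `Q p q` stands for "a representative can be reached from `(p, q)`", and each
hypothesis ending in `Q p q` is an allowed move. -/
lemma reduce_mod (hr : 0 < r) (hI : ∀ p q i j, Q (p + r * i) (q + r * j) → Q p q)
    (h : ∀ p q, 0 ≤ p → p < r → 0 ≤ q → q < r → Q p q) (p q : ℤ) : Q p q := by
  apply hI p q (-(p / r)) (-(q / r))
  have h1 := Int.mul_ediv_add_emod p r
  have h2 := Int.mul_ediv_add_emod q r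
  have e1 : p + r * -(p / r) = p % r := by linear_combination -h1
  have e2 : q + r * -(q / r) = q % r := by linear_combination -h2
  rw [e1, e2]
  exact h _ _ (Int.emod_nonneg p hr.ne') (Int.emod_lt_of_pos p hr) (Int.emod_nonneg q hr.ne')
    (Int.emod_lt_of_pos q hr)

/-- A fundamental domain for `±1` on the torus `(ℤ/r)²`. The second box is open because points with
a coordinate `0` or `r/2` can always be folded into the first. -/
lemma reduce_generic (hr : 0 < r) (hI : ∀ p q i j, Q (p + r * i) (q + r * j) → Q p q)
    (hN : ∀ p q i j, Q (-p + r * i) (-q + r * j) → Q p q)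
    (h₁ : ∀ k l, 0 ≤ k → 0 ≤ l → 2 * k ≤ r → 2 * l ≤ r → Q k l)
    (h₂ : ∀ k l, 0 < k → 2 * k < r → r < 2 * l → l < r → Q k l) (p q : ℤ) : Q p q := by
  refine reduce_mod hr hI (fun p q hp hp' hq hq' => ?_) p q
  by_cases hp2 : 2 * p ≤ r
  · by_cases hq2 : 2 * q ≤ r
    · exact h₁ p q hp hq hp2 hq2
    · by_cases hp0 : p = 0
      · exact hN p q 0 1 (h₁ _ _ (by omega) (by omega) (by omega) (by omega))
      · by_cases hp3 : 2 * p = r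
        · exact hN p q 1 1 (h₁ _ _ (by omega) (by omega) (by omega) (by omega))
        · exact h₂ p q (by omega) (by omega) (by omega) (by omega)
  · by_cases hq0 : q = 0
    · exact hN p q 1 0 (h₁ _ _ (by omega) (by omega) (by omega) (by omega))
    · by_cases hq2 : r ≤ 2 * q
      · exact hN p q 1 1 (h₁ _ _ (by omega) (by omega) (by omega) (by omega))
      · exact hN p q 1 1 (h₂ _ _ (by omega) (by omega) (by omega) (by omega))

lemma reduce_x_zero (hr : 0 < r) (hI : ∀ p q i j, Q (p + r * i) (q + r * j) → Q p q)
    (hN : ∀ p q i j, Q (-p + r * i) (-q + r * j) → Q p q)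
    (hX : ∀ p q i j, Q (-p + r * i) (q + r * j) → Q p q)
    (h₁ : ∀ k l, 0 ≤ k → 0 ≤ l → 2 * k ≤ r → 2 * l ≤ r → Q k l) (p q : ℤ) : Q p q :=
  reduce_generic hr hI hN h₁ (fun k l _ _ _ _ => hX k l 0 0 (hN _ _ 0 1
    (h₁ _ _ (by omega) (by omega) (by omega) (by omega)))) p q

/-- The swap folds the first box along `k = l`. Combined with `-1` it becomes `(k, l) ↦ (r - l, r -
k)`, which folds the second box along `k + l = r`. -/
lemma reduce_norm_one (hr : 0 < r) (hI : ∀ p q i j, Q (p + r * i) (q + r * j) → Q p q)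
    (hN : ∀ p q i j, Q (-p + r * i) (-q + r * j) → Q p q) (hW : ∀ p q, Q q p → Q p q)
    (h₁ : ∀ k l, 0 ≤ k → k ≤ l → 2 * l ≤ r → Q k l)
    (h₂ : ∀ k l, 0 < k → 2 * k < r → r < 2 * l → l < r → k + l ≤ r → Q k l) (p q : ℤ) :
    Q p q := by
  refine reduce_generic hr hI hN (fun k l hk hl hk' hl' => ?_) (fun k l hk hk' hl hl' => ?_) p q
  · rcases le_total k l with h | h
    · exact h₁ k l hk h hl'
    · exact hW k l (h₁ l k hl h hk')
  · by_cases h : k + l ≤ r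
    · exact h₂ k l hk hk' hl hl' h
    · exact hW k l (hN _ _ 1 1 (h₂ _ _ (by omega) (by omega) (by omega) (by omega) (by omega)))

lemma reduce_square (hr : 0 < r) (hI : ∀ p q i j, Q (p + r * i) (q + r * j) → Q p q)
    (hN : ∀ p q i j, Q (-p + r * i) (-q + r * j) → Q p q)
    (hX : ∀ p q i j, Q (-p + r * i) (q + r * j) → Q p q) (hW : ∀ p q, Q q p → Q p q)
    (h₁ : ∀ k l, 0 ≤ k → k ≤ l → 2 * l ≤ r → Q k l) (p q : ℤ) : Q p q := by
  refine reduce_x_zero hr hI hN hX (fun k l hk hl hk' hl' => ?_) p q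
  rcases le_total k l with h | h
  · exact h₁ k l hk h hl'
  · exact hW k l (h₁ l k hl h hk')

/-- The move `(p, q) ↦ (q - p, q)` reflects each row in `2p = q`. On the row `q = 0` it coincides
with `-1` and identifies nothing new, hence the separate segment. -/
lemma reduce_x_half (hr : 0 < r) (hI : ∀ p q i j, Q (p + r * i) (q + r * j) → Q p q)
    (hN : ∀ p q i j, Q (-p + r * i) (-q + r * j) → Q p q)
    (hT : ∀ p q i j, Q (q - p + r * i) (q + r * j) → Q p q)
    (h₁ : ∀ k l, 0 ≤ k → 2 * k ≤ l → 2 * l ≤ r → Q k l)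
    (h₂ : ∀ k, 0 ≤ k → 2 * k ≤ r → Q k 0)
    (h₃ : ∀ k l, 0 < k → 2 * k < r → r < 2 * l → l < r → 2 * k ≤ l → Q k l) (p q : ℤ) :
    Q p q := by
  have h₂' : ∀ k l, 0 ≤ k → 2 * k ≤ r → l = 0 → Q k l := fun k l hk hk' hl => hl ▸ h₂ k hk hk'
  refine reduce_generic hr hI hN (fun k l hk hl hk' hl' => ?_) (fun k l hk hk' hl hl' => ?_) p q
  · by_cases hl0 : l = 0
    · exact h₂' k l hk hk' hl0
    · by_cases h : 2 * k ≤ l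
      · exact h₁ k l hk h hl'
      · by_cases hkl : k ≤ l
        · exact hT k l 0 0 (h₁ _ _ (by omega) (by omega) (by omega))
        · by_cases hlr : 2 * l = r
          · omega
          · exact hT k l 0 0 (hN _ _ 0 1
              (h₃ _ _ (by omega) (by omega) (by omega) (by omega) (by omega)))
  · by_cases h : 2 * k ≤ l
    · exact h₃ k l hk hk' hl hl' h
    · by_cases h' : k = l
      · omega
      · exact hT k l 0 0 (h₃ _ _ (by omega) (by omega) (by omega) (by omega) (by omega))

/-- Besides the reflection in `2p = q` there is now `(p, q) ↦ (p, p - q + r)`, with mirror `2q = p +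
r`; these mirrors bound the triangle of representatives. -/
lemma reduce_hexagonal (hr : 0 < r) (hI : ∀ p q i j, Q (p + r * i) (q + r * j) → Q p q)
    (hN : ∀ p q i j, Q (-p + r * i) (-q + r * j) → Q p q)
    (hT : ∀ p q i j, Q (q - p + r * i) (q + r * j) → Q p q) (hW : ∀ p q, Q q p → Q p q)
    (hV : ∀ p q i j, Q (p + r * i) (p - q + r * j) → Q p q)
    (h₁ : ∀ k l, 0 ≤ 2 * k → 2 * k ≤ l → 2 * l ≤ k + r → Q k l) (p q : ℤ) : Q p q := by
  refine reduce_x_half hr hI hN hT (fun k l hk hkl hl => ?_) (fun k hk hk' => ?_)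
    (fun k l hk hk' hl hl' hkl => ?_) p q
  · exact h₁ k l (by omega) (by omega) (by omega)
  · exact hW k 0 (h₁ 0 k (by omega) (by omega) (by omega))
  · by_cases h : 2 * l ≤ k + r
    · exact h₁ k l (by omega) (by omega) (by omega)
    · by_cases h' : k + l ≤ r
      · exact hV k l 0 1 (h₁ _ _ (by omega) (by omega) (by omega))
      · exact hW k l (hN _ _ 1 1 (hV _ _ 0 1 (h₁ _ _ (by omega) (by omega) (by omega))))

end Reduction

/-- In the uniqueness proofs both points lie in `[0, r)²`, so the translation `r * i` takes three
values only and the problem becomes linear. -/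
lemma mul_cases_of_bounds {r i : ℤ} (hr : 0 < r) (h₁ : -(2 * r) < r * i) (h₂ : r * i < 2 * r) :
    r * i = -r ∨ r * i = 0 ∨ r * i = r := by
  have h1 : -2 < i := by nlinarith
  have h2 : i < 2 := by nlinarith
  obtain rfl | rfl | rfl : i = -1 ∨ i = 0 ∨ i = 1 := by omega
  all_goals omega

/-! ### The relation for `e^B = 1` -/

section One

variable {r : ℕ} {x y : ℝ}

/-- For `A = 1` the term `s - As` vanishes, so only the existence of a compatible `s` matters. -/
lemma rel_one_of_comm {S : Matrix (Fin 2) (Fin 2) ℤ} (hdet : S.det = 1)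
    (h : realMat S * Bmat x y = Bmat x y * realMat S) (u m : Fin 2 → ℤ) :
    Rel r x y 1 u (S.mulVec u + (2 * r : ℤ) • m) := by
  obtain ⟨s, hs⟩ := exists_compat_int r (Or.inl hdet)
  exact ⟨S, s, m, hs, Or.inl ⟨hdet, h, by simp⟩⟩

lemma rel_one_of_anti {S : Matrix (Fin 2) (Fin 2) ℤ} (hdet : S.det = -1)
    (h : realMat S * Bmat x y = -(Bmat x y * realMat S)) (u m : Fin 2 → ℤ) :
    Rel r x y 1 u (-S.mulVec u + (2 * r : ℤ) • m) := by
  obtain ⟨s, hs⟩ := exists_compat_int r (Or.inr hdet)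
  exact ⟨S, s, m, hs, Or.inr ⟨hdet, h, by simp⟩⟩

lemma comm_scalar (hy : 0 < y) (ε : ℤ) :
    realMat !![ε, 0; 0, ε] * Bmat x y = Bmat x y * realMat !![ε, 0; 0, ε] :=
  (comm_Bmat_iff hy).mpr (by simp)

lemma anti_x_zero (hy : 0 < y) (hx : x = 0) (ε : ℤ) :
    realMat !![ε, 0; 0, -ε] * Bmat x y = -(Bmat x y * realMat !![ε, 0; 0, -ε]) :=
  (anti_Bmat_iff hy).mpr (by simp [hx])

lemma anti_x_half (hy : 0 < y) (hx : x = 1 / 2) (ε : ℤ) :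
    realMat !![ε, -ε; 0, -ε] * Bmat x y = -(Bmat x y * realMat !![ε, -ε; 0, -ε]) :=
  (anti_Bmat_iff hy).mpr (by simp [hx])

lemma anti_norm_one (hy : 0 < y) (hN : x ^ 2 + y ^ 2 = 1) (ε : ℤ) :
    realMat !![0, ε; ε, 0] * Bmat x y = -(Bmat x y * realMat !![0, ε; ε, 0]) :=
  (anti_Bmat_iff hy).mpr (by simp [hN])

lemma anti_hexagonal (hy : 0 < y) (hN : x ^ 2 + y ^ 2 = 1) (hx : x = 1 / 2) (ε : ℤ) :
    realMat !![ε, 0; ε, -ε] * Bmat x y = -(Bmat x y * realMat !![ε, 0; ε, -ε]) :=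
  (anti_Bmat_iff hy).mpr ⟨by rw [hN, hx]; simp, by simp⟩

lemma rel_one_translate (hy : 0 < y) (p q i j : ℤ) :
    Rel r x y 1 ![2 * p, 2 * q] ![2 * (p + r * i), 2 * (q + r * j)] := by
  convert rel_one_of_comm (S := !![1, 0; 0, 1]) (by simp) (comm_scalar hy 1) ![2 * p, 2 * q] ![i, j]
    using 1
  ext n
  fin_cases n <;> simp <;> ring

lemma rel_one_neg (hy : 0 < y) (p q i j : ℤ) :
    Rel r x y 1 ![2 * p, 2 * q] ![2 * (-p + r * i), 2 * (-q + r * j)] := by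
  convert rel_one_of_comm (S := !![-1, 0; 0, -1]) (by simp) (comm_scalar hy (-1))
    ![2 * p, 2 * q] ![i, j] using 1
  ext n
  fin_cases n <;> simp <;> ring

lemma rel_one_x_zero (hy : 0 < y) (hx : x = 0) (p q i j : ℤ) :
    Rel r x y 1 ![2 * p, 2 * q] ![2 * (-p + r * i), 2 * (q + r * j)] := by
  convert rel_one_of_anti (S := !![1, 0; 0, -1]) (by simp) (anti_x_zero hy hx 1)
    ![2 * p, 2 * q] ![i, j] using 1
  ext n
  fin_cases n <;> simp <;> ring

lemma rel_one_x_half (hy : 0 < y) (hx : x = 1 / 2) (p q i j : ℤ) :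
    Rel r x y 1 ![2 * p, 2 * q] ![2 * (q - p + r * i), 2 * (q + r * j)] := by
  convert rel_one_of_anti (S := !![1, -1; 0, -1]) (by simp) (anti_x_half hy hx 1)
    ![2 * p, 2 * q] ![i, j] using 1
  ext n
  fin_cases n <;> simp <;> ring

lemma rel_one_norm_one (hy : 0 < y) (hN : x ^ 2 + y ^ 2 = 1) (p q : ℤ) :
    Rel r x y 1 ![2 * p, 2 * q] ![2 * q, 2 * p] := by
  convert rel_one_of_anti (S := !![0, -1; -1, 0]) (by simp) (anti_norm_one hy hN (-1))
    ![2 * p, 2 * q] ![0, 0] using 1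
  ext n
  fin_cases n <;> simp

lemma rel_one_hexagonal (hy : 0 < y) (hN : x ^ 2 + y ^ 2 = 1) (hx : x = 1 / 2) (p q i j : ℤ) :
    Rel r x y 1 ![2 * p, 2 * q] ![2 * (p + r * i), 2 * (p - q + r * j)] := by
  convert rel_one_of_anti (S := !![-1, 0; -1, 1]) (by simp) (anti_hexagonal hy hN hx (-1))
    ![2 * p, 2 * q] ![i, j] using 1
  ext n
  fin_cases n <;> simp <;> ring

/-- Lists all possible moves, for use in uniqueness: the symmetries `S` from `comm_cases`, and `-S`
for the reflections from `anti_cases`, each up to sign and translation by `rℤ²`. -/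
lemma rel_one_cases (hxy : (x, y) ∈ F₁) {p q p' q' : ℤ}
    (h : Rel r x y 1 ![2 * p, 2 * q] ![2 * p', 2 * q']) :
    ∃ ε i j a b : ℤ, (ε = 1 ∨ ε = -1) ∧ p' = ε * a + r * i ∧ q' = ε * b + r * j ∧
      ((a = p ∧ b = q) ∨ (x = 0 ∧ a = p ∧ b = -q) ∨ (x = 1 / 2 ∧ a = q - p ∧ b = q) ∨
        (x ^ 2 + y ^ 2 = 1 ∧ a = q ∧ b = p) ∨ (x ^ 2 + y ^ 2 = 1 ∧ x = 0 ∧ a = -q ∧ b = p) ∨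
        (x ^ 2 + y ^ 2 = 1 ∧ x = 1 / 2 ∧
          ((a = p - q ∧ b = p) ∨ (a = -q ∧ b = p - q) ∨ (a = p ∧ b = p - q)))) := by
  obtain ⟨S, s, m, -, h⟩ := h
  rcases h with ⟨hdet, hS, hu⟩ | ⟨hdet, hS, hu⟩
  · obtain ⟨ε, hε, h⟩ := comm_cases hxy hdet hS
    have h0 := congrFun hu 0
    have h1 := congrFun hu 1
    rcases h with rfl | ⟨hN, hx, rfl⟩ | ⟨hN, hx, rfl | rfl⟩ <;> simp at h0 h1
    · exact ⟨ε, m 0, m 1, p, q, hε, by linarith, by linarith, Or.inl ⟨rfl, rfl⟩⟩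
    · exact ⟨ε, m 0, m 1, -q, p, hε, by linarith, by linarith,
        Or.inr (Or.inr (Or.inr (Or.inr (Or.inl ⟨hN, hx, rfl, rfl⟩))))⟩
    · exact ⟨ε, m 0, m 1, p - q, p, hε, by linarith, by linarith,
        Or.inr (Or.inr (Or.inr (Or.inr (Or.inr ⟨hN, hx, Or.inl ⟨rfl, rfl⟩⟩))))⟩
    · exact ⟨ε, m 0, m 1, -q, p - q, hε, by linarith, by linarith,
        Or.inr (Or.inr (Or.inr (Or.inr (Or.inr ⟨hN, hx, Or.inr (Or.inl ⟨rfl, rfl⟩)⟩))))⟩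
  · obtain ⟨ε, hε, h⟩ := anti_cases hxy hdet hS
    have h0 := congrFun hu 0
    have h1 := congrFun hu 1
    have hε' : -ε = 1 ∨ -ε = -1 := by omega
    rcases h with ⟨hx, rfl⟩ | ⟨hx, rfl⟩ | ⟨hN, rfl⟩ | ⟨hN, hx, rfl⟩ <;> simp at h0 h1
    · exact ⟨-ε, m 0, m 1, p, -q, hε', by linarith, by linarith,
        Or.inr (Or.inl ⟨hx, rfl, rfl⟩)⟩
    · exact ⟨ε, m 0, m 1, q - p, q, hε, by linarith, by linarith,
        Or.inr (Or.inr (Or.inl ⟨hx, rfl, rfl⟩))⟩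
    · exact ⟨-ε, m 0, m 1, q, p, hε', by linarith, by linarith,
        Or.inr (Or.inr (Or.inr (Or.inl ⟨hN, rfl, rfl⟩)))⟩
    · exact ⟨-ε, m 0, m 1, p, p - q, hε', by linarith, by linarith,
        Or.inr (Or.inr (Or.inr (Or.inr (Or.inr ⟨hN, hx, Or.inr (Or.inr ⟨rfl, rfl⟩)⟩))))⟩

/-- The vectors with even coordinates `2k`, `2l`, where `k`, `l` satisfy `P`. -/
def evenPoints (P : ℤ → ℤ → Prop) : Set (Fin 2 → ℤ) := {u | ∃ k l, P k l ∧ u = ![2 * k, 2 * l]}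

lemma gridPoints_eq_image (r : ℕ) (P : ℤ → ℤ → Prop) :
    gridPoints r P = halfGrid r '' evenPoints P := by
  ext ξ
  have h : ∀ k l : ℤ, halfGrid r ![2 * k, 2 * l] = ![(k : ℝ) / r, (l : ℝ) / r] := by
    intro k l
    ext i
    fin_cases i <;> simp [halfGrid] <;> exact mul_div_mul_left _ _ two_ne_zero
  constructor
  · rintro ⟨k, l, hP, rfl⟩
    exact ⟨_, ⟨k, l, hP, rfl⟩, h k l⟩
  · rintro ⟨_, ⟨k, l, hP, rfl⟩, rfl⟩
    exact ⟨k, l, hP, h k l⟩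

lemma exists_even_of_compat_one {u : Fin 2 → ℤ} (h : Compat r 1 u) :
    ∃ p q, u = ![2 * p, 2 * q] := by
  obtain ⟨⟨q, hq⟩, ⟨p, hp⟩⟩ := h
  simp at hp hq
  refine ⟨p, -q, ?_⟩
  ext i
  fin_cases i
  · simpa using hp
  · simp
    omega

/-- The points satisfying `P` which are reached from `(p, q)`. -/
def Reaches (r : ℕ) (x y : ℝ) (A : Matrix (Fin 2) (Fin 2) ℤ) (P : ℤ → ℤ → Prop) (p q : ℤ) : Prop :=
  ∃ k l, P k l ∧ Relation.ReflTransGen (Rel r x y A) ![2 * p, 2 * q] ![2 * k, 2 * l]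

lemma Reaches.of_rel {A : Matrix (Fin 2) (Fin 2) ℤ} {P : ℤ → ℤ → Prop} {p q p' q' : ℤ}
    (h : Rel r x y A ![2 * p, 2 * q] ![2 * p', 2 * q']) (h' : Reaches r x y A P p' q') :
    Reaches r x y A P p q := by
  obtain ⟨k, l, hP, hrel⟩ := h'
  exact ⟨k, l, hP, hrel.head h⟩

lemma Reaches.self {A : Matrix (Fin 2) (Fin 2) ℤ} {P : ℤ → ℤ → Prop} {p q : ℤ} (h : P p q) :
    Reaches r x y A P p q :=
  ⟨p, q, h, Relation.ReflTransGen.refl⟩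

lemma isTransversal_one {P : ℤ → ℤ → Prop} (hex : ∀ p q, Reaches r x y 1 P p q)
    (huniq : ∀ p q p' q', P p q → P p' q' → Rel r x y 1 ![2 * p, 2 * q] ![2 * p', 2 * q'] →
      p = p' ∧ q = q') :
    IsTransversal r x y 1 (evenPoints P) where
  compat := by
    rintro _ ⟨k, l, -, rfl⟩
    simp [Compat]
  exists_rel u hu := by
    obtain ⟨p, q, rfl⟩ := exists_even_of_compat_one hu
    obtain ⟨k, l, hP, h⟩ := hex p q
    exact ⟨_, ⟨k, l, hP, rfl⟩, h⟩
  eq_of_rel := by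
    rintro _ ⟨p, q, hP, rfl⟩ _ ⟨p', q', hP', rfl⟩ h
    obtain ⟨rfl, rfl⟩ := huniq p q p' q' hP hP' h
    rfl

lemma isTransversal_one_generic (hr : 0 < r) (hxy : (x, y) ∈ F₁) (hN : 1 < x ^ 2 + y ^ 2)
    (hx : x ≠ 0) (hx' : x ≠ 1 / 2) :
    IsTransversal r x y 1 (evenPoints fun k l => (0 ≤ k ∧ 0 ≤ l ∧ 2 * k ≤ r ∧ 2 * l ≤ r) ∨
      (0 < k ∧ 2 * k < r ∧ r < 2 * l ∧ l < r)) := by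
  have hr' : (0 : ℤ) < r := by exact_mod_cast hr
  have hy := hxy.2.2.1
  refine isTransversal_one (reduce_generic hr'
    (fun p q i j => Reaches.of_rel (rel_one_translate hy p q i j))
    (fun p q i j => Reaches.of_rel (rel_one_neg hy p q i j))
    (fun k l _ _ _ _ => Reaches.self (by tauto)) (fun k l _ _ _ _ => Reaches.self (by tauto))) ?_
  intro p q p' q' h h' hrel
  have hb : 0 ≤ p ∧ p < r ∧ 0 ≤ q ∧ q < r := by omega
  have hb' : 0 ≤ p' ∧ p' < r ∧ 0 ≤ q' ∧ q' < r := by omega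
  obtain ⟨ε, i, j, a, b, hε, hp, hq, hc⟩ := rel_one_cases hxy hrel
  simp only [hN.ne', hx, hx', false_and, or_false] at hc
  obtain ⟨rfl, rfl⟩ := hc
  rcases hε with rfl | rfl <;>
    rcases mul_cases_of_bounds hr' (i := i) (by omega) (by omega) with hi | hi | hi <;>
    rcases mul_cases_of_bounds hr' (i := j) (by omega) (by omega) with hj | hj | hj <;> omega

lemma isTransversal_one_x_zero (hr : 0 < r) (hxy : (x, y) ∈ F₁) (hN : 1 < x ^ 2 + y ^ 2)
    (hx : x = 0) :
    IsTransversal r x y 1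
      (evenPoints fun k l => 0 ≤ k ∧ 0 ≤ l ∧ 2 * k ≤ r ∧ 2 * l ≤ r) := by
  have hr' : (0 : ℤ) < r := by exact_mod_cast hr
  have hy := hxy.2.2.1
  have hx' : x ≠ 1 / 2 := by rw [hx]; norm_num
  refine isTransversal_one (reduce_x_zero hr'
    (fun p q i j => Reaches.of_rel (rel_one_translate hy p q i j))
    (fun p q i j => Reaches.of_rel (rel_one_neg hy p q i j))
    (fun p q i j => Reaches.of_rel (rel_one_x_zero hy hx p q i j))
    (fun k l _ _ _ _ => Reaches.self (by tauto))) ?_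
  intro p q p' q' h h' hrel
  have hb : 0 ≤ p ∧ p < r ∧ 0 ≤ q ∧ q < r := by omega
  have hb' : 0 ≤ p' ∧ p' < r ∧ 0 ≤ q' ∧ q' < r := by omega
  obtain ⟨ε, i, j, a, b, hε, hp, hq, hc⟩ := rel_one_cases hxy hrel
  simp only [hN.ne', hx', false_and, or_false] at hc
  rcases hc with ⟨rfl, rfl⟩ | ⟨-, rfl, rfl⟩ <;> rcases hε with rfl | rfl <;>
    rcases mul_cases_of_bounds hr' (i := i) (by omega) (by omega) with hi | hi | hi <;>
    rcases mul_cases_of_bounds hr' (i := j) (by omega) (by omega) with hj | hj | hj <;> omega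

lemma isTransversal_one_x_half (hr : 0 < r) (hxy : (x, y) ∈ F₁) (hN : 1 < x ^ 2 + y ^ 2)
    (hx : x = 1 / 2) :
    IsTransversal r x y 1 (evenPoints fun k l => ((0 ≤ k ∧ 2 * k ≤ l ∧ 2 * l ≤ r) ∨
      (0 ≤ k ∧ 2 * k ≤ r ∧ l = 0)) ∨ (0 < k ∧ 2 * k < r ∧ r < 2 * l ∧ l < r ∧ 2 * k ≤ l)) := by
  have hr' : (0 : ℤ) < r := by exact_mod_cast hr
  have hy := hxy.2.2.1
  have hx' : x ≠ 0 := by rw [hx]; norm_num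
  refine isTransversal_one (reduce_x_half hr'
    (fun p q i j => Reaches.of_rel (rel_one_translate hy p q i j))
    (fun p q i j => Reaches.of_rel (rel_one_neg hy p q i j))
    (fun p q i j => Reaches.of_rel (rel_one_x_half hy hx p q i j))
    (fun k l _ _ _ => Reaches.self (by tauto)) (fun k _ _ => Reaches.self (by tauto))
    (fun k l _ _ _ _ _ => Reaches.self (by tauto))) ?_
  intro p q p' q' h h' hrel
  have hb : 0 ≤ p ∧ p < r ∧ 0 ≤ q ∧ q < r := by omega
  have hb' : 0 ≤ p' ∧ p' < r ∧ 0 ≤ q' ∧ q' < r := by omega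
  obtain ⟨ε, i, j, a, b, hε, hp, hq, hc⟩ := rel_one_cases hxy hrel
  simp only [hN.ne', hx', false_and, or_false, false_or] at hc
  rcases hc with ⟨rfl, rfl⟩ | ⟨-, rfl, rfl⟩ <;> rcases hε with rfl | rfl <;>
    rcases mul_cases_of_bounds hr' (i := i) (by omega) (by omega) with hi | hi | hi <;>
    rcases mul_cases_of_bounds hr' (i := j) (by omega) (by omega) with hj | hj | hj <;> omega

lemma isTransversal_one_norm_one (hr : 0 < r) (hxy : (x, y) ∈ F₁) (hN : x ^ 2 + y ^ 2 = 1)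
    (hx : x ≠ 0) (hx' : x ≠ 1 / 2) :
    IsTransversal r x y 1 (evenPoints fun k l => (0 ≤ k ∧ k ≤ l ∧ 2 * l ≤ r) ∨
      (0 < k ∧ 2 * k < r ∧ r < 2 * l ∧ l < r ∧ k + l ≤ r)) := by
  have hr' : (0 : ℤ) < r := by exact_mod_cast hr
  have hy := hxy.2.2.1
  refine isTransversal_one (reduce_norm_one hr'
    (fun p q i j => Reaches.of_rel (rel_one_translate hy p q i j))
    (fun p q i j => Reaches.of_rel (rel_one_neg hy p q i j))
    (fun p q => Reaches.of_rel (rel_one_norm_one hy hN p q))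
    (fun k l _ _ _ => Reaches.self (by tauto))
    (fun k l _ _ _ _ _ => Reaches.self (by tauto))) ?_
  intro p q p' q' h h' hrel
  have hb : 0 ≤ p ∧ p < r ∧ 0 ≤ q ∧ q < r := by omega
  have hb' : 0 ≤ p' ∧ p' < r ∧ 0 ≤ q' ∧ q' < r := by omega
  obtain ⟨ε, i, j, a, b, hε, hp, hq, hc⟩ := rel_one_cases hxy hrel
  simp only [hx, hx', false_and, and_false, or_false, false_or] at hc
  rcases hc with ⟨rfl, rfl⟩ | ⟨-, rfl, rfl⟩ <;> rcases hε with rfl | rfl <;>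
    rcases mul_cases_of_bounds hr' (i := i) (by omega) (by omega) with hi | hi | hi <;>
    rcases mul_cases_of_bounds hr' (i := j) (by omega) (by omega) with hj | hj | hj <;> omega

lemma isTransversal_one_square (hr : 0 < r) (hxy : (x, y) ∈ F₁) (hN : x ^ 2 + y ^ 2 = 1)
    (hx : x = 0) :
    IsTransversal r x y 1 (evenPoints fun k l => 0 ≤ k ∧ k ≤ l ∧ 2 * l ≤ r) := by
  have hr' : (0 : ℤ) < r := by exact_mod_cast hr
  have hy := hxy.2.2.1
  have hx' : x ≠ 1 / 2 := by rw [hx]; norm_num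
  refine isTransversal_one (reduce_square hr'
    (fun p q i j => Reaches.of_rel (rel_one_translate hy p q i j))
    (fun p q i j => Reaches.of_rel (rel_one_neg hy p q i j))
    (fun p q i j => Reaches.of_rel (rel_one_x_zero hy hx p q i j))
    (fun p q => Reaches.of_rel (rel_one_norm_one hy hN p q))
    (fun k l _ _ _ => Reaches.self (by tauto))) ?_
  intro p q p' q' h h' hrel
  have hb : 0 ≤ p ∧ p < r ∧ 0 ≤ q ∧ q < r := by omega
  have hb' : 0 ≤ p' ∧ p' < r ∧ 0 ≤ q' ∧ q' < r := by omega
  obtain ⟨ε, i, j, a, b, hε, hp, hq, hc⟩ := rel_one_cases hxy hrel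
  simp only [hx', false_and, and_false, or_false, false_or] at hc
  rcases hc with ⟨rfl, rfl⟩ | ⟨-, rfl, rfl⟩ | ⟨-, rfl, rfl⟩ | ⟨-, -, rfl, rfl⟩ <;>
    rcases hε with rfl | rfl <;>
    rcases mul_cases_of_bounds hr' (i := i) (by omega) (by omega) with hi | hi | hi <;>
    rcases mul_cases_of_bounds hr' (i := j) (by omega) (by omega) with hj | hj | hj <;> omega

lemma isTransversal_one_hexagonal (hr : 0 < r) (hxy : (x, y) ∈ F₁) (hN : x ^ 2 + y ^ 2 = 1)
    (hx : x = 1 / 2) :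
    IsTransversal r x y 1 (evenPoints fun k l => 0 ≤ 2 * k ∧ 2 * k ≤ l ∧ 2 * l ≤ k + r) := by
  have hr' : (0 : ℤ) < r := by exact_mod_cast hr
  have hy := hxy.2.2.1
  have hx' : x ≠ 0 := by rw [hx]; norm_num
  refine isTransversal_one (reduce_hexagonal hr'
    (fun p q i j => Reaches.of_rel (rel_one_translate hy p q i j))
    (fun p q i j => Reaches.of_rel (rel_one_neg hy p q i j))
    (fun p q i j => Reaches.of_rel (rel_one_x_half hy hx p q i j))
    (fun p q => Reaches.of_rel (rel_one_norm_one hy hN p q))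
    (fun p q i j => Reaches.of_rel (rel_one_hexagonal hy hN hx p q i j))
    (fun k l _ _ _ => Reaches.self (by tauto))) ?_
  intro p q p' q' h h' hrel
  have hb : 0 ≤ p ∧ p < r ∧ 0 ≤ q ∧ q < r := by omega
  have hb' : 0 ≤ p' ∧ p' < r ∧ 0 ≤ q' ∧ q' < r := by omega
  obtain ⟨ε, i, j, a, b, hε, hp, hq, hc⟩ := rel_one_cases hxy hrel
  simp only [hx', false_and, and_false, false_or] at hc
  rcases hc with ⟨rfl, rfl⟩ | ⟨-, rfl, rfl⟩ | ⟨-, rfl, rfl⟩ | ⟨-, -, ⟨rfl, rfl⟩ | ⟨rfl, rfl⟩ |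
      ⟨rfl, rfl⟩⟩ <;> rcases hε with rfl | rfl <;>
    rcases mul_cases_of_bounds hr' (i := i) (by omega) (by omega) with hi | hi | hi <;>
    rcases mul_cases_of_bounds hr' (i := j) (by omega) (by omega) with hj | hj | hj <;> omega

end One

/-! ### Representatives when `e^B = -1` -/

section NegOne

variable {r : ℕ} {x y : ℝ}

lemma mulVec_two (M : Matrix (Fin 2) (Fin 2) ℤ) (u : Fin 2 → ℤ) :
    M.mulVec u = ![M 0 0 * u 0 + M 0 1 * u 1, M 1 0 * u 0 + M 1 1 * u 1] := by
  ext i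
  fin_cases i <;> simp [Matrix.mulVec, dotProduct, Fin.sum_univ_two]

/-- For even `r` the conditions are a homogeneous linear system modulo 2 with invertible matrix. -/
lemma Compat.even {S : Matrix (Fin 2) (Fin 2) ℤ} (hS : S.det = 1 ∨ S.det = -1) {s : Fin 2 → ℤ}
    (h : Compat r S s) (hr : Even r) : 2 ∣ s 0 ∧ 2 ∣ s 1 := by
  obtain ⟨k, hk⟩ := hr
  obtain ⟨⟨a, ha⟩, ⟨b, hb⟩⟩ := h
  have hsq : S.det * S.det = 1 := by
    rcases hS with h | h <;> simp [h]
  have hd := S.det_fin_two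
  have hk' : (r : ℤ) = 2 * k := by omega
  rw [hk'] at ha hb
  refine ⟨⟨S.det * (S 0 0 * (b + k * (S 0 1 * S 1 1)) - S 0 1 * (a + k * (S 0 0 * S 1 0))), ?_⟩,
    ⟨S.det * (S 1 0 * (b + k * (S 0 1 * S 1 1)) - S 1 1 * (a + k * (S 0 0 * S 1 0))), ?_⟩⟩
  · linear_combination -s 0 * hsq + s 0 * S.det * hd + S.det * S 0 0 * hb - S.det * S 0 1 * ha
  · linear_combination -s 1 * hsq + s 1 * S.det * hd + S.det * S 1 0 * hb - S.det * S 1 1 * ha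

/-- Translations by `(1 - A) 2ℤ² + 2r ℤ²`, combined with a sign. -/
lemma rel_scalar (hy : 0 < y) (A : Matrix (Fin 2) (Fin 2) ℤ) {ε : ℤ} (hε : ε = 1 ∨ ε = -1)
    (u : Fin 2 → ℤ) (a b i j : ℤ) :
    Rel r x y A u ![ε * u 0 + 2 * a - 2 * (A 0 0 * a + A 0 1 * b) + 2 * r * i,
      ε * u 1 + 2 * b - 2 * (A 1 0 * a + A 1 1 * b) + 2 * r * j] := by
  refine ⟨!![ε, 0; 0, ε], ![2 * a, 2 * b], ![i, j], ?_, Or.inl ⟨?_, comm_scalar hy ε, ?_⟩⟩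
  · simp [Compat, mul_assoc]
  · rcases hε with rfl | rfl <;> simp
  · rw [mulVec_two, mulVec_two]
    ext n
    fin_cases n <;> simp <;> ring

lemma rel_anti_zero (hr : Even r) {A S : Matrix (Fin 2) (Fin 2) ℤ} (hdet : S.det = -1)
    (h : realMat S * Bmat x y = -(Bmat x y * realMat S)) (u : Fin 2 → ℤ) :
    Rel r x y A u (-A.mulVec (S.mulVec u)) := by
  refine ⟨S, 0, 0, ?_, Or.inr ⟨hdet, h, by simp⟩⟩
  have hr' : (2 : ℤ) ∣ r := by exact_mod_cast hr.two_dvd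
  simp only [Compat, Pi.zero_apply, zero_mul, sub_self, zero_sub, dvd_neg]
  exact ⟨hr'.mul_right _, hr'.mul_right _⟩

lemma rel_neg_one_translate (hy : 0 < y) (p q i j : ℤ) :
    Rel r x y (-1) ![2 * p, 2 * q] ![2 * (p + 2 * i), 2 * (q + 2 * j)] := by
  convert rel_scalar hy (-1) (Or.inl rfl) ![2 * p, 2 * q] i j 0 0 using 1
  ext n
  fin_cases n <;> simp <;> ring

lemma rel_neg_one_x_half (hr : Even r) (hy : 0 < y) (hx : x = 1 / 2) (p q : ℤ) :
    Rel r x y (-1) ![2 * p, 2 * q] ![2 * (p - q), 2 * -q] := by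
  convert rel_anti_zero (A := -1) (S := !![1, -1; 0, -1]) hr (by simp) (anti_x_half hy hx 1)
    ![2 * p, 2 * q] using 1
  ext n
  fin_cases n
  · simp
    ring
  · simp

lemma rel_neg_one_norm_one (hr : Even r) (hy : 0 < y) (hN : x ^ 2 + y ^ 2 = 1) (p q : ℤ) :
    Rel r x y (-1) ![2 * p, 2 * q] ![2 * q, 2 * p] := by
  convert rel_anti_zero (A := -1) (S := !![0, 1; 1, 0]) hr (by simp) (anti_norm_one hy hN 1)
    ![2 * p, 2 * q] using 1
  ext n
  fin_cases n <;> simp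

/-- For even `r` the vector `s` is even, so `s - As = 2s` and `2rm` both vanish modulo 4. Only the
action of `S` on `(p, q)` modulo 2 remains, where signs do not matter. -/
lemma rel_neg_one_cases (hr : Even r) (hxy : (x, y) ∈ F₁) {p q p' q' : ℤ}
    (h : Rel r x y (-1) ![2 * p, 2 * q] ![2 * p', 2 * q']) :
    (2 ∣ p' - p ∧ 2 ∣ q' - q) ∨ (x = 1 / 2 ∧ 2 ∣ p' - (p - q) ∧ 2 ∣ q' - q) ∨
      (x ^ 2 + y ^ 2 = 1 ∧ 2 ∣ p' - q ∧ 2 ∣ q' - p) ∨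
      (x ^ 2 + y ^ 2 = 1 ∧ x = 1 / 2 ∧
        ((2 ∣ p' - (p - q) ∧ 2 ∣ q' - p) ∨ (2 ∣ p' - q ∧ 2 ∣ q' - (p - q)) ∨
          (2 ∣ p' - p ∧ 2 ∣ q' - (p - q)))) := by
  obtain ⟨S, s, m, hs, h⟩ := h
  obtain ⟨⟨a, ha⟩, ⟨b, hb⟩⟩ := hs.even (by tauto) hr
  obtain rfl : s = ![2 * a, 2 * b] := by
    ext n
    fin_cases n <;> simp [ha, hb]
  obtain ⟨k, hk⟩ := hr
  have hk' : (r : ℤ) = 2 * k := by omega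
  have hrm : ∀ n : ℤ, 2 * (r : ℤ) * n = 4 * (k * n) := fun n => by rw [hk']; ring
  simp only [mulVec_two] at h
  rcases h with ⟨hdet, hS, hu⟩ | ⟨hdet, hS, hu⟩
  · obtain ⟨ε, hε, h⟩ := comm_cases hxy hdet hS
    have h0 := congrFun hu 0
    have h1 := congrFun hu 1
    rcases h with rfl | ⟨hN, hx, rfl⟩ | ⟨hN, hx, rfl | rfl⟩ <;>
      simp [hrm] at h0 h1 <;>
      generalize (k : ℤ) * m 0 = c at h0 <;> generalize (k : ℤ) * m 1 = d at h1
    · refine Or.inl ?_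
      rcases hε with rfl | rfl <;> omega
    · refine Or.inr (Or.inr (Or.inl ⟨hN, ?_⟩))
      rcases hε with rfl | rfl <;> omega
    · refine Or.inr (Or.inr (Or.inr ⟨hN, hx, ?_⟩))
      rcases hε with rfl | rfl <;> omega
    · refine Or.inr (Or.inr (Or.inr ⟨hN, hx, ?_⟩))
      rcases hε with rfl | rfl <;> omega
  · obtain ⟨ε, hε, h⟩ := anti_cases hxy hdet hS
    have h0 := congrFun hu 0
    have h1 := congrFun hu 1
    rcases h with ⟨hx, rfl⟩ | ⟨hx, rfl⟩ | ⟨hN, rfl⟩ | ⟨hN, hx, rfl⟩ <;>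
      simp [hrm] at h0 h1 <;>
      generalize (k : ℤ) * m 0 = c at h0 <;> generalize (k : ℤ) * m 1 = d at h1
    · refine Or.inl ?_
      rcases hε with rfl | rfl <;> omega
    · refine Or.inr (Or.inl ⟨hx, ?_⟩)
      rcases hε with rfl | rfl <;> omega
    · refine Or.inr (Or.inr (Or.inl ⟨hN, ?_⟩))
      rcases hε with rfl | rfl <;> omega
    · refine Or.inr (Or.inr (Or.inr ⟨hN, hx, ?_⟩))
      rcases hε with rfl | rfl <;> omega

lemma exists_even_of_compat_neg_one {u : Fin 2 → ℤ} (h : Compat r (-1) u) :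
    ∃ p q, u = ![2 * p, 2 * q] := by
  obtain ⟨⟨q, hq⟩, ⟨p, hp⟩⟩ := h
  simp at hp hq
  refine ⟨-p, q, ?_⟩
  ext i
  fin_cases i
  · simp
    omega
  · simpa using hq

lemma isTransversal_neg_one {P : ℤ → ℤ → Prop} (hex : ∀ p q, Reaches r x y (-1) P p q)
    (huniq : ∀ p q p' q', P p q → P p' q' → Rel r x y (-1) ![2 * p, 2 * q] ![2 * p', 2 * q'] →
      p = p' ∧ q = q') :
    IsTransversal r x y (-1) (evenPoints P) where
  compat := by
    rintro _ ⟨k, l, -, rfl⟩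
    simp [Compat]
  exists_rel u hu := by
    obtain ⟨p, q, rfl⟩ := exists_even_of_compat_neg_one hu
    obtain ⟨k, l, hP, h⟩ := hex p q
    exact ⟨_, ⟨k, l, hP, rfl⟩, h⟩
  eq_of_rel := by
    rintro _ ⟨p, q, hP, rfl⟩ _ ⟨p', q', hP', rfl⟩ h
    obtain ⟨rfl, rfl⟩ := huniq p q p' q' hP hP' h
    rfl

lemma isTransversal_neg_one_odd (hr : Odd r) (hy : 0 < y) :
    IsTransversal r x y (-1) (evenPoints fun k l => k = 0 ∧ l = 0) := by
  refine isTransversal_neg_one (fun p q => ?_) (by omega)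
  obtain ⟨n, hn⟩ := hr
  refine Reaches.of_rel (p' := 0) (q' := 0) ?_ (Reaches.self ⟨rfl, rfl⟩)
  -- With `r = 2n + 1` the shift is `p + 2np - rp = 0`, and likewise for `q`.
  convert rel_scalar hy (-1) (Or.inl rfl) ![2 * p, 2 * q] (n * p) (n * q) (-p) (-q) using 1
  ext i
  fin_cases i <;> simp <;> ring

lemma reduce_mod_two {Q : ℤ → ℤ → Prop} (hI : ∀ p q i j, Q (p + 2 * i) (q + 2 * j) → Q p q)
    (h00 : Q 0 0) (h10 : Q 1 0) (h01 : Q 0 1) (h11 : Q 1 1) (p q : ℤ) : Q p q := by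
  refine reduce_mod two_pos hI (fun p q _ _ _ _ => ?_) p q
  obtain rfl | rfl : p = 0 ∨ p = 1 := by omega
  all_goals
    obtain rfl | rfl : q = 0 ∨ q = 1 := by omega
    all_goals assumption

lemma isTransversal_neg_one_generic (hr : Even r) (hxy : (x, y) ∈ F₁) (hN : 1 < x ^ 2 + y ^ 2)
    (hx : x ≠ 1 / 2) :
    IsTransversal r x y (-1) (evenPoints fun k l => (k = 0 ∧ l = 0) ∨ (k = 1 ∧ l = 0) ∨
      (k = 0 ∧ l = 1) ∨ (k = 1 ∧ l = 1)) := by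
  refine isTransversal_neg_one (reduce_mod_two
    (fun p q i j => Reaches.of_rel (rel_neg_one_translate hxy.2.2.1 p q i j))
    (Reaches.self (by omega)) (Reaches.self (by omega)) (Reaches.self (by omega))
    (Reaches.self (by omega))) ?_
  intro p q p' q' h h' hrel
  have hc := rel_neg_one_cases hr hxy hrel
  simp only [hN.ne', hx, false_and, or_false] at hc
  omega

lemma isTransversal_neg_one_x_half (hr : Even r) (hxy : (x, y) ∈ F₁) (hN : 1 < x ^ 2 + y ^ 2)
    (hx : x = 1 / 2) :
    IsTransversal r x y (-1) (evenPoints fun k l => (k = 0 ∧ l = 0) ∨ (k = 1 ∧ l = 0) ∨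
      (k = 1 ∧ l = 1)) := by
  have hT := fun p q i j => Reaches.of_rel (r := r) (x := x)
    (P := fun k l => (k = 0 ∧ l = 0) ∨ (k = 1 ∧ l = 0) ∨ (k = 1 ∧ l = 1))
    (rel_neg_one_translate hxy.2.2.1 p q i j)
  refine isTransversal_neg_one (reduce_mod_two hT
    (Reaches.self (by omega)) (Reaches.self (by omega))
    (Reaches.of_rel (rel_neg_one_x_half hr hxy.2.2.1 hx 0 1)
      (hT _ _ 1 1 (Reaches.self (by omega)))) (Reaches.self (by omega))) ?_
  intro p q p' q' h h' hrel
  have hc := rel_neg_one_cases hr hxy hrel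
  simp only [hN.ne', false_and, or_false] at hc
  omega

lemma isTransversal_neg_one_norm_one (hr : Even r) (hxy : (x, y) ∈ F₁) (hN : x ^ 2 + y ^ 2 = 1)
    (hx : x ≠ 1 / 2) :
    IsTransversal r x y (-1) (evenPoints fun k l => (k = 0 ∧ l = 0) ∨ (k = 1 ∧ l = 0) ∨
      (k = 1 ∧ l = 1)) := by
  refine isTransversal_neg_one (reduce_mod_two
    (fun p q i j => Reaches.of_rel (rel_neg_one_translate hxy.2.2.1 p q i j))
    (Reaches.self (by omega)) (Reaches.self (by omega))
    (Reaches.of_rel (rel_neg_one_norm_one hr hxy.2.2.1 hN 0 1) (Reaches.self (by omega)))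
    (Reaches.self (by omega))) ?_
  intro p q p' q' h h' hrel
  have hc := rel_neg_one_cases hr hxy hrel
  simp only [hx, false_and, and_false, or_false, false_or] at hc
  omega

lemma isTransversal_neg_one_hexagonal (hr : Even r) (hxy : (x, y) ∈ F₁) (hN : x ^ 2 + y ^ 2 = 1)
    (hx : x = 1 / 2) :
    IsTransversal r x y (-1) (evenPoints fun k l => (k = 0 ∧ l = 0) ∨ (k = 1 ∧ l = 1)) := by
  have hT := fun p q i j => Reaches.of_rel (r := r) (x := x)
    (P := fun k l => (k = 0 ∧ l = 0) ∨ (k = 1 ∧ l = 1))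
    (rel_neg_one_translate hxy.2.2.1 p q i j)
  have h01 : Reaches r x y (-1) (fun k l => (k = 0 ∧ l = 0) ∨ (k = 1 ∧ l = 1)) 0 1 :=
    Reaches.of_rel (rel_neg_one_x_half hr hxy.2.2.1 hx 0 1)
      (hT _ _ 1 1 (Reaches.self (by omega)))
  refine isTransversal_neg_one (reduce_mod_two hT (Reaches.self (by omega))
    (Reaches.of_rel (rel_neg_one_norm_one hr hxy.2.2.1 hN 1 0) h01) h01
    (Reaches.self (by omega))) ?_
  intro p q p' q' h h' hrel
  have hc := rel_neg_one_cases hr hxy hrel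
  omega

end NegOne

/-! ### Representatives when `e^B` has order 3, 4 or 6 -/

section FiniteOrder

variable {r : ℕ} {x y : ℝ}

lemma isTransversal_singleton {A : Matrix (Fin 2) (Fin 2) ℤ} {t : Fin 2 → ℤ}
    (ht : Compat r A t) (h : ∀ u, Compat r A u → Rel r x y A u t) :
    IsTransversal r x y A {t} where
  compat := by
    rintro u rfl
    exact ht
  exists_rel u hu := ⟨t, rfl, Relation.ReflTransGen.single (h u hu)⟩
  eq_of_rel := by
    rintro u rfl u' rfl _
    rfl

lemma isTransversal_pair {A : Matrix (Fin 2) (Fin 2) ℤ} {t t' : Fin 2 → ℤ}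
    (ht : Compat r A t) (ht' : Compat r A t')
    (h : ∀ u, Compat r A u → Rel r x y A u t ∨ Rel r x y A u t')
    (hne : ¬Rel r x y A t t') (hne' : ¬Rel r x y A t' t) :
    IsTransversal r x y A {t, t'} where
  compat := by
    rintro u (rfl | rfl)
    · exact ht
    · exact ht'
  exists_rel u hu := by
    rcases h u hu with h | h
    · exact ⟨t, Or.inl rfl, Relation.ReflTransGen.single h⟩
    · exact ⟨t', Or.inr rfl, Relation.ReflTransGen.single h⟩
  eq_of_rel := by
    rintro u (rfl | rfl) u' (rfl | rfl) h
    · rfl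
    · exact absurd h hne
    · exact absurd h hne'
    · rfl

/-- A criterion for `u` and `t` to be related through `S = ±1`. -/
lemma rel_of_entries (hy : 0 < y) {A : Matrix (Fin 2) (Fin 2) ℤ} {ε : ℤ} (hε : ε = 1 ∨ ε = -1)
    {u t : Fin 2 → ℤ} (a b i j : ℤ)
    (h0 : t 0 = ε * u 0 + 2 * a - 2 * (A 0 0 * a + A 0 1 * b) + 2 * r * i)
    (h1 : t 1 = ε * u 1 + 2 * b - 2 * (A 1 0 * a + A 1 1 * b) + 2 * r * j) :
    Rel r x y A u t := by
  convert rel_scalar hy A hε u a b i j using 1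
  ext n
  fin_cases n
  · exact h0
  · exact h1

/-- Compatible vectors agree modulo 2, and `det(1 - A) = 1`, so their differences all lie in `(1 -
A)2ℤ²`. The witnesses below are the solution of that unimodular system. -/
lemma isTransversal_order_six (hy : 0 < y) {b : ℤ} (hb : 2 ∣ (r : ℤ) - b) :
    IsTransversal r x y !![1, -1; 1, 0] {![b, 0]} := by
  refine isTransversal_singleton ?_ fun u hu => ?_
  · simp [Compat]
    omega
  · obtain ⟨h0, h1⟩ := hu
    simp at h0 h1
    refine rel_of_entries hy (Or.inl rfl) ((b - u 0) / 2 - -u 1 / 2) ((b - u 0) / 2) 0 0 ?_ ?_ <;>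
      simp <;> omega

lemma isTransversal_order_six_inv (hy : 0 < y) {b : ℤ} (hb : 2 ∣ (r : ℤ) - b) :
    IsTransversal r x y !![0, 1; -1, 1] {![0, b]} := by
  refine isTransversal_singleton ?_ fun u hu => ?_
  · simp [Compat]
    omega
  · obtain ⟨h0, h1⟩ := hu
    simp at h0 h1
    refine rel_of_entries hy (Or.inl rfl) ((b - u 1) / 2) ((b - u 1) / 2 - -u 0 / 2) 0 0 ?_ ?_ <;>
      simp <;> omega

lemma order_four_even {A : Matrix (Fin 2) (Fin 2) ℤ}
    (hA : A = !![0, -1; 1, 0] ∨ A = !![0, 1; -1, 0]) {u : Fin 2 → ℤ} (hu : Compat r A u) :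
    2 ∣ u 0 ∧ 2 ∣ u 1 := by
  obtain ⟨h0, h1⟩ := hu
  rcases hA with rfl | rfl <;> simp at h0 h1 <;> omega

/-- Here `det(1 - A) = 2`, and `(1 - A)2ℤ²` consists of the even vectors whose coordinate sum is
divisible by 4. -/
lemma rel_order_four (hy : 0 < y) {A : Matrix (Fin 2) (Fin 2) ℤ}
    (hA : A = !![0, -1; 1, 0] ∨ A = !![0, 1; -1, 0]) {u t : Fin 2 → ℤ} (hu : Compat r A u)
    (ht : Compat r A t) (i : ℤ) (h : 4 ∣ t 0 + t 1 - (u 0 + u 1) - 2 * r * i) :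
    Rel r x y A u t := by
  obtain ⟨hu0, hu1⟩ := order_four_even hA hu
  obtain ⟨ht0, ht1⟩ := order_four_even hA ht
  rw [mul_assoc] at h
  obtain ⟨c, hc⟩ : ∃ c, (r : ℤ) * i = c := ⟨_, rfl⟩
  rw [hc] at h
  obtain ⟨d₀, hd₀⟩ : ∃ d, t 0 - u 0 - 2 * c = 2 * d := ⟨(t 0 - u 0 - 2 * c) / 2, by omega⟩
  obtain ⟨d₁, hd₁⟩ : ∃ d, t 1 - u 1 = 2 * d := ⟨(t 1 - u 1) / 2, by omega⟩
  rcases hA with rfl | rfl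
  · refine rel_of_entries hy (Or.inl rfl) ((d₀ - d₁) / 2) ((d₀ + d₁) / 2) i 0 ?_ ?_ <;>
      simp [mul_assoc, hc] <;> omega
  · refine rel_of_entries hy (Or.inl rfl) ((d₀ + d₁) / 2) ((d₁ - d₀) / 2) i 0 ?_ ?_ <;>
      simp [mul_assoc, hc] <;> omega

lemma isTransversal_order_four_odd (hy : 0 < y) (hr : Odd r) {A : Matrix (Fin 2) (Fin 2) ℤ}
    (hA : A = !![0, -1; 1, 0] ∨ A = !![0, 1; -1, 0]) :
    IsTransversal r x y A {![0, 0]} := by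
  have h0 : Compat r A ![0, 0] := by
    rcases hA with rfl | rfl <;> simp [Compat]
  refine isTransversal_singleton h0 fun u hu => ?_
  obtain ⟨⟨a, ha⟩, ⟨b, hb⟩⟩ := order_four_even hA hu
  obtain ⟨n, hn⟩ := hr
  refine rel_order_four hy hA hu h0 (-(a + b)) ⟨n * (a + b), ?_⟩
  rw [ha, hb, hn]
  simp
  ring

lemma isTransversal_order_four_even (hr : Even r) (hxy : (x, y) ∈ F₁) (hx : x = 0)
    {A : Matrix (Fin 2) (Fin 2) ℤ} (hA : A = !![0, -1; 1, 0] ∨ A = !![0, 1; -1, 0]) :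
    IsTransversal r x y A {![0, 0], ![0, 2]} := by
  have h0 : Compat r A ![0, 0] := by
    rcases hA with rfl | rfl <;> simp [Compat]
  have h2 : Compat r A ![0, 2] := by
    rcases hA with rfl | rfl <;> simp [Compat]
  have hx' : x ≠ 1 / 2 := by rw [hx]; norm_num
  -- For even `r`, the coordinate sum modulo 4 is invariant: symmetries of the square lattice only
  -- permute coordinates and change signs, and both translations contribute multiples of 4.
  have key : ∀ u u' : Fin 2 → ℤ, 2 ∣ u 0 → 2 ∣ u 1 → Rel r x y A u u' →
      4 ∣ u' 0 + u' 1 - (u 0 + u 1) := by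
    rintro u u' ⟨p, hp⟩ ⟨q, hq⟩ ⟨S, s, m, hs, h⟩
    obtain ⟨⟨a, ha⟩, ⟨b, hb⟩⟩ := hs.even (by tauto) hr
    obtain rfl : s = ![2 * a, 2 * b] := by
      ext n
      fin_cases n <;> simp [ha, hb]
    obtain rfl : u = ![2 * p, 2 * q] := by
      ext n
      fin_cases n <;> simp [hp, hq]
    obtain ⟨k, hk⟩ := hr
    have hk' : (r : ℤ) = 2 * k := by omega
    have hrm : ∀ n : ℤ, 2 * (r : ℤ) * n = 4 * (k * n) := fun n => by rw [hk']; ring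
    simp only [mulVec_two] at h
    rcases h with ⟨hdet, hS, hu⟩ | ⟨hdet, hS, hu⟩
    · obtain ⟨ε, hε, h⟩ := comm_cases hxy hdet hS
      simp only [hx', false_and, and_false, or_false] at h
      have h0 := congrFun hu 0
      have h1 := congrFun hu 1
      rcases h with rfl | ⟨-, -, rfl⟩ <;> rcases hA with rfl | rfl <;>
        simp [hrm] at h0 h1 ⊢ <;>
        generalize (k : ℤ) * m 0 = c at h0 <;> generalize (k : ℤ) * m 1 = d at h1 <;>
        rcases hε with rfl | rfl <;> omega
    · obtain ⟨ε, hε, h⟩ := anti_cases hxy hdet hS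
      simp only [hx', false_and, and_false, or_false, false_or] at h
      have h0 := congrFun hu 0
      have h1 := congrFun hu 1
      rcases h with ⟨-, rfl⟩ | ⟨-, rfl⟩ <;> rcases hA with rfl | rfl <;>
        simp [hrm] at h0 h1 ⊢ <;>
        generalize (k : ℤ) * m 0 = c at h0 <;> generalize (k : ℤ) * m 1 = d at h1 <;>
        rcases hε with rfl | rfl <;> omega
  refine isTransversal_pair h0 h2 (fun u hu => ?_) (fun h => ?_) (fun h => ?_)
  · obtain ⟨hu0, hu1⟩ := order_four_even hA hu
    by_cases h : 4 ∣ u 0 + u 1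
    · exact Or.inl (rel_order_four hxy.2.2.1 hA hu h0 0 (by simp; omega))
    · exact Or.inr (rel_order_four hxy.2.2.1 hA hu h2 0 (by simp; omega))
  · have := key _ _ (by simp) (by simp) h
    revert this
    simp
  · have := key _ _ (by simp) (by simp) h
    revert this
    simp

lemma order_three_even {A : Matrix (Fin 2) (Fin 2) ℤ}
    (hA : A = !![0, -1; 1, -1] ∨ A = !![-1, 1; -1, 0]) {u t : Fin 2 → ℤ} (hu : Compat r A u)
    (ht : Compat r A t) : 2 ∣ t 0 - u 0 ∧ 2 ∣ t 1 - u 1 := by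
  obtain ⟨h0, h1⟩ := hu
  obtain ⟨h0', h1'⟩ := ht
  rcases hA with rfl | rfl <;> simp at h0 h1 h0' h1' <;> omega

/-- Here `det(1 - A) = 3`, and `(1 - A)ℤ²` consists of the vectors with coordinate sum divisible by
3; the sign `ε` comes from `S = ±1`. -/
lemma rel_order_three (hy : 0 < y) {A : Matrix (Fin 2) (Fin 2) ℤ}
    (hA : A = !![0, -1; 1, -1] ∨ A = !![-1, 1; -1, 0]) {ε : ℤ} (hε : ε = 1 ∨ ε = -1)
    {u t : Fin 2 → ℤ} (hu : Compat r A u) (ht : Compat r A t) (i : ℤ)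
    (h : 3 ∣ t 0 + t 1 - ε * (u 0 + u 1) - 2 * r * i) : Rel r x y A u t := by
  obtain ⟨h0, h1⟩ := order_three_even hA hu ht
  rw [mul_assoc] at h
  obtain ⟨c, hc⟩ : ∃ c, (r : ℤ) * i = c := ⟨_, rfl⟩
  rw [hc] at h
  obtain ⟨d₀, hd₀⟩ : ∃ d, t 0 - ε * u 0 - 2 * c = 2 * d := by
    refine ⟨(t 0 - ε * u 0 - 2 * c) / 2, ?_⟩
    rcases hε with rfl | rfl <;> omega
  obtain ⟨d₁, hd₁⟩ : ∃ d, t 1 - ε * u 1 = 2 * d := by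
    refine ⟨(t 1 - ε * u 1) / 2, ?_⟩
    rcases hε with rfl | rfl <;> omega
  obtain ⟨e, he⟩ : (3 : ℤ) ∣ d₀ + d₁ := by
    rcases hε with rfl | rfl <;> omega
  rcases hA with rfl | rfl
  · refine rel_of_entries hy hε (d₀ - e) e i 0 ?_ ?_ <;> simp [mul_assoc, hc] <;> omega
  · refine rel_of_entries hy hε e (d₁ - e) i 0 ?_ ?_ <;> simp [mul_assoc, hc] <;> omega

lemma isTransversal_order_three_of_not_dvd (hy : 0 < y) (hr : ¬3 ∣ r)
    {A : Matrix (Fin 2) (Fin 2) ℤ} (hA : A = !![0, -1; 1, -1] ∨ A = !![-1, 1; -1, 0])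
    {t : Fin 2 → ℤ} (ht : Compat r A t) : IsTransversal r x y A {t} := by
  refine isTransversal_singleton ht fun u hu => ?_
  have h3 : ∃ n : ℤ, (1 : ℤ) - 4 * r * r = 3 * n := by
    obtain ⟨n, hn | hn⟩ : ∃ n : ℤ, (r : ℤ) = 3 * n + 1 ∨ (r : ℤ) = 3 * n + 2 :=
      ⟨r / 3, by omega⟩
    · exact ⟨-1 - 8 * n - 12 * n * n, by rw [hn]; ring⟩
    · exact ⟨-5 - 16 * n - 12 * n * n, by rw [hn]; ring⟩
  obtain ⟨n, hn⟩ := h3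
  -- Since `4r² ≡ 1` modulo 3, the number `2r` is its own inverse, and a translation by `2rℤ²`
  -- cancels the difference of the sums.
  refine rel_order_three hy hA (Or.inl rfl) hu ht (2 * r * (t 0 + t 1 - (u 0 + u 1)))
    ⟨n * (t 0 + t 1 - (u 0 + u 1)), ?_⟩
  linear_combination (t 0 + t 1 - (u 0 + u 1)) * hn

/-- Both column sums of a symmetry of the hexagonal lattice are congruent to the same `±1` modulo
3. -/
lemma hexagonal_column_sums (hxy : (x, y) ∈ F₁) (hx : x = 1 / 2) {S : Matrix (Fin 2) (Fin 2) ℤ}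
    (h : (S.det = 1 ∧ realMat S * Bmat x y = Bmat x y * realMat S) ∨
      (S.det = -1 ∧ realMat S * Bmat x y = -(Bmat x y * realMat S))) :
    ∃ δ : ℤ, (δ = 1 ∨ δ = -1) ∧ 3 ∣ S 0 0 + S 1 0 - δ ∧ 3 ∣ S 0 1 + S 1 1 - δ := by
  have hx' : x ≠ 0 := by rw [hx]; norm_num
  rcases h with ⟨hdet, hS⟩ | ⟨hdet, hS⟩
  · obtain ⟨ε, hε, h⟩ := comm_cases hxy hdet hS
    simp only [hx', false_and, and_false, false_or] at h
    rcases h with rfl | ⟨-, -, rfl | rfl⟩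
    · exact ⟨ε, hε, by simp, by simp⟩
    · refine ⟨-ε, by omega, ?_, ?_⟩
      · simp
        omega
      · simp
    · refine ⟨ε, hε, ?_, ?_⟩
      · simp
      · simp
        omega
  · obtain ⟨ε, hε, h⟩ := anti_cases hxy hdet hS
    simp only [hx', false_and, false_or] at h
    rcases h with ⟨-, rfl⟩ | ⟨-, rfl⟩ | ⟨-, -, rfl⟩
    · refine ⟨ε, hε, ?_, ?_⟩
      · simp
      · simp
        omega
    · exact ⟨ε, hε, by simp, by simp⟩
    · refine ⟨-ε, by omega, ?_, ?_⟩
      · simp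
        omega
      · simp

/-- The column sums of `A` are 1 modulo 3 and those of `S` share one sign, so the coordinate sum
modulo 3 is preserved up to sign. The classes `1` and `2` merge, which leaves two orbits. -/
lemma order_three_invariant (hxy : (x, y) ∈ F₁) (hx : x = 1 / 2) (hr : 3 ∣ r)
    {A : Matrix (Fin 2) (Fin 2) ℤ} (hA : A = !![0, -1; 1, -1] ∨ A = !![-1, 1; -1, 0])
    {u u' : Fin 2 → ℤ} (h : Rel r x y A u u') :
    ∃ δ : ℤ, (δ = 1 ∨ δ = -1) ∧ 3 ∣ u' 0 + u' 1 - δ * (u 0 + u 1) := by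
  obtain ⟨S, s, m, -, h⟩ := h
  obtain ⟨δ, hδ, ⟨a, ha⟩, ⟨b, hb⟩⟩ := hexagonal_column_sums hxy hx (S := S) (by tauto)
  obtain ⟨c, hc⟩ : (3 : ℤ) ∣ A 0 0 + A 1 0 - 1 := by
    rcases hA with rfl | rfl <;> simp
  obtain ⟨d, hd⟩ : (3 : ℤ) ∣ A 0 1 + A 1 1 - 1 := by
    rcases hA with rfl | rfl <;> simp
  obtain ⟨k, hk⟩ := hr
  have hk' : (r : ℤ) = 3 * k := by exact_mod_cast hk
  simp only [mulVec_two] at h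
  rcases h with ⟨-, -, rfl⟩ | ⟨-, -, rfl⟩
  · refine ⟨δ, hδ, ⟨a * u 0 + b * u 1 - c * s 0 - d * s 1 + 2 * k * (m 0 + m 1), ?_⟩⟩
    simp only [Pi.add_apply, Pi.sub_apply, Pi.smul_apply, smul_eq_mul, Matrix.cons_val_zero,
      Matrix.cons_val_one]
    linear_combination u 0 * ha + u 1 * hb - s 0 * hc - s 1 * hd + 2 * (m 0 + m 1) * hk'
  · refine ⟨-δ, by omega, ⟨-(a * u 0 + b * u 1) - c * (S 0 0 * u 0 + S 0 1 * u 1) -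
      d * (S 1 0 * u 0 + S 1 1 * u 1) - c * s 0 - d * s 1 + 2 * k * (m 0 + m 1), ?_⟩⟩
    simp only [Pi.add_apply, Pi.sub_apply, Pi.neg_apply, Pi.smul_apply, smul_eq_mul,
      Matrix.cons_val_zero, Matrix.cons_val_one]
    linear_combination -u 0 * ha - u 1 * hb - (s 0 + (S 0 0 * u 0 + S 0 1 * u 1)) * hc -
      (s 1 + (S 1 0 * u 0 + S 1 1 * u 1)) * hd + 2 * (m 0 + m 1) * hk'

lemma isTransversal_order_three_of_dvd (hxy : (x, y) ∈ F₁) (hx : x = 1 / 2) (hr : 3 ∣ r)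
    {A : Matrix (Fin 2) (Fin 2) ℤ} (hA : A = !![0, -1; 1, -1] ∨ A = !![-1, 1; -1, 0])
    {t t' : Fin 2 → ℤ} (ht : Compat r A t) (ht' : Compat r A t') (h0 : 3 ∣ t 0 + t 1)
    (h0' : ¬3 ∣ t' 0 + t' 1) : IsTransversal r x y A {t, t'} := by
  refine isTransversal_pair ht ht' (fun u hu => ?_) (fun h => ?_) (fun h => ?_)
  · by_cases h : 3 ∣ u 0 + u 1
    · exact Or.inl (rel_order_three hxy.2.2.1 hA (Or.inl rfl) hu ht 0 (by omega))
    · by_cases h' : 3 ∣ t' 0 + t' 1 - (u 0 + u 1)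
      · exact Or.inr (rel_order_three hxy.2.2.1 hA (Or.inl rfl) hu ht' 0 (by omega))
      · have h1 : (u 0 + u 1) % 3 = 1 ∨ (u 0 + u 1) % 3 = 2 := by omega
        exact Or.inr (rel_order_three hxy.2.2.1 hA (Or.inr rfl) hu ht' 0
          (by rcases h1 with h1 | h1 <;> omega))
  · obtain ⟨δ, hδ, h⟩ := order_three_invariant hxy hx hr hA h
    rcases hδ with rfl | rfl <;> omega
  · obtain ⟨δ, hδ, h⟩ := order_three_invariant hxy hx hr hA h
    rcases hδ with rfl | rfl <;> omega

end FiniteOrder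

/-! ### The table of representatives -/

section Angles

variable {lam : ℝ}

lemma AngleMod.cos_sin {θ : ℝ} (h : AngleMod θ lam) : cos lam = cos θ ∧ sin lam = sin θ := by
  obtain ⟨j, rfl⟩ := h
  have : θ + 2 * π * j = θ + j * (2 * π) := by ring
  rw [this, cos_add_nat_mul_two_pi, sin_add_nat_mul_two_pi]
  exact ⟨rfl, rfl⟩

lemma AngleMod.cos_sin_pi_add {θ θ' : ℝ} (hθ : θ' = π + θ) (h : AngleMod θ' lam) :
    cos lam = -cos θ ∧ sin lam = -sin θ := by
  rw [h.cos_sin.1, h.cos_sin.2, hθ, cos_add, sin_add]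
  simp

lemma cos_sin_one_third : cos (1 / 3 * π) = 1 / 2 ∧ sin (1 / 3 * π) = √3 / 2 := by
  rw [one_div_mul_eq_div, cos_pi_div_three, sin_pi_div_three]
  exact ⟨rfl, rfl⟩

lemma cos_sin_one_half : cos (1 / 2 * π) = 0 ∧ sin (1 / 2 * π) = 1 := by
  rw [one_div_mul_eq_div, cos_pi_div_two, sin_pi_div_two]
  exact ⟨rfl, rfl⟩

lemma cos_sin_two_thirds : cos (2 / 3 * π) = -1 / 2 ∧ sin (2 / 3 * π) = √3 / 2 := by
  have : 2 / 3 * π = π - 1 / 3 * π := by ring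
  rw [this, cos_pi_sub, sin_pi_sub, cos_sin_one_third.1, cos_sin_one_third.2]
  exact ⟨by ring, rfl⟩

lemma AngleMod.values_one_third (h : AngleMod (1 / 3 * π) lam) :
    cos lam = 1 / 2 ∧ sin lam = √3 / 2 := by
  rw [h.cos_sin.1, h.cos_sin.2]
  exact cos_sin_one_third

lemma AngleMod.values_five_thirds (h : AngleMod (5 / 3 * π) lam) :
    cos lam = 1 / 2 ∧ sin lam = -(√3 / 2) := by
  obtain ⟨h1, h2⟩ := h.cos_sin_pi_add (θ := 2 / 3 * π) (by ring)
  rw [h1, h2, cos_sin_two_thirds.1, cos_sin_two_thirds.2]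
  exact ⟨by ring, rfl⟩

lemma AngleMod.values_one_half (h : AngleMod (1 / 2 * π) lam) : cos lam = 0 ∧ sin lam = 1 := by
  rw [h.cos_sin.1, h.cos_sin.2]
  exact cos_sin_one_half

lemma AngleMod.values_three_halves (h : AngleMod (3 / 2 * π) lam) :
    cos lam = 0 ∧ sin lam = -1 := by
  obtain ⟨h1, h2⟩ := h.cos_sin_pi_add (θ := 1 / 2 * π) (by ring)
  rw [h1, h2, cos_sin_one_half.1, cos_sin_one_half.2]
  exact ⟨by ring, rfl⟩

lemma AngleMod.values_two_thirds (h : AngleMod (2 / 3 * π) lam) :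
    cos lam = -1 / 2 ∧ sin lam = √3 / 2 := by
  rw [h.cos_sin.1, h.cos_sin.2]
  exact cos_sin_two_thirds

lemma AngleMod.values_four_thirds (h : AngleMod (4 / 3 * π) lam) :
    cos lam = -1 / 2 ∧ sin lam = -(√3 / 2) := by
  obtain ⟨h1, h2⟩ := h.cos_sin_pi_add (θ := 1 / 3 * π) (by ring)
  rw [h1, h2, cos_sin_one_third.1, cos_sin_one_third.2]
  exact ⟨by ring, rfl⟩

lemma AngleMod.values_pi (h : AngleMod π lam) : cos lam = -1 ∧ sin lam = 0 := by
  rw [h.cos_sin.1, h.cos_sin.2, cos_pi, sin_pi]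
  exact ⟨rfl, rfl⟩

lemma AngleMod.values_two_pi (h : AngleMod (2 * π) lam) : cos lam = 1 ∧ sin lam = 0 := by
  rw [h.cos_sin.1, h.cos_sin.2, cos_two_pi, sin_two_pi]
  exact ⟨rfl, rfl⟩

lemma angleMod_cases (h : lam ∈ angles) :
    AngleMod (1 / 3 * π) lam ∨ AngleMod (5 / 3 * π) lam ∨ AngleMod (1 / 2 * π) lam ∨
      AngleMod (3 / 2 * π) lam ∨ AngleMod (2 / 3 * π) lam ∨ AngleMod (4 / 3 * π) lam ∨
      AngleMod π lam ∨ AngleMod (2 * π) lam := by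
  obtain ⟨lam₀, h₀, k, rfl⟩ := h
  have key : AngleMod lam₀ (lam₀ + k * π) ∨ AngleMod (lam₀ + π) (lam₀ + k * π) := by
    obtain ⟨j, rfl | rfl⟩ := k.even_or_odd'
    · exact Or.inl ⟨j, by push_cast; ring⟩
    · exact Or.inr ⟨j, by push_cast; ring⟩
  simp only [Set.mem_insert_iff, Set.mem_singleton_iff] at h₀
  generalize lam₀ + k * π = lam at key
  rcases h₀ with rfl | rfl | rfl | rfl
  · rw [show 1 / 3 * π + π = 4 / 3 * π by ring] at key
    tauto
  · rw [show 1 / 2 * π + π = 3 / 2 * π by ring] at key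
    tauto
  · rw [show 2 / 3 * π + π = 5 / 3 * π by ring] at key
    tauto
  · rw [← two_mul] at key
    tauto

/-- The angles other than the given one are excluded by the values of cosine and sine. -/
lemma not_angleMod {c s : ℝ} (h : cos lam = c ∧ sin lam = s) :
    ((c ≠ 1 / 2 ∨ s ≠ √3 / 2) → ¬AngleMod (1 / 3 * π) lam) ∧
    ((c ≠ 1 / 2 ∨ s ≠ -(√3 / 2)) → ¬AngleMod (5 / 3 * π) lam) ∧
    ((c ≠ 0 ∨ s ≠ 1) → ¬AngleMod (1 / 2 * π) lam) ∧
    ((c ≠ 0 ∨ s ≠ -1) → ¬AngleMod (3 / 2 * π) lam) ∧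
    ((c ≠ -1 / 2 ∨ s ≠ √3 / 2) → ¬AngleMod (2 / 3 * π) lam) ∧
    ((c ≠ -1 / 2 ∨ s ≠ -(√3 / 2)) → ¬AngleMod (4 / 3 * π) lam) ∧
    (c ≠ -1 → ¬AngleMod π lam) ∧ (c ≠ 1 → ¬AngleMod (2 * π) lam) := by
  obtain ⟨rfl, rfl⟩ := h
  have key : ∀ {p q : Prop}, p ∧ q → ¬(¬p ∨ ¬q) := by tauto
  exact ⟨fun h h' => key h'.values_one_third h, fun h h' => key h'.values_five_thirds h,
    fun h h' => key h'.values_one_half h, fun h h' => key h'.values_three_halves h,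
    fun h h' => key h'.values_two_thirds h, fun h h' => key h'.values_four_thirds h,
    fun h h' => h h'.values_pi.1, fun h h' => h h'.values_two_pi.1⟩

end Angles

/-! ### Matching each row of the list with a transversal. -/

section Table

variable {r : ℕ} {lam x y : ℝ}

lemma matrix_entries {D : OscData} (hD : IsStd D r lam x y) {A : Matrix (Fin 2) (Fin 2) ℤ}
    (hflow : ∀ ξ, D.flow 1 ξ = (realMat A).mulVec ξ) :
    sin lam = A 1 0 * y ∧ (A 0 0 : ℝ) = cos lam + A 1 0 * x ∧
      (A 1 1 : ℝ) = cos lam - A 1 0 * x ∧ (A 0 1 : ℝ) = -(A 1 0 * (x ^ 2 + y ^ 2)) := by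
  have hy := hD.y_pos
  have h1 := hflow ![1, 0]
  have h2 := hflow ![0, 1]
  rw [hD.flow, realMat_mulVec, one_mul] at h1 h2
  have e1 := congrFun h1 0
  have e2 := congrFun h1 1
  have e3 := congrFun h2 0
  have e4 := congrFun h2 1
  simp [Bmat] at e1 e2 e3 e4
  rw [← e1, ← e2, ← e3, ← e4]
  refine ⟨?_, ?_, ?_, ?_⟩ <;> field_simp <;> ring

lemma norm_eq_one_of_hexagonal (hx : x = 1 / 2) (hy : y = √3 / 2) : x ^ 2 + y ^ 2 = 1 := by
  rw [hx, hy, div_pow √3, sq_sqrt (by norm_num)]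
  norm_num

lemma hexagonal_of_norm_eq_one (hx : x = 1 / 2) (hy : 0 < y) (hN : x ^ 2 + y ^ 2 = 1) :
    y = √3 / 2 := by
  have h3 : √3 ^ 2 = 3 := sq_sqrt (by norm_num)
  have : y ^ 2 = (√3 / 2) ^ 2 := by
    rw [hx] at hN
    linear_combination hN - h3 / 4
  exact (sq_eq_sq₀ hy.le (by positivity)).mp this

/-- Squaring gives `n²y² = 3/4` while `y² ≥ 3/4`, so `n = ±1` and `y` is minimal in `F₁`, which
happens only at the corner. -/
lemma hexagonal_of_sin (hxy : (x, y) ∈ F₁) {n ε : ℤ} (hε : ε = 1 ∨ ε = -1)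
    (h : (n : ℝ) * y = ε * (√3 / 2)) : n = ε ∧ x = 1 / 2 ∧ y = √3 / 2 := by
  have h3 : √3 ^ 2 = 3 := sq_sqrt (by norm_num)
  have h3' : 0 < √3 := by positivity
  obtain ⟨hx0, hx1, hy, hN⟩ := id hxy
  simp only at hx0 hx1 hy hN
  have hε2 : (ε : ℝ) ^ 2 = 1 := by
    rcases hε with rfl | rfl <;> norm_num
  have hsq : ((n : ℝ) * y) ^ 2 = 3 / 4 := by
    rw [h, mul_pow, hε2, div_pow, h3]
    norm_num
  obtain ⟨hn1, hn2⟩ := abs_le_one_of_norm (a := 1 / 2) (c := (n : ℝ)) (t := 0) hxy (by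
    linear_combination hsq)
  have hn1' : -2 < n := by exact_mod_cast hn1
  have hn2' : n < 2 := by exact_mod_cast hn2
  have hnε : n = ε := by
    have hpos : 0 < ((n * ε : ℤ) : ℝ) := by
      push_cast
      have : (n * ε : ℝ) * y = √3 / 2 := by linear_combination ε * h + √3 / 2 * hε2
      exact pos_of_mul_pos_left (this ▸ by positivity) hy.le
    have hpos' : 0 < n * ε := by exact_mod_cast hpos
    rcases hε with rfl | rfl <;> omega
  have hy' : y = √3 / 2 := by
    rw [hnε] at h
    linear_combination ε * h + (√3 / 2 - y) * hε2
  refine ⟨hnε, ?_, hy'⟩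
  rw [hy', div_pow, h3] at hN
  nlinarith

/-- The bound on `y` gives `n = ε` and `y = 1`; then `x` is an integer in `[0, 1/2]`. -/
lemma square_of_sin (hxy : (x, y) ∈ F₁) {n ε a : ℤ} (hε : ε = 1 ∨ ε = -1)
    (h : (n : ℝ) * y = ε) (ha : (a : ℝ) = n * x) : n = ε ∧ x = 0 ∧ y = 1 := by
  obtain ⟨hx0, hx1, hy, hN⟩ := id hxy
  simp only at hx0 hx1 hy hN
  have hε2 : (ε : ℝ) ^ 2 = 1 := by
    rcases hε with rfl | rfl <;> norm_num
  have hsq : ((n : ℝ) * y) ^ 2 = 1 := by rw [h, hε2]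
  obtain ⟨hn1, hn2⟩ := abs_le_one_of_norm (a := 0) (c := (n : ℝ)) (t := 0) hxy (by
    linear_combination hsq)
  have hn1' : -2 < n := by exact_mod_cast hn1
  have hn2' : n < 2 := by exact_mod_cast hn2
  have hnε : n = ε := by
    have hpos : 0 < ((n * ε : ℤ) : ℝ) := by
      push_cast
      have : (n * ε : ℝ) * y = 1 := by linear_combination ε * h + hε2
      exact pos_of_mul_pos_left (this ▸ one_pos) hy.le
    have hpos' : 0 < n * ε := by exact_mod_cast hpos
    rcases hε with rfl | rfl <;> omega
  have hy' : y = 1 := by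
    rw [hnε] at h
    linear_combination ε * h + (1 - y) * hε2
  refine ⟨hnε, ?_, hy'⟩
  have hxa : x = ((ε * a : ℤ) : ℝ) := by
    push_cast
    rw [ha, hnε]
    linear_combination -x * hε2
  have h1 : (-1 : ℝ) < ((ε * a : ℤ) : ℝ) := by linarith
  have h2 : ((ε * a : ℤ) : ℝ) < 1 := by linarith
  have h1' : -1 < ε * a := by exact_mod_cast h1
  have h2' : ε * a < 1 := by exact_mod_cast h2
  rw [hxa, show ε * a = 0 by omega, Int.cast_zero]

lemma halfGrid_vec (r : ℕ) (a b : ℤ) :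
    halfGrid r ![a, b] = ![(a : ℝ) / (2 * r), (b : ℝ) / (2 * r)] := by
  ext i
  fin_cases i <;> rfl

lemma two_div_two_mul (r : ℕ) : (2 : ℝ) / (2 * r) = 1 / r := by
  rw [div_mul_eq_div_div, div_self two_ne_zero]

lemma three_div_two_mul (r : ℕ) : (3 : ℝ) / (2 * r) = 1 / (2 * r) + 1 / r := by
  rw [← two_div_two_mul, ← add_div]
  norm_num

lemma gridPoints_union (r : ℕ) (P Q : ℤ → ℤ → Prop) :
    gridPoints r P ∪ gridPoints r Q = gridPoints r fun k l => P k l ∨ Q k l := by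
  ext ξ
  constructor
  · rintro (⟨k, l, h, rfl⟩ | ⟨k, l, h, rfl⟩)
    · exact ⟨k, l, Or.inl h, rfl⟩
    · exact ⟨k, l, Or.inr h, rfl⟩
  · rintro ⟨k, l, h | h, rfl⟩
    · exact Or.inl ⟨k, l, h, rfl⟩
    · exact Or.inr ⟨k, l, h, rfl⟩

lemma gridPoints_or_single (r : ℕ) (P : ℤ → ℤ → Prop) (a b : ℤ) :
    (gridPoints r fun k l => (k = a ∧ l = b) ∨ P k l) =
      insert ![(a : ℝ) / r, (b : ℝ) / r] (gridPoints r P) := by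
  rw [← gridPoints_union, Set.insert_eq]
  congr 1
  ext ξ
  constructor
  · rintro ⟨k, l, ⟨rfl, rfl⟩, rfl⟩
    rfl
  · rintro rfl
    exact ⟨a, b, ⟨rfl, rfl⟩, rfl⟩

lemma gridPoints_single (r : ℕ) (a b : ℤ) :
    (gridPoints r fun k l => k = a ∧ l = b) = {![(a : ℝ) / r, (b : ℝ) / r]} := by
  ext ξ
  constructor
  · rintro ⟨k, l, ⟨rfl, rfl⟩, rfl⟩
    rfl
  · rintro rfl
    exact ⟨a, b, ⟨rfl, rfl⟩, rfl⟩

/-- The list `Ξ` is the image of a system of representatives. -/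
def HasTransversal (r : ℕ) (lam x y : ℝ) (A : Matrix (Fin 2) (Fin 2) ℤ) : Prop :=
  ∃ U, xiList r lam x y = halfGrid r '' U ∧ IsTransversal r x y A U

variable {A : Matrix (Fin 2) (Fin 2) ℤ}

/-- `A = cos λ + sin λ B_{x,y}`, in coordinates. -/
def IsRotation (lam x y : ℝ) (A : Matrix (Fin 2) (Fin 2) ℤ) : Prop :=
  sin lam = A 1 0 * y ∧ (A 0 0 : ℝ) = cos lam + A 1 0 * x ∧
    (A 1 1 : ℝ) = cos lam - A 1 0 * x ∧ (A 0 1 : ℝ) = -(A 1 0 * (x ^ 2 + y ^ 2))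

lemma IsRotation.hexagonal (h : IsRotation lam x y A) (hxy : (x, y) ∈ F₁) {γ ε : ℤ}
    (hε : ε = 1 ∨ ε = -1) (hc : cos lam = γ / 2) (hs : sin lam = ε * (√3 / 2)) :
    x = 1 / 2 ∧ y = √3 / 2 ∧ A 1 0 = ε ∧ A 0 1 = -ε ∧ 2 * A 0 0 = γ + ε ∧ 2 * A 1 1 = γ - ε := by
  obtain ⟨h10, h00, h11, h01⟩ := h
  obtain ⟨ha, hx, hy⟩ := hexagonal_of_sin hxy hε (h10.symm.trans hs)
  have hN := norm_eq_one_of_hexagonal hx hy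
  rw [hc, ha, hx] at h00 h11
  rw [ha, hN] at h01
  refine ⟨hx, hy, ha, ?_, ?_, ?_⟩
  · exact_mod_cast (by push_cast; linear_combination h01 : (A 0 1 : ℝ) = ((-ε : ℤ) : ℝ))
  · exact_mod_cast (by push_cast; linear_combination 2 * h00 :
      ((2 * A 0 0 : ℤ) : ℝ) = ((γ + ε : ℤ) : ℝ))
  · exact_mod_cast (by push_cast; linear_combination 2 * h11 :
      ((2 * A 1 1 : ℤ) : ℝ) = ((γ - ε : ℤ) : ℝ))

lemma IsRotation.square (h : IsRotation lam x y A) (hxy : (x, y) ∈ F₁) {ε : ℤ}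
    (hε : ε = 1 ∨ ε = -1) (hc : cos lam = 0) (hs : sin lam = ε) :
    x = 0 ∧ y = 1 ∧ A = !![0, -ε; ε, 0] := by
  obtain ⟨h10, h00, h11, h01⟩ := h
  rw [hc, zero_add] at h00
  obtain ⟨ha, hx, hy⟩ := square_of_sin hxy hε (h10.symm.trans hs) h00
  rw [hx, mul_zero] at h00
  rw [hc, hx, mul_zero, sub_zero] at h11
  rw [ha, hx, hy] at h01
  refine ⟨hx, hy, matrix_eq_of_entries (by exact_mod_cast h00) ?_ ha (by exact_mod_cast h11)⟩
  exact_mod_cast (by push_cast; linear_combination h01 : (A 0 1 : ℝ) = ((-ε : ℤ) : ℝ))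

lemma IsRotation.scalar (h : IsRotation lam x y A) (hy : 0 < y) {ε : ℤ} (hc : cos lam = ε)
    (hs : sin lam = 0) : A = !![ε, 0; 0, ε] := by
  obtain ⟨h10, h00, h11, h01⟩ := h
  rw [hs, zero_eq_mul, or_iff_left hy.ne'] at h10
  rw [hc, h10, zero_mul, add_zero] at h00
  rw [hc, h10, zero_mul, sub_zero] at h11
  rw [h10, zero_mul, neg_zero] at h01
  exact matrix_eq_of_entries (by exact_mod_cast h00) (by exact_mod_cast h01)
    (by exact_mod_cast h10) (by exact_mod_cast h11)

lemma hasTransversal_one_third (hlam : AngleMod (1 / 3 * π) lam) (hxy : (x, y) ∈ F₁)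
    (h : IsRotation lam x y A) : HasTransversal r lam x y A := by
  obtain ⟨-, n2, n3, n4, n5, n6, n7, n8⟩ := not_angleMod hlam.values_one_third
  have h3 : 0 < √3 := by positivity
  obtain ⟨hx, hy, h10, h01, h00, h11⟩ := h.hexagonal hxy (γ := 1) (ε := 1) (Or.inl rfl)
    (by rw [hlam.values_one_third.1]; norm_num) (by rw [hlam.values_one_third.2]; simp)
  have hA : A = !![1, -1; 1, 0] := matrix_eq_of_entries (by omega) h01 h10 (by omega)
  -- The values of cosine and sine exclude every other row, and `A` itself has forced `(x, y)` to be
  -- the hexagonal point.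
  have hxi : xiList r lam x y = byParity r {![0, 0]} {![1 / (2 * (r : ℝ)), 0]} := by
    simp only [xiList, hlam, hx, hy, n2 (by right; linarith), n3 (by left; norm_num),
      n4 (by left; norm_num), n5 (by left; norm_num), n6 (by left; norm_num), n7 (by norm_num),
      n8 (by norm_num), true_and, false_and, or_false, Set.ofPred_mem_eq]
  rw [HasTransversal, hxi, hA, byParity]
  split_ifs with hr
  · exact ⟨_, by simp [halfGrid_vec], isTransversal_order_six hxy.2.2.1 (b := 0)
      (by have := hr.two_dvd; omega)⟩
  · exact ⟨_, by simp [halfGrid_vec], isTransversal_order_six hxy.2.2.1 (b := 1)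
      (by rw [Nat.not_even_iff] at hr; omega)⟩

lemma hasTransversal_five_thirds (hlam : AngleMod (5 / 3 * π) lam) (hxy : (x, y) ∈ F₁)
    (h : IsRotation lam x y A) : HasTransversal r lam x y A := by
  obtain ⟨n1, -, n3, n4, n5, n6, n7, n8⟩ := not_angleMod hlam.values_five_thirds
  have h3 : 0 < √3 := by positivity
  obtain ⟨hx, hy, h10, h01, h00, h11⟩ := h.hexagonal hxy (γ := 1) (ε := -1) (Or.inr rfl)
    (by rw [hlam.values_five_thirds.1]; norm_num) (by rw [hlam.values_five_thirds.2]; simp)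
  have hA : A = !![0, 1; -1, 1] := matrix_eq_of_entries (by omega) h01 h10 (by omega)
  have hxi : xiList r lam x y = byParity r {![0, 0]} {![0, 1 / (2 * (r : ℝ))]} := by
    simp only [xiList, hlam, hx, hy, n1 (by right; linarith), n3 (by left; norm_num),
      n4 (by left; norm_num), n5 (by left; norm_num), n6 (by left; norm_num), n7 (by norm_num),
      n8 (by norm_num), true_and, false_and, or_false, false_or, Set.ofPred_mem_eq]
  rw [HasTransversal, hxi, hA, byParity]
  split_ifs with hr
  · exact ⟨_, by simp [halfGrid_vec], isTransversal_order_six_inv hxy.2.2.1 (b := 0)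
      (by have := hr.two_dvd; omega)⟩
  · exact ⟨_, by simp [halfGrid_vec], isTransversal_order_six_inv hxy.2.2.1 (b := 1)
      (by rw [Nat.not_even_iff] at hr; omega)⟩

lemma hasTransversal_of_order_four (hxy : (x, y) ∈ F₁) (hx : x = 0)
    (hA : A = !![0, -1; 1, 0] ∨ A = !![0, 1; -1, 0])
    (hxi : xiList r lam x y = byParity r {![0, 0], ![0, 1 / (r : ℝ)]} {![0, 0]}) :
    HasTransversal r lam x y A := by
  rw [HasTransversal, hxi, byParity]
  split_ifs with hr
  · exact ⟨_, by simp [Set.image_pair, halfGrid_vec, two_div_two_mul],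
      isTransversal_order_four_even hr hxy hx hA⟩
  · exact ⟨_, by simp [halfGrid_vec],
      isTransversal_order_four_odd hxy.2.2.1 (Nat.not_even_iff_odd.mp hr) hA⟩

lemma hasTransversal_one_half (hlam : AngleMod (1 / 2 * π) lam) (hxy : (x, y) ∈ F₁)
    (h : IsRotation lam x y A) : HasTransversal r lam x y A := by
  obtain ⟨n1, n2, -, n4, n5, n6, n7, n8⟩ := not_angleMod hlam.values_one_half
  obtain ⟨hx, hy, hA⟩ := h.square hxy (ε := 1) (Or.inl rfl) hlam.values_one_half.1
    (by rw [hlam.values_one_half.2]; simp)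
  refine hasTransversal_of_order_four hxy hx (Or.inl hA) ?_
  simp only [xiList, hlam, hx, hy, n1 (by left; norm_num), n2 (by left; norm_num),
    n4 (by right; norm_num), n5 (by left; norm_num), n6 (by left; norm_num), n7 (by norm_num),
    n8 (by norm_num), true_and, false_and, or_false, false_or, Set.ofPred_mem_eq]

lemma hasTransversal_three_halves (hlam : AngleMod (3 / 2 * π) lam) (hxy : (x, y) ∈ F₁)
    (h : IsRotation lam x y A) : HasTransversal r lam x y A := by
  obtain ⟨n1, n2, n3, -, n5, n6, n7, n8⟩ := not_angleMod hlam.values_three_halves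
  obtain ⟨hx, hy, hA⟩ := h.square hxy (ε := -1) (Or.inr rfl) hlam.values_three_halves.1
    (by rw [hlam.values_three_halves.2]; simp)
  refine hasTransversal_of_order_four hxy hx (Or.inr (by rw [hA, neg_neg])) ?_
  simp only [xiList, hlam, hx, hy, n1 (by left; norm_num), n2 (by left; norm_num),
    n3 (by right; norm_num), n5 (by left; norm_num), n6 (by left; norm_num), n7 (by norm_num),
    n8 (by norm_num), true_and, false_and, or_false, false_or, Set.ofPred_mem_eq]

lemma hasTransversal_two_thirds (hlam : AngleMod (2 / 3 * π) lam) (hxy : (x, y) ∈ F₁)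
    (h : IsRotation lam x y A) : HasTransversal r lam x y A := by
  obtain ⟨n1, n2, n3, n4, -, n6, n7, n8⟩ := not_angleMod hlam.values_two_thirds
  have h3 : 0 < √3 := by positivity
  obtain ⟨hx, hy, h10, h01, h00, h11⟩ := h.hexagonal hxy (γ := -1) (ε := 1) (Or.inl rfl)
    (by rw [hlam.values_two_thirds.1]; norm_num) (by rw [hlam.values_two_thirds.2]; simp)
  have hA : A = !![0, -1; 1, -1] := matrix_eq_of_entries (by omega) h01 h10 (by omega)
  have hxi : xiList r lam x y = byParity r
      (byThree r {![0, 0], ![1 / (r : ℝ), 0]} {![0, 0]})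
      (byThree r {![0, 1 / (2 * (r : ℝ))], ![1 / (r : ℝ), 1 / (2 * (r : ℝ))]}
        {![0, 1 / (2 * (r : ℝ))]}) := by
    simp only [xiList, hlam, hx, hy, n1 (by left; norm_num), n2 (by left; norm_num),
      n3 (by left; norm_num), n4 (by left; norm_num), n6 (by right; linarith), n7 (by norm_num),
      n8 (by norm_num), true_and, false_and, or_false, false_or, Set.ofPred_mem_eq]
  rw [HasTransversal, hxi, byParity, byThree, byThree]
  have hc : ∀ a b : ℤ, 2 ∣ a → 2 ∣ (r : ℤ) - b → Compat r A ![a, b] := by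
    intro a b ha hb
    rw [hA]
    simp [Compat]
    omega
  split_ifs with hr h3r h3r
  · have hr' := hr.two_dvd
    exact ⟨_, by simp [Set.image_pair, halfGrid_vec, two_div_two_mul],
      isTransversal_order_three_of_dvd hxy hx h3r (Or.inl hA) (t := ![0, 0]) (t' := ![2, 0])
        (hc _ _ (by simp) (by omega)) (hc _ _ (by simp) (by omega)) (by simp) (by simp)⟩
  · have hr' := hr.two_dvd
    exact ⟨_, by simp [halfGrid_vec], isTransversal_order_three_of_not_dvd hxy.2.2.1 h3r
      (Or.inl hA) (t := ![0, 0]) (hc _ _ (by simp) (by omega))⟩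
  · rw [Nat.not_even_iff] at hr
    exact ⟨_, by simp [Set.image_pair, halfGrid_vec, two_div_two_mul, Set.pair_comm],
      -- The sum-zero class is represented by `(2, 1)`, the second entry of the list.
      isTransversal_order_three_of_dvd hxy hx h3r (Or.inl hA) (t := ![2, 1]) (t' := ![0, 1])
        (hc _ _ (by simp) (by omega)) (hc _ _ (by simp) (by omega)) (by simp) (by simp)⟩
  · rw [Nat.not_even_iff] at hr
    exact ⟨_, by simp [halfGrid_vec], isTransversal_order_three_of_not_dvd hxy.2.2.1 h3r
      (Or.inl hA) (t := ![0, 1]) (hc _ _ (by simp) (by omega))⟩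

lemma hasTransversal_four_thirds (hlam : AngleMod (4 / 3 * π) lam) (hxy : (x, y) ∈ F₁)
    (h : IsRotation lam x y A) : HasTransversal r lam x y A := by
  obtain ⟨n1, n2, n3, n4, n5, -, n7, n8⟩ := not_angleMod hlam.values_four_thirds
  have h3 : 0 < √3 := by positivity
  obtain ⟨hx, hy, h10, h01, h00, h11⟩ := h.hexagonal hxy (γ := -1) (ε := -1) (Or.inr rfl)
    (by rw [hlam.values_four_thirds.1]; norm_num) (by rw [hlam.values_four_thirds.2]; simp)
  have hA : A = !![-1, 1; -1, 0] := matrix_eq_of_entries (by omega) h01 h10 (by omega)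
  have hxi : xiList r lam x y = byParity r
      (byThree r {![0, 0], ![1 / (r : ℝ), 0]} {![0, 0]})
      (byThree r {![1 / (2 * (r : ℝ)), 0], ![1 / (2 * (r : ℝ)) + 1 / (r : ℝ), 0]}
        {![1 / (2 * (r : ℝ)), 0]}) := by
    simp only [xiList, hlam, hx, hy, n1 (by left; norm_num), n2 (by left; norm_num),
      n3 (by left; norm_num), n4 (by left; norm_num), n5 (by right; linarith), n7 (by norm_num),
      n8 (by norm_num), true_and, false_and, or_false, false_or, Set.ofPred_mem_eq]
  rw [HasTransversal, hxi, byParity, byThree, byThree]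
  have hc : ∀ a : ℤ, 2 ∣ (r : ℤ) - a → Compat r A ![a, 0] := by
    intro a ha
    rw [hA]
    simp [Compat]
    omega
  split_ifs with hr h3r h3r
  · have hr' := hr.two_dvd
    exact ⟨_, by simp [Set.image_pair, halfGrid_vec, two_div_two_mul],
      isTransversal_order_three_of_dvd hxy hx h3r (Or.inr hA) (t := ![0, 0]) (t' := ![2, 0])
        (hc _ (by omega)) (hc _ (by omega)) (by simp) (by simp)⟩
  · have hr' := hr.two_dvd
    exact ⟨_, by simp [halfGrid_vec], isTransversal_order_three_of_not_dvd hxy.2.2.1 h3r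
      (Or.inr hA) (t := ![0, 0]) (hc _ (by omega))⟩
  · rw [Nat.not_even_iff] at hr
    exact ⟨_, by simp [Set.image_pair, halfGrid_vec, three_div_two_mul, Set.pair_comm],
      -- Again the second listed entry, `1/(2r) + 1/r = 3/(2r)`, gives the sum-zero class.
      isTransversal_order_three_of_dvd hxy hx h3r (Or.inr hA) (t := ![3, 0]) (t' := ![1, 0])
        (hc _ (by omega)) (hc _ (by omega)) (by simp) (by simp)⟩
  · rw [Nat.not_even_iff] at hr
    exact ⟨_, by simp [halfGrid_vec], isTransversal_order_three_of_not_dvd hxy.2.2.1 h3r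
      (Or.inr hA) (t := ![1, 0]) (hc _ (by omega))⟩

lemma hasTransversal_pi (hlam : AngleMod π lam) (hxy : (x, y) ∈ F₁)
    (h : IsRotation lam x y A) : HasTransversal r lam x y A := by
  obtain ⟨n1, n2, n3, n4, n5, n6, -, n8⟩ := not_angleMod hlam.values_pi
  have hA : A = -1 := by
    rw [h.scalar hxy.2.2.1 (ε := -1) (by rw [hlam.values_pi.1]; simp) hlam.values_pi.2]
    decide
  have hy0 := hxy.2.2.1
  have hN := hxy.2.2.2
  simp only at hN hy0
  -- For odd `r` all four rows for the angle `π` have the same single representative, whatever their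
  -- even part `E`.
  have hodd : ∀ E, xiList r lam x y = byParity r E {![0, 0]} → ¬Even r → ∃ U,
      xiList r lam x y = halfGrid r '' U ∧ IsTransversal r x y (-1) U := by
    intro E hE hr
    refine ⟨_, ?_, isTransversal_neg_one_odd (Nat.not_even_iff_odd.mp hr) hy0⟩
    rw [hE, byParity, if_neg hr, ← gridPoints_eq_image, gridPoints_single]
    simp
  have hxi : xiList r lam x y = {ξ |
      (1 < x ^ 2 + y ^ 2 ∧ x ≠ 1 / 2 ∧ ξ ∈ byParity r {![0, 0], ![1 / (r : ℝ), 0],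
        ![0, 1 / (r : ℝ)], ![1 / (r : ℝ), 1 / (r : ℝ)]} {![0, 0]}) ∨
      (1 < x ^ 2 + y ^ 2 ∧ x = 1 / 2 ∧ ξ ∈ byParity r {![0, 0], ![1 / (r : ℝ), 0],
        ![1 / (r : ℝ), 1 / (r : ℝ)]} {![0, 0]}) ∨
      (x ^ 2 + y ^ 2 = 1 ∧ x ≠ 1 / 2 ∧ ξ ∈ byParity r {![0, 0], ![1 / (r : ℝ), 0],
        ![1 / (r : ℝ), 1 / (r : ℝ)]} {![0, 0]}) ∨
      (x = 1 / 2 ∧ y = √3 / 2 ∧ ξ ∈ byParity r {![0, 0],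
        ![1 / (r : ℝ), 1 / (r : ℝ)]} {![0, 0]})} := by
    simp only [xiList, hlam, n1 (by left; norm_num), n2 (by left; norm_num),
      n3 (by left; norm_num), n4 (by left; norm_num), n5 (by left; norm_num),
      n6 (by left; norm_num), n8 (by norm_num), true_and, false_and, or_false, false_or]
  rw [HasTransversal, hA]
  rcases hN.lt_or_eq with hN | hN
  · by_cases hx : x = 1 / 2
    · have hy : y ≠ √3 / 2 := fun hy => hN.ne' (norm_eq_one_of_hexagonal hx hy)
      simp only [eq_true hx, eq_true hN, eq_false hN.ne', eq_false hy, ne_eq, true_and, false_and,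
      and_false, not_true_eq_false, or_false, false_or, Set.ofPred_mem_eq] at hxi
      by_cases hr : Even r
      · refine ⟨_, ?_, isTransversal_neg_one_x_half hr hxy hN hx⟩
        rw [hxi, byParity, if_pos hr, ← gridPoints_eq_image, gridPoints_or_single,
          gridPoints_or_single, gridPoints_single]
        simp
      · exact hodd _ hxi hr
    · simp only [eq_false hx, eq_true hN, eq_false hN.ne', ne_eq, true_and, false_and,
      and_false, not_false_eq_true, or_false, Set.ofPred_mem_eq] at hxi
      by_cases hr : Even r
      · refine ⟨_, ?_, isTransversal_neg_one_generic hr hxy hN hx⟩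
        rw [hxi, byParity, if_pos hr, ← gridPoints_eq_image, gridPoints_or_single,
          gridPoints_or_single, gridPoints_or_single, gridPoints_single]
        simp
      · exact hodd _ hxi hr
  · replace hN := hN.symm
    by_cases hx : x = 1 / 2
    · have hy := hexagonal_of_norm_eq_one hx hy0 hN
      simp only [eq_true hx, eq_true hN, eq_false hN.not_gt, eq_true hy, ne_eq, true_and, false_and,
      and_false, not_true_eq_false, false_or, Set.ofPred_mem_eq] at hxi
      by_cases hr : Even r
      · refine ⟨_, ?_, isTransversal_neg_one_hexagonal hr hxy hN hx⟩
        rw [hxi, byParity, if_pos hr, ← gridPoints_eq_image, gridPoints_or_single,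
          gridPoints_single]
        simp
      · exact hodd _ hxi hr
    · simp only [eq_false hx, eq_true hN, eq_false hN.not_gt, ne_eq, true_and, false_and,
      and_false, not_false_eq_true, or_false, false_or, Set.ofPred_mem_eq] at hxi
      by_cases hr : Even r
      · refine ⟨_, ?_, isTransversal_neg_one_norm_one hr hxy hN hx⟩
        rw [hxi, byParity, if_pos hr, ← gridPoints_eq_image, gridPoints_or_single,
          gridPoints_or_single, gridPoints_single]
        simp
      · exact hodd _ hxi hr

lemma hasTransversal_two_pi (hr : 0 < r) (hlam : AngleMod (2 * π) lam) (hxy : (x, y) ∈ F₁)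
    (h : IsRotation lam x y A) : HasTransversal r lam x y A := by
  obtain ⟨n1, n2, n3, n4, n5, n6, n7, -⟩ := not_angleMod hlam.values_two_pi
  have hA : A = 1 := by
    rw [h.scalar hxy.2.2.1 (ε := 1) (by rw [hlam.values_two_pi.1]; simp) hlam.values_two_pi.2]
    decide
  have hy0 := hxy.2.2.1
  have hN := hxy.2.2.2
  simp only at hN hy0
  have h02 : (0 : ℝ) ≠ 1 / 2 := by norm_num
  rw [HasTransversal, hA]
  have key : ∀ {P : ℤ → ℤ → Prop}, IsTransversal r x y 1 (evenPoints P) →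
      xiList r lam x y = gridPoints r P → ∃ U,
        xiList r lam x y = halfGrid r '' U ∧ IsTransversal r x y 1 U :=
    fun hP hx => ⟨_, by rw [hx, gridPoints_eq_image], hP⟩
  replace n1 := n1 (by left; norm_num)
  replace n2 := n2 (by left; norm_num)
  replace n3 := n3 (by left; norm_num)
  replace n4 := n4 (by left; norm_num)
  replace n5 := n5 (by left; norm_num)
  replace n6 := n6 (by left; norm_num)
  replace n7 := n7 (by norm_num)
  rcases hN.lt_or_eq with hN | hN
  · by_cases hx : x = 1 / 2
    · have hx' : x ≠ 0 := by rw [hx]; exact h02.symm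
      have hy : y ≠ √3 / 2 := fun hy => hN.ne' (norm_eq_one_of_hexagonal hx hy)
      refine key (isTransversal_one_x_half hr hxy hN hx) ?_
      simp only [xiList, n1, n2, n3, n4, n5, n6, n7, hlam, eq_true hx, eq_true hN,
        eq_false hN.ne', eq_false hx', eq_false hy, ne_eq, true_and, false_and,
      and_false, not_true_eq_false, not_false_eq_true, or_false, false_or, Set.ofPred_mem_eq, gridPoints_union]
    · by_cases hx' : x = 0
      · have hy : y ≠ 1 := fun hy => hN.ne' (by rw [hx', hy]; norm_num)
        refine key (isTransversal_one_x_zero hr hxy hN hx') ?_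
        simp only [xiList, n1, n2, n3, n4, n5, n6, n7, hlam, eq_false hx, eq_true hN,
          eq_false hN.ne', eq_true hx', eq_false hy, ne_eq, true_and, false_and,
      and_false, not_true_eq_false, not_false_eq_true, or_false, false_or, Set.ofPred_mem_eq]
      · refine key (isTransversal_one_generic hr hxy hN hx' hx) ?_
        simp only [xiList, n1, n2, n3, n4, n5, n6, n7, hlam, eq_false hx, eq_true hN,
          eq_false hN.ne', eq_false hx', ne_eq, true_and, false_and,
      and_false, not_false_eq_true, or_false, false_or, Set.ofPred_mem_eq, gridPoints_union]
  · replace hN := hN.symm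
    by_cases hx : x = 1 / 2
    · have hx' : x ≠ 0 := by rw [hx]; exact h02.symm
      have hy := hexagonal_of_norm_eq_one hx hy0 hN
      refine key (isTransversal_one_hexagonal hr hxy hN hx) ?_
      simp only [xiList, n1, n2, n3, n4, n5, n6, n7, hlam, eq_true hx, eq_true hN,
        eq_false hN.not_gt, eq_false hx', eq_true hy, ne_eq, true_and, false_and,
      and_false, not_true_eq_false, not_false_eq_true, false_or, Set.ofPred_mem_eq]
    · by_cases hx' : x = 0
      · have hy : y = 1 := by
          have : y ^ 2 = 1 ^ 2 := by
            rw [hx'] at hN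
            linear_combination hN
          exact (sq_eq_sq₀ hy0.le zero_le_one).mp this
        refine key (isTransversal_one_square hr hxy hN hx') ?_
        simp only [xiList, n1, n2, n3, n4, n5, n6, n7, hlam, eq_false hx, eq_true hN,
          eq_false hN.not_gt, eq_true hx', eq_true hy, ne_eq, true_and, false_and,
      and_false, not_true_eq_false, not_false_eq_true, or_false, false_or, Set.ofPred_mem_eq]
      · refine key (isTransversal_one_norm_one hr hxy hN hx' hx) ?_
        simp only [xiList, n1, n2, n3, n4, n5, n6, n7, hlam, eq_false hx, eq_true hN,
          eq_false hN.not_gt, eq_false hx', ne_eq, true_and, false_and,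
      and_false, not_false_eq_true, or_false, false_or, Set.ofPred_mem_eq, gridPoints_union]

theorem hasTransversal (hr : 0 < r) (hlam : lam ∈ angles) (hxy : (x, y) ∈ F₁)
    (h : IsRotation lam x y A) : HasTransversal r lam x y A := by
  rcases angleMod_cases hlam with h' | h' | h' | h' | h' | h' | h' | h'
  · exact hasTransversal_one_third h' hxy h
  · exact hasTransversal_five_thirds h' hxy h
  · exact hasTransversal_one_half h' hxy h
  · exact hasTransversal_three_halves h' hxy h
  · exact hasTransversal_two_thirds h' hxy h
  · exact hasTransversal_four_thirds h' hxy h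
  · exact hasTransversal_pi h' hxy h
  · exact hasTransversal_two_pi hr h' hxy h

end Table

end OscLattice

end

/-! ### The classification theorem. -/

theorem mainTheorem4 (r : ℕ) (hr : 0 < r) (lam : ℝ) (hlam : lam ∈ OscLattice.angles)
    (x y : ℝ) (hxy : (x, y) ∈ OscLattice.F₁) (z : ℝ) (ξ : Fin 2 → ℝ)
    (L : Subgroup (OscLattice.Osc
      (OscLattice.stdData hr (OscLattice.angles_pos hlam) x hxy.2.2.1)))
    (hgen : L = OscLattice.Osc.generated _ z ξ)
    (hL : OscLattice.Osc.IsLattice L)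
    (hLH : L ⊓ OscLattice.Osc.heisenberg _ = OscLattice.Osc.Γ _) :
    ∃ ξ₀ ∈ OscLattice.xiList r lam x y,
      (OscLattice.Osc.IsLattice (OscLattice.Osc.generated
          (OscLattice.stdData hr (OscLattice.angles_pos hlam) x hxy.2.2.1) 0 ξ₀) ∧
        OscLattice.Osc.generated _ 0 ξ₀ ⊓ OscLattice.Osc.heisenberg
          (OscLattice.stdData hr (OscLattice.angles_pos hlam) x hxy.2.2.1) =
            OscLattice.Osc.Γ _ ∧
        OscLattice.Osc.Equivalent L (OscLattice.Osc.generated _ 0 ξ₀)) ∧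
      ∀ ξ₁ ∈ OscLattice.xiList r lam x y,
        OscLattice.Osc.Equivalent L (OscLattice.Osc.generated _ 0 ξ₁) → ξ₁ = ξ₀ := by
  have hD := OscLattice.isStd_stdData hr (OscLattice.angles_pos hlam) x hxy.2.2.1
  subst hgen
  obtain ⟨A, hA, hflow, u, rfl, hu⟩ := OscLattice.Osc.exists_matrix_of_inf_heisenberg hD hLH
  obtain ⟨U, hxi, hU⟩ :=
    OscLattice.hasTransversal hr hlam hxy (OscLattice.matrix_entries hD hflow)
  rw [hxi]
  exact OscLattice.classification_of_transversal hD hA hflow hU hu hL
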